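/- **Conventions.** For a finite set $S$, $\mathcal F(S)$ is the free group on $S$ and $|w|$ is the length of the reduced word $w\in\mathcal F(S)$. For a presentation $\langle S:R\rangle$ with $R\subset\mathcal F(S)$ and a word $w\in\mathcal F(S)$ that is trivial in $G=\langle S:R\rangle$, $\mathrm{Area}_G(w)$ is the minimum $t\ge 1$ such that $w=z_1r_1^{a_1}z_1^{-1}\cdots z_tr_t^{a_t}z_t^{-1}$ in $\mathcal F(S)$ for some $r_i\in R$, $z_i\in\mathcal F(S)$, $a_i\in\{\pm1\}$. A group over $\mathbb Z_2$ is a group $G$ with a central element $J_G$ such that $J_G^2=1$ (possibly $J_G=1$). For an $m\times n$ linear system $Mx=c$ over $\mathbb Z_2$, the solution group $\Gamma_{Mx=c}$ is the group with generators $x_1,\dots,x_n,J$ and relations $J^2=1$; $x_j^2=1$ and $x_jJx_j^{-1}J^{-1}=1$ for all $j$; $\prod_j x_j^{M_{ij}}=J^{c_i}$ for all $1\le i\le m$; and $x_jx_kx_j^{-1}x_k^{-1}=1$ whenever $M_{ij},M_{ik}\ne0$ for some $i$. Put $J_\Gamma=J$. **Theorem 4.1.** There are a constant $C$, a polynomial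 $p$ and an algorithm (a multi-stack Turing machine) such that the following holds. Let $G=\langle S:R\rangle$ be a finitely presented group over $\mathbb Z_2$ with $J_G\in S$, and let $N=|S|+\sum_{r\in R}|r|$ be the size of the presentation. Then there are an $m\times n$ linear system $Mx=c$ over $\mathbb Z_2$, with solution group $\Gamma=\Gamma_{Mx=c}$, and a homomorphism $\phi:\mathcal F(S)\to\mathcal F(x_1,\dots,x_n,J)$ such that (a) $\phi(J_G)=J_\Gamma$, and $\phi$ descends to an injective homomorphism $G\to\Gamma_{Mx=c}$; (b) $|\phi(w)|\le 4|w|$ for all $w\in\mathcal F(S)$, and $\mathrm{Area}_\Gamma(\phi(w))\le C\cdot N\cdot\mathrm{Area}_G(w)$ for all $w\in\mathcal F(S)$ that are trivial in $G$; (c) $M$ has exactly three non-zero entries in every row, $m\le CN$ and $n\le CN$, and the algorithm, given $\langle S:R\rangle$ and $J_G$, outputs $M$ and $c$ after at most $p(N)$ steps. -/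

import Mathlib

/-- A finite group presentation `⟨S : R⟩` together with a distinguished generator `J ∈ S`.
The finite generating set is `S = Fin numGens`; the finite set of relators `R` is given as a list
without repetitions of elements of the free group on `S`. -/
structure FinPres where
  numGens : ℕ
  J : Fin numGens
  rels : List (FreeGroup (Fin numGens))
  nodup : rels.Nodup

namespace FinPres

/-- The set of relators. -/
def relSet (P : FinPres) : Set (FreeGroup (Fin P.numGens)) := {r | r ∈ P.rels}

/-- The group defined by the presentation. -/
abbrev Grp (P : FinPres) : Type := PresentedGroup P.relSet

/-- `(G, J)` is a group over `ℤ₂`: `J` is central in `G` and `J² = 1` (`J = 1` is allowed). -/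
def IsOverZ2 (P : FinPres) : Prop :=
  (PresentedGroup.of P.J : P.Grp) ∈ Subgroup.center P.Grp ∧
    (PresentedGroup.of P.J : P.Grp) ^ 2 = 1

/-- The size `|S| + ∑_{r ∈ R} |r|` of the presentation, `|r|` being the reduced word length. -/
def size (P : FinPres) : ℕ := P.numGens + (P.rels.map FreeGroup.norm).sum

end FinPres

/-- `w = z₁ r₁^{±1} z₁⁻¹ ⋯ z_t r_t^{±1} z_t⁻¹` in the free group, with all `rᵢ` in `R`. -/
def IsConjProduct {α : Type} (R : Set (FreeGroup α)) (w : FreeGroup α) (t : ℕ) : Prop :=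
  ∃ (z r : Fin t → FreeGroup α) (a : Fin t → ℤ),
    (∀ i, r i ∈ R) ∧ (∀ i, a i = 1 ∨ a i = -1) ∧
      w = (List.ofFn fun i => z i * r i ^ a i * (z i)⁻¹).prod

/-- The area of a word `w` that is trivial in `⟨α : R⟩`: the least `t ≥ 1` such that `w` is a
product of `t` conjugates of relators and their inverses.
(Only used for `w` trivial in `⟨α : R⟩` and `R ≠ ∅`, where such a `t` exists.) -/
noncomputable def wordArea {α : Type} (R : Set (FreeGroup α)) (w : FreeGroup α) : ℕ :=
  sInf {t : ℕ | 1 ≤ t ∧ IsConjProduct R w t}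

namespace LinSys

variable {m n : ℕ}

/-- The generator `x_j` of the solution group. The generating set is `Option (Fin n)`. -/
def x (j : Fin n) : FreeGroup (Option (Fin n)) := FreeGroup.of (some j)

/-- The generator `J` of the solution group. -/
def J : FreeGroup (Option (Fin n)) := FreeGroup.of none

/-- The defining relators of the solution group of `M x = c`. -/
inductive SolRel (M : Matrix (Fin m) (Fin n) (ZMod 2)) (c : Fin m → ZMod 2) :
    FreeGroup (Option (Fin n)) → Prop
  | comm_J (j : Fin n) : SolRel M c (x j * J * (x j)⁻¹ * J⁻¹)
  | sq_x (j : Fin n) : SolRel M c (x j ^ 2)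
  | sq_J : SolRel M c (J ^ 2)
  | eqn (i : Fin m) :
      SolRel M c ((List.ofFn fun j => x j ^ (M i j).val).prod * (J ^ (c i).val)⁻¹)
  | comm_x (i : Fin m) (j k : Fin n) (hj : M i j ≠ 0) (hk : M i k ≠ 0) :
      SolRel M c (x j * x k * (x j)⁻¹ * (x k)⁻¹)

/-- The set of defining relators of the solution group. -/
def solRels (M : Matrix (Fin m) (Fin n) (ZMod 2)) (c : Fin m → ZMod 2) :
    Set (FreeGroup (Option (Fin n))) := {r | SolRel M c r}

/-- The solution group `Γ` of `M x = c`. -/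
abbrev SolGroup (M : Matrix (Fin m) (Fin n) (ZMod 2)) (c : Fin m → ZMod 2) : Type :=
  PresentedGroup (solRels M c)

end LinSys

/-- Symbols of the string encoding of a presentation. -/
inductive PresSymbol
  | tick
  | pos
  | neg
  | sep

/-- A letter `s_i^{±1}`: the index `i` in unary, followed by the sign of the exponent. -/
def encodeLetter {k : ℕ} (l : Fin k × Bool) : List PresSymbol :=
  List.replicate l.1.val PresSymbol.tick ++ [if l.2 then PresSymbol.pos else PresSymbol.neg]

/-- The string encoding of a presentation: the number of generators in unary, the index of `J` in
unary, then the relators as reduced words, each part being terminated by `sep`. The length of this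
string is bounded by a polynomial in the size of the presentation. -/
def FinPres.encode (P : FinPres) : List PresSymbol :=
  List.replicate P.numGens PresSymbol.tick ++ [PresSymbol.sep] ++
    List.replicate P.J.val PresSymbol.tick ++ [PresSymbol.sep] ++
      P.rels.flatMap fun r => r.toWord.flatMap encodeLetter ++ [PresSymbol.sep]

/-- Symbols of the string encoding of a linear system over `ℤ₂`. -/
inductive SysSymbol
  | tick
  | bit (b : ZMod 2)
  | sep

/-- The string encoding of `M x = c`: the number of variables in unary, then the rows of the
augmented matrix `(M | c)`, each part being terminated by `sep`. -/
def LinSys.encode {m n : ℕ} (M : Matrix (Fin m) (Fin n) (ZMod 2)) (c : Fin m → ZMod 2) :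
    List SysSymbol :=
  List.replicate n SysSymbol.tick ++ [SysSymbol.sep] ++
    (List.ofFn fun i =>
      (List.ofFn fun j => SysSymbol.bit (M i j)) ++ [SysSymbol.bit (c i), SysSymbol.sep]).flatten

/-- Started on the encoding of `P`, the Turing machine `T` halts after at most `t` steps with the
encoding of the system `M x = c` as its output. -/
def ConstructsInTime (T : Turing.TM2ComputableAux PresSymbol SysSymbol) (P : FinPres) {m n : ℕ}
    (M : Matrix (Fin m) (Fin n) (ZMod 2)) (c : Fin m → ZMod 2) (t : ℕ) : Prop :=
  Nonempty (Turing.TM2OutputsInTime T.tm (P.encode.map T.inputAlphabet.symm)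
    (some ((LinSys.encode M c).map T.outputAlphabet.symm)) t)

/-! Each generator `s` of `G` is written as a product of two involutions, `s = gen s true * gen s
false`, so that `s⁻¹` is the product in the opposite order. An equation `a + b + c = 0` between
involutions says `a = b c`. Equations `x_i = A_i A_{i+1}` with cyclic indices (a wheel with spokes
`A_i`) therefore force `x_0 x_1 ⋯ = 1` by telescoping.

A relator `s_1 ⋯ s_l` is cut into blocks. The equations of a letter give `s_i = y_i z_i`. A wheel of
length four gives `z_i y_{i+1} = u_i v_i`, where one fixed hub `h` stands for `z_0` and `y_{l+1}`.
Inner wheels, all based at one involution `A_0`, give `u_i = A_{2i} A_{2i+1}` and `v_i = A_{2i+1}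
A_{2i+2}`. Hence `h s_1 ⋯ s_l h = ∏ u_i v_i = 1`. Every letter uses boundedly many variables and
equations, so the system has linear size, and every letter costs boundedly many relators of the
solution group. Counting them gives the area bound (`CloseSol.relator`, `CloseSol.lift_rel`).

For injectivity it suffices to solve the equations by involutions commuting with `J` in some group
containing `G` (`exists_valuation`); commutation inside an equation is then automatic
(`commute_of_mul_eq`). The difficulty is to find the spokes `A_i` for given `x_i`. If the `x_i` are
free apart from being involutions with product `1` around the cycles, there is an involutive
automorphism inverting all prefix products `p_i = x_0 ⋯ x_{i-1}` (`Flower.flip`). In the symmetric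
group on the ambient group it is conjugation by an involution `a` (`exists_involution_conj`), and
`A_i = a p_i` is a solution (`Flower.exists_petals`). To make the `x_i` free in this sense, the
remaining variables take values in a product of `Equiv.Perm G` with permutation groups of the
universal groups, one factor for each four-wheel and one for the inner wheels (`exists_genericSol`).

The system is computable in polynomial time because an equation involves only one generator, the
global variables and two consecutive blocks: a finite program with unary counters prints each row
around this window. -/

/-! ### Stack programs and their compilation to multi-stack Turing machines. -/

/-- Structured programs acting on finitely many stacks. -/
inductive StackProg {K : Type} (Γ : K → Type) : Type
  | skip : StackProg Γ
  | push (k : K) (a : Γ k) : StackProg Γ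
  | pop (k : K) : StackProg Γ
  | seq (p q : StackProg Γ) : StackProg Γ
  | ite (k : K) (c : Option (Γ k) → Bool) (p q : StackProg Γ) : StackProg Γ
  | loop (k : K) (c : Option (Γ k) → Bool) (p : StackProg Γ) : StackProg Γ

namespace StackProg

variable {K : Type} {Γ : K → Type}

/-- The program points of a program. -/
def Label : StackProg Γ → Type
  | skip => Unit
  | push _ _ => Unit
  | pop _ => Unit
  | seq p q => Label p ⊕ Label q
  | ite _ _ p q => Option (Label p ⊕ Label q)
  | loop _ _ p => Option (Label p)

/-- The set of program points is finite. -/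
@[reducible]
def labelFintype : (p : StackProg Γ) → Fintype (Label p)
  | skip => inferInstanceAs (Fintype Unit)
  | push _ _ => inferInstanceAs (Fintype Unit)
  | pop _ => inferInstanceAs (Fintype Unit)
  | seq p q =>
    letI := labelFintype p; letI := labelFintype q
    inferInstanceAs (Fintype (Label p ⊕ Label q))
  | ite _ _ p q =>
    letI := labelFintype p; letI := labelFintype q
    inferInstanceAs (Fintype (Option (Label p ⊕ Label q)))
  | loop _ _ p =>
    letI := labelFintype p
    inferInstanceAs (Fintype (Option (Label p)))

/-- The first program point. -/
def entry : (p : StackProg Γ) → Label p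
  | skip => ()
  | push _ _ => ()
  | pop _ => ()
  | seq p _ => Sum.inl (entry p)
  | ite _ _ _ _ => none
  | loop _ _ _ => none

open Turing.TM2 in
/-- A conditional jump depending on the top of a stack. -/
def jump {Λ : Type} (k : K) (c : Option (Γ k) → Bool) (l₁ l₂ : Λ) : Stmt Γ Λ Bool :=
  -- The Boolean register only carries the test to the branch. Both branches reset it, so every
  -- program point is reached with register `false`.
  .peek k (fun _ o => c o) <| .branch id (.load (fun _ => false) <| .goto fun _ => l₁)
    (.load (fun _ => false) <| .goto fun _ => l₂)

open Turing.TM2 in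
/-- The machine code of a program, whose program points are placed at `e` and which continues at
`ex`. -/
def code : (p : StackProg Γ) → {Λ : Type} → (Label p → Λ) → Λ → Label p → Stmt Γ Λ Bool
  | skip, _, _, ex, _ => .goto fun _ => ex
  | push k a, _, _, ex, _ => .push k (fun _ => a) <| .goto fun _ => ex
  | pop k, _, _, ex, _ => .pop k (fun s _ => s) <| .goto fun _ => ex
  | seq p q, _, e, _, Sum.inl l => code p (fun l => e (Sum.inl l)) (e (Sum.inr (entry q))) l
  | seq _ q, _, e, ex, Sum.inr l => code q (fun l => e (Sum.inr l)) ex l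
  | ite k c p q, _, e, _, none =>
      jump k c (e (some (Sum.inl (entry p)))) (e (some (Sum.inr (entry q))))
  | ite _ _ p _, _, e, ex, some (Sum.inl l) => code p (fun l => e (some (Sum.inl l))) ex l
  | ite _ _ _ q, _, e, ex, some (Sum.inr l) => code q (fun l => e (some (Sum.inr l))) ex l
  | loop k c p, _, e, ex, none => jump k c (e (some (entry p))) ex
  | loop _ _ p, _, e, _, some l => code p (fun l => e (some l)) (e none) l

variable [DecidableEq K]

/-- `Exec p s s' t`: started on the stacks `s`, the program `p` ends with the stacks `s'` after
`t` steps. -/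
inductive Exec : StackProg Γ → (∀ k, List (Γ k)) → (∀ k, List (Γ k)) → ℕ → Prop
  | skip (s) : Exec skip s s 1
  | push (k a s) : Exec (push k a) s (Function.update s k (a :: s k)) 1
  | pop (k s) : Exec (pop k) s (Function.update s k (s k).tail) 1
  | seq {p q s s' s'' t t'} : Exec p s s' t → Exec q s' s'' t' → Exec (seq p q) s s'' (t + t')
  | ite_true {k c p q s s' t} : c (s k).head? = true → Exec p s s' t →
      Exec (ite k c p q) s s' (1 + t)
  | ite_false {k c p q s s' t} : c (s k).head? = false → Exec q s s' t →
      Exec (ite k c p q) s s' (1 + t)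
  | loop_true {k c p s s' s'' t t'} : c (s k).head? = true → Exec p s s' t →
      Exec (loop k c p) s' s'' t' → Exec (loop k c p) s s'' (1 + (t + t'))
  | loop_false {k c p s} : c (s k).head? = false → Exec (loop k c p) s s 1

open Turing.TM2 in
theorem jump_step {Λ : Type} (M : Λ → Stmt Γ Λ Bool) (l : Λ) (k : K) (c : Option (Γ k) → Bool)
    (l₁ l₂ : Λ) (h : M l = jump k c l₁ l₂) (s : ∀ k, List (Γ k)) :
    (flip bind (step M)) (some ⟨some l, false, s⟩) =
      some ⟨some (cond (c (s k).head?) l₁ l₂), false, s⟩ := by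
  cases hc : c (s k).head? <;> simp [flip, h, jump, hc]

-- Correctness of the compilation. The code may sit anywhere in a machine `M` with any exit `ex`;
-- this generality lets the induction descend to subprograms.
open Turing.TM2 in
theorem Exec.iterate {p : StackProg Γ} {s s' : ∀ k, List (Γ k)} {t : ℕ} (h : Exec p s s' t) :
    ∀ {Λ : Type} (M : Λ → Stmt Γ Λ Bool) (e : Label p → Λ) (ex : Λ),
      (∀ l, M (e l) = code p e ex l) →
      (flip bind (step M))^[t] (some ⟨some (e (entry p)), false, s⟩) =
        some ⟨some ex, false, s'⟩ := by
  induction h with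
  | skip s => intro Λ M e ex h; simp [flip, h, code]
  | push k a s => intro Λ M e ex h; simp [flip, h, code]
  | pop k s => intro Λ M e ex h; simp [flip, h, code]
  | @seq p q s s' s'' t t' _ _ ih₁ ih₂ =>
    intro Λ M e ex h
    -- `Function.iterate_add_apply` performs the right-hand summand of the step count first.
    rw [add_comm, Function.iterate_add_apply]
    have h1 := ih₁ M (fun l => e (Sum.inl l)) (e (Sum.inr (entry q))) (fun l => h (Sum.inl l))
    have h2 := ih₂ M (fun l => e (Sum.inr l)) ex (fun l => h (Sum.inr l))
    exact (congrArg _ h1).trans h2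
  | @ite_true k c p q s s' t hc _ ih =>
    intro Λ M e ex h
    rw [add_comm, Function.iterate_add_apply]
    have h1 := jump_step M _ k c _ _ (h none) s
    rw [hc] at h1
    exact (congrArg _ h1).trans
      (ih M (fun l => e (some (Sum.inl l))) ex (fun l => h (some (Sum.inl l))))
  | @ite_false k c p q s s' t hc _ ih =>
    intro Λ M e ex h
    rw [add_comm, Function.iterate_add_apply]
    have h1 := jump_step M _ k c _ _ (h none) s
    rw [hc] at h1
    exact (congrArg _ h1).trans
      (ih M (fun l => e (some (Sum.inr l))) ex (fun l => h (some (Sum.inr l))))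
  | @loop_true k c p s s' s'' t t' hc _ _ ih₁ ih₂ =>
    intro Λ M e ex h
    rw [add_comm, Function.iterate_add_apply, add_comm t t', Function.iterate_add_apply]
    have h1 := jump_step M _ k c _ _ (h none) s
    rw [hc] at h1
    have h2 := ih₁ M (fun l => e (some l)) (e none) (fun l => h (some l))
    have h3 := ih₂ M e ex h
    refine (congrArg _ (congrArg _ h1)).trans ?_
    exact (congrArg _ h2).trans h3
  | @loop_false k c p s hc =>
    intro Λ M e ex h
    have h1 := jump_step M _ k c _ _ (h none) s
    rw [hc] at h1
    exact h1

/-- The Turing machine of a program, with input stack `i` and output stack `o`. -/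
def machine [Fintype K] (p : StackProg Γ) (i o : K) [Fintype (Γ i)] : Turing.FinTM2 where
  K := K
  k₀ := i
  k₁ := o
  Γ := Γ
  Λ := Option (Label p)
  main := some (entry p)
  ΛFin := letI := labelFintype p; inferInstanceAs (Fintype (Option (Label p)))
  σ := Bool
  initialState := false
  m := fun
    | none => .halt
    | some l => code p some none l

/-- `p` runs from `s` to `s'` in at most `T` steps. -/
def Runs (p : StackProg Γ) (s s' : ∀ k, List (Γ k)) (T : ℕ) : Prop :=
  ∃ t ≤ T, Exec p s s' t

theorem Runs.mono {p : StackProg Γ} {s s' : ∀ k, List (Γ k)} {T T' : ℕ} (h : Runs p s s' T)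
    (hT : T ≤ T') : Runs p s s' T' :=
  let ⟨t, ht, e⟩ := h; ⟨t, ht.trans hT, e⟩

theorem Runs.seq {p q : StackProg Γ} {s s' s'' : ∀ k, List (Γ k)} {T T' : ℕ}
    (h : Runs p s s' T) (h' : Runs q s' s'' T') : Runs (seq p q) s s'' (T + T') :=
  let ⟨_, ht, e⟩ := h; let ⟨_, ht', e'⟩ := h'; ⟨_, add_le_add ht ht', e.seq e'⟩

theorem Runs.skip (s : ∀ k, List (Γ k)) : Runs skip s s 1 := ⟨_, le_rfl, .skip s⟩

theorem Runs.push (k : K) (a : Γ k) (s : ∀ k, List (Γ k)) :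
    Runs (push k a) s (Function.update s k (a :: s k)) 1 := ⟨_, le_rfl, .push k a s⟩

theorem Runs.pop (k : K) (s : ∀ k, List (Γ k)) :
    Runs (pop k) s (Function.update s k (s k).tail) 1 := ⟨_, le_rfl, .pop k s⟩

theorem Runs.ite_true {k : K} {c : Option (Γ k) → Bool} {p q : StackProg Γ}
    {s s' : ∀ k, List (Γ k)} {T : ℕ} (hc : c (s k).head? = true) (h : Runs p s s' T) :
    Runs (ite k c p q) s s' (1 + T) :=
  let ⟨_, ht, e⟩ := h; ⟨_, Nat.add_le_add_left ht 1, .ite_true hc e⟩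

theorem Runs.ite_false {k : K} {c : Option (Γ k) → Bool} {p q : StackProg Γ}
    {s s' : ∀ k, List (Γ k)} {T : ℕ} (hc : c (s k).head? = false) (h : Runs q s s' T) :
    Runs (ite k c p q) s s' (1 + T) :=
  let ⟨_, ht, e⟩ := h; ⟨_, Nat.add_le_add_left ht 1, .ite_false hc e⟩

theorem Runs.loop_true {k : K} {c : Option (Γ k) → Bool} {p : StackProg Γ}
    {s s' s'' : ∀ k, List (Γ k)} {T T' : ℕ} (hc : c (s k).head? = true) (h : Runs p s s' T)
    (h' : Runs (loop k c p) s' s'' T') : Runs (loop k c p) s s'' (1 + (T + T')) :=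
  let ⟨_, ht, e⟩ := h; let ⟨_, ht', e'⟩ := h'
  ⟨_, Nat.add_le_add_left (add_le_add ht ht') 1, .loop_true hc e e'⟩

theorem Runs.loop_false {k : K} {c : Option (Γ k) → Bool} {p : StackProg Γ}
    {s : ∀ k, List (Γ k)} (hc : c (s k).head? = false) : Runs (loop k c p) s s 1 :=
  ⟨_, le_rfl, .loop_false hc⟩

/-- The left side is the form in which `Turing.initList` and `Turing.haltList` give the stacks. -/
theorem dite_eq_update (i : K) (x : List (Γ i)) (k : K) :
    (if h : k = i then (by rw [h]; exact x) else [] : List (Γ k)) =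
      Function.update (fun k => ([] : List (Γ k))) i x k := by
  by_cases h : k = i
  · subst h; simp
  · rw [dif_neg h, Function.update_of_ne h]

-- The additional step executes `halt` at the label `none`.
open Turing in
theorem Runs.outputsInTime [Fintype K] {p : StackProg Γ} {i o : K} [Fintype (Γ i)]
    {x : List (Γ i)} {y : List (Γ o)} {T : ℕ}
    (h : Runs p (Function.update (fun _ => []) i x) (Function.update (fun _ => []) o y) T) :
    Nonempty (TM2OutputsInTime (machine p i o) x (some y) (T + 1)) := by
  obtain ⟨t, ht, e⟩ := h
  have key := e.iterate (machine p i o).m some none (fun l => rfl)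
  have hi : initList (machine p i o) x =
      ⟨some (some (entry p)), false, Function.update (fun _ => []) i x⟩ :=
    congrArg (TM2.Cfg.mk (some (some (entry p))) false) (funext (dite_eq_update i x))
  have ho : haltList (machine p i o) y =
      ⟨none, false, Function.update (fun _ => []) o y⟩ :=
    congrArg (TM2.Cfg.mk none false) (funext (dite_eq_update o y))
  refine ⟨⟨⟨t + 1, ?_⟩, Nat.succ_le_succ ht⟩⟩
  rw [Function.iterate_succ_apply', hi]
  refine (congrArg _ key).trans ?_
  change _ = some (haltList (machine p i o) y)
  rw [ho]
  rfl

end StackProg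

/-! ### The variables and equations of the linear system. -/

namespace WheelSystem

/-- The tokens of a list of relators: letters `s^{±1}` and the end-of-relator mark. -/
inductive Tok
  | letter (s : ℕ) (e : Bool)
  | endmark
  deriving DecidableEq

/-- The variables of the system: two involutions for every generator, five global variables and
eleven variables for every block. -/
inductive Var
  | gen (s : ℕ) (e : Bool)
  | glob (i : Fin 5)
  -- The indices `j` stand for `y, m, z, u, v` (0 to 4), the spokes of the four-wheel (5 to 8) and
  -- two spokes of the inner wheel (9, 10). Among the globals, `glob 3` is the hub for `y` and `z`,
  -- and `glob 4` is the common base spoke of the inner wheels.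
  | blk (o : ℕ) (j : Fin 11)
  deriving DecidableEq

/-- Variables relative to a current generator and a current block. -/
inductive RelVar
  | gen (e : Bool)
  | glob (i : Fin 5)
  | prev (j : Fin 11)
  | cur (j : Fin 11)
  deriving DecidableEq

/-- The variable denoted by a relative variable. -/
def RelVar.inst (s o : ℕ) : RelVar → Var
  | gen e => .gen s e
  | glob i => .glob i
  | prev j => .blk o j
  | cur j => .blk (o + 1) j

theorem RelVar.inst_injective (s o : ℕ) : Function.Injective (RelVar.inst s o) := by
  intro a b h
  cases a <;> cases b <;> simp_all [RelVar.inst]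

/-- An equation `v₁ + v₂ + v₃ = c`. -/
structure Row (α : Type) where
  v₁ : α
  v₂ : α
  v₃ : α
  c : ZMod 2

namespace Row

variable {α β : Type}

/-- Renaming of the variables of an equation. -/
def map (f : α → β) (r : Row α) : Row β := ⟨f r.v₁, f r.v₂, f r.v₃, r.c⟩

/-- The coefficient of `v`. -/
def bit [DecidableEq α] (r : Row α) (v : α) : ZMod 2 :=
  if v = r.v₁ ∨ v = r.v₂ ∨ v = r.v₃ then 1 else 0

/-- The three variables are distinct. -/
def Distinct (r : Row α) : Prop := r.v₁ ≠ r.v₂ ∧ r.v₁ ≠ r.v₃ ∧ r.v₂ ≠ r.v₃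

instance [DecidableEq α] (r : Row α) : Decidable r.Distinct :=
  inferInstanceAs (Decidable (_ ∧ _))

theorem Distinct.map {f : α → β} (hf : Function.Injective f) {r : Row α} (h : r.Distinct) :
    (r.map f).Distinct :=
  ⟨hf.ne h.1, hf.ne h.2.1, hf.ne h.2.2⟩

theorem bit_map [DecidableEq α] [DecidableEq β] {f : α → β} (hf : Function.Injective f)
    (r : Row α) (v : α) : (r.map f).bit (f v) = r.bit v := by
  simp [bit, map, hf.eq_iff]

end Row

open RelVar in
/-- The equations that force the first involution of `J` to be `J` and the second to be `1`. -/
def forcingRows : List (Row RelVar) :=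
  -- In each triple, the two equations with `glob 0` identify `glob 1` and `glob 2`; these cancel in
  -- the third equation and leave the generator alone.
  [⟨gen true, glob 0, glob 1, 1⟩, ⟨gen true, glob 0, glob 2, 1⟩, ⟨gen true, glob 1, glob 2, 1⟩,
    ⟨gen false, glob 0, glob 1, 0⟩, ⟨gen false, glob 0, glob 2, 0⟩, ⟨gen false, glob 1, glob 2, 0⟩]

/-- The variable number `j` of a block, or the hub `i` at the boundary of a relator. -/
def hubOr (b : Bool) (i : Fin 5) (v : RelVar) : RelVar := if b then .glob i else v

open RelVar in
/-- The equations of all blocks; the flags tell if the block begins and if it ends a relator. -/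
def linkRows (b b' : Bool) : List (Row RelVar) :=
  -- A wheel with rim `z, y, v, u` and spokes `cur 5` to `cur 8`: it forces `z y = u v`.
  [⟨hubOr b 3 (prev 2), cur 5, cur 6, 0⟩, ⟨hubOr b' 3 (cur 0), cur 6, cur 7, 0⟩,
    ⟨cur 4, cur 7, cur 8, 0⟩, ⟨cur 3, cur 8, cur 5, 0⟩,
    -- Two sectors of the inner wheel: `u v` becomes the product of the spokes at the two ends of
    -- the block, which telescopes over the blocks of a relator.
    ⟨cur 3, hubOr b 4 (prev 10), cur 9, 0⟩, ⟨cur 4, cur 9, hubOr b' 4 (cur 10), 0⟩]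

open RelVar in
/-- The equations of a block that belongs to a letter with exponent sign `e`. -/
def letterRows (e : Bool) : List (Row RelVar) :=
  -- Eliminating the middle variable `m` gives `gen e * gen !e = y z`.
  [⟨cur 0, gen e, cur 1, 0⟩, ⟨cur 1, gen !e, cur 2, 0⟩]

/-- The equations of a block. -/
def tokRows (b : Bool) : Tok → List (Row RelVar)
  | .letter _ e => linkRows b false ++ letterRows e
  | .endmark => linkRows b true

theorem tokRows_distinct (b : Bool) (t : Tok) : ∀ r ∈ tokRows b t, r.Distinct := by
  rcases t with ⟨s, e⟩ | _
  · change ∀ r ∈ linkRows b false ++ letterRows e, r.Distinct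
    revert b e
    decide
  · change ∀ r ∈ linkRows b true, r.Distinct
    revert b
    decide

theorem forcingRows_distinct : ∀ r ∈ forcingRows, r.Distinct := by decide

/-- The generator of a token. -/
def Tok.index : Tok → ℕ
  | letter s _ => s
  | endmark => 0

/-- The token number `o`. -/
def tokAt (ts : List Tok) (o : ℕ) : Tok := ts.getD o .endmark

/-- The token number `o` is the first one of a relator. -/
def startAt (ts : List Tok) : ℕ → Bool
  | 0 => true
  | o + 1 => tokAt ts o = .endmark

/-- The equations of the block number `o`. -/
def rowsAt (ts : List Tok) (o : ℕ) : List (Row Var) :=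
  (tokRows (startAt ts o) (tokAt ts o)).map (Row.map (RelVar.inst (tokAt ts o).index o))

/-- All equations. -/
def rows (J : ℕ) (ts : List Tok) : List (Row Var) :=
  forcingRows.map (Row.map (RelVar.inst J 0)) ++ (List.range ts.length).flatMap (rowsAt ts)

/-- The list of all variables, for `k` generators and the blocks with number at most `B`. -/
def vars (k B : ℕ) : List Var :=
  (List.range k).flatMap (fun s => [.gen s true, .gen s false]) ++
    (List.finRange 5).map .glob ++
      -- Block `0` occurs in no equation, since the first block begins a relator and uses the hubs.
      -- It keeps the window of two consecutive blocks uniform.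
      (List.range (B + 1)).flatMap fun o => (List.finRange 11).map (.blk o)

theorem length_vars (k B : ℕ) : (vars k B).length = 2 * k + 5 + 11 * (B + 1) := by
  simp [vars, List.length_flatMap]
  ring

theorem gen_mem_vars {k B s : ℕ} {e : Bool} : .gen s e ∈ vars k B ↔ s < k := by
  cases e <;> simp [vars]

theorem glob_mem_vars {k B : ℕ} (i : Fin 5) : .glob i ∈ vars k B := by
  simp [vars]

theorem blk_mem_vars {k B o : ℕ} {j : Fin 11} : .blk o j ∈ vars k B ↔ o ≤ B := by
  simp [vars]

theorem nodup_vars (k B : ℕ) : (vars k B).Nodup := by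
  refine (List.Nodup.append ?_ ?_ ?_).append ?_ ?_
  · rw [List.nodup_flatMap]
    refine ⟨fun s _ => by simp, ?_⟩
    refine List.nodup_range.imp fun {a b} h => ?_
    simp only [Function.onFun, List.Disjoint]
    rintro v hv hv'
    simp at hv hv'
    rcases hv with rfl | rfl <;> simp_all
  · exact (List.nodup_finRange 5).map fun a b h => by simpa using h
  · intro v hv hv'
    simp at hv hv'
    obtain ⟨i, rfl⟩ := hv'
    simp at hv
  · rw [List.nodup_flatMap]
    refine ⟨fun o _ => (List.nodup_finRange 11).map fun a b h => by simpa using h, ?_⟩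
    refine List.nodup_range.imp fun {a b} h => ?_
    simp only [Function.onFun, List.Disjoint]
    rintro v hv hv'
    simp at hv hv'
    obtain ⟨i, rfl⟩ := hv
    simp_all
  · intro v hv hv'
    simp at hv hv'
    obtain ⟨o, _, j, rfl⟩ := hv'
    simp at hv

/-! ### The matrix of a list of equations. -/

variable (V : List Var) (R : List (Row Var))

/-- The matrix of the list `R` of equations in the variables `V`. -/
def matrix : Matrix (Fin R.length) (Fin V.length) (ZMod 2) := fun i j => R[i].bit V[j]

/-- The right-hand side of the list `R` of equations. -/
def vector : Fin R.length → ZMod 2 := fun i => R[i].c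

theorem encode_matrix_vector : LinSys.encode (matrix V R) (vector R) =
    List.replicate V.length .tick ++ [.sep] ++
      R.flatMap fun r => (V.map fun v => .bit (r.bit v)) ++ [.bit r.c, .sep] := by
  unfold LinSys.encode
  congr 1
  rw [List.flatMap_def]
  congr 1
  apply List.ext_getElem
  · simp
  · intro i h h'
    simp only [List.getElem_ofFn, List.getElem_map, matrix, vector]
    congr 1
    apply List.ext_getElem
    · simp
    · intro j h h'
      simp

theorem filter_eq_three {α : Type} [DecidableEq α] {l : List α} (hl : l.Nodup) {a b c : α}
    (ha : a ∈ l) (hb : b ∈ l) (hc : c ∈ l) (hab : a ≠ b) (hac : a ≠ c) (hbc : b ≠ c) :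
    (l.filter fun v => v = a ∨ v = b ∨ v = c).Perm [a, b, c] := by
  rw [List.perm_ext_iff_of_nodup (hl.filter _) (by simp [hab, hac, hbc])]
  intro v
  simp
  rintro (rfl | rfl | rfl) <;> assumption

theorem matrix_ne_zero_iff {V : List Var} {R : List (Row Var)} {i : Fin R.length}
    {j : Fin V.length} : matrix V R i j ≠ 0 ↔
      V.get j = R[i].v₁ ∨ V.get j = R[i].v₂ ∨ V.get j = R[i].v₃ := by
  change R[i].bit V[j] ≠ 0 ↔ _
  unfold Row.bit
  split_ifs with h
  · exact iff_of_true one_ne_zero h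
  · exact iff_of_false (fun h => h rfl) h

theorem card_matrix {V : List Var} {R : List (Row Var)} (hV : V.Nodup)
    (hR : ∀ r ∈ R, r.Distinct ∧ r.v₁ ∈ V ∧ r.v₂ ∈ V ∧ r.v₃ ∈ V) (i : Fin R.length) :
    (Finset.univ.filter fun j => matrix V R i j ≠ 0).card = 3 := by
  obtain ⟨⟨h12, h13, h23⟩, h1, h2, h3⟩ := hR R[i] (List.getElem_mem _)
  have key := (filter_eq_three hV h1 h2 h3 h12 h13 h23).length_eq
  rw [← List.toFinset_card_of_nodup (hV.filter _)] at key
  rw [Finset.filter_congr (fun j _ => matrix_ne_zero_iff),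
    ← Finset.card_map ⟨V.get, List.nodup_iff_injective_get.mp hV⟩]
  refine Eq.trans ?_ key
  congr 1
  ext v
  simp only [Finset.mem_map, Finset.mem_filter, Finset.mem_univ, true_and,
    List.mem_toFinset, List.mem_filter, decide_eq_true_eq, Function.Embedding.coeFn_mk]
  constructor
  · rintro ⟨j, hj, rfl⟩
    exact ⟨List.get_mem _ _, hj⟩
  · rintro ⟨hv, h⟩
    obtain ⟨j, rfl⟩ := List.mem_iff_get.mp hv
    exact ⟨j, h, rfl⟩

theorem tokAt_eq {ts : List Tok} {o : ℕ} (h : o < ts.length) : tokAt ts o = ts[o] := by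
  simp [tokAt, h]

theorem mem_vars_inst {k B s o : ℕ} (hs : s < k) (ho : o < B) (v : RelVar) :
    v.inst s o ∈ vars k B := by
  cases v with
  | gen e => exact gen_mem_vars.mpr hs
  | glob i => exact glob_mem_vars i
  | prev j => exact blk_mem_vars.mpr ho.le
  | cur j => exact blk_mem_vars.mpr ho

theorem rows_wf {k J : ℕ} {ts : List Tok} (hJ : J < k) (hts : ∀ t ∈ ts, t.index < k) :
    ∀ r ∈ rows J ts, r.Distinct ∧ r.v₁ ∈ vars k ts.length ∧ r.v₂ ∈ vars k ts.length ∧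
      r.v₃ ∈ vars k ts.length := by
  intro r hr
  rcases List.mem_append.mp hr with hr | hr
  · obtain ⟨t, ht, rfl⟩ := List.mem_map.mp hr
    refine ⟨(forcingRows_distinct t ht).map (RelVar.inst_injective _ _), ?_⟩
    simp [forcingRows] at ht
    rcases ht with rfl | rfl | rfl | rfl | rfl | rfl <;>
      exact ⟨gen_mem_vars.mpr hJ, glob_mem_vars _, glob_mem_vars _⟩
  · obtain ⟨o, ho, hr⟩ := List.mem_flatMap.mp hr
    obtain ⟨t, ht, rfl⟩ := List.mem_map.mp hr
    have ho' : o < ts.length := List.mem_range.mp ho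
    have hk : (tokAt ts o).index < k := by
      rw [tokAt_eq ho']; exact hts _ (List.getElem_mem _)
    exact ⟨(tokRows_distinct _ _ t ht).map (RelVar.inst_injective _ _),
      mem_vars_inst hk ho' _, mem_vars_inst hk ho' _, mem_vars_inst hk ho' _⟩

theorem length_rows_le (J : ℕ) (ts : List Tok) : (rows J ts).length ≤ 6 + 8 * ts.length := by
  have h : ∀ o, (rowsAt ts o).length ≤ 8 := by
    intro o
    unfold rowsAt
    rw [List.length_map]
    rcases tokAt ts o with ⟨s, e⟩ | _ <;> simp [tokRows, linkRows, letterRows]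
  have h2 : ((List.range ts.length).flatMap (rowsAt ts)).length ≤ ts.length * 8 := by
    rw [List.length_flatMap]
    refine (List.sum_le_card_nsmul _ 8 ?_).trans (by simp)
    intro x hx
    obtain ⟨o, _, rfl⟩ := List.mem_map.mp hx
    exact h o
  unfold rows
  rw [List.length_append]
  simp [forcingRows, -List.length_flatMap]
  omega

end WheelSystem

/-! ### Tokens of a presentation and linear bounds on their number. -/

open WheelSystem in
/-- The tokens of the relators of a presentation. -/
def FinPres.tokens (P : FinPres) : List Tok :=
  P.rels.flatMap fun r => r.toWord.map (fun l => Tok.letter l.1 l.2) ++ [Tok.endmark]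

namespace WheelSystem

theorem index_lt_of_mem_tokens (P : FinPres) : ∀ t ∈ P.tokens, t.index < P.numGens := by
  intro t ht
  simp only [FinPres.tokens, List.mem_flatMap, List.mem_append, List.mem_map,
    List.mem_singleton] at ht
  obtain ⟨r, -, ⟨l, -, rfl⟩ | rfl⟩ := ht
  · exact l.1.2
  · exact P.J.pos

/-- A nonempty relator contributes at least `1` to the size. By `nodup` the empty relator occurs at
most once, and the existence of the generator `J` pays for it. -/
theorem length_rels_le (P : FinPres) : P.rels.length ≤ P.size := by
  classical
  have h1 : P.rels.length ≤ (P.rels.map FreeGroup.norm).sum + 1 := by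
    have h : ∀ l : List (FreeGroup (Fin P.numGens)), l.Nodup →
        l.length ≤ (l.map FreeGroup.norm).sum + if 1 ∈ l then 1 else 0 := by
      intro l hl
      induction l with
      | nil => simp
      | cons a l ih =>
        obtain ⟨ha, hl⟩ := List.nodup_cons.mp hl
        have ih := ih hl
        simp only [List.length_cons, List.map_cons, List.sum_cons, List.mem_cons]
        by_cases h1 : a = 1
        · subst h1
          rw [if_neg ha] at ih
          simp
          omega
        · have : 1 ≤ a.norm := by
            rw [Nat.one_le_iff_ne_zero]
            exact fun h => h1 (FreeGroup.norm_eq_zero.mp h)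
          simp only [Ne.symm h1, false_or]
          omega
    refine (h _ P.nodup).trans ?_
    split_ifs <;> omega
  have h2 : 1 ≤ P.numGens := P.J.pos
  unfold FinPres.size
  omega

theorem length_tokens_le (P : FinPres) : P.tokens.length ≤ 2 * P.size := by
  have h : P.tokens.length = (P.rels.map FreeGroup.norm).sum + P.rels.length := by
    unfold FinPres.tokens
    rw [List.length_flatMap]
    induction P.rels with
    | nil => rfl
    | cons a l ih =>
      rw [List.map_cons, List.sum_cons, ih]
      simp [FreeGroup.norm]
      omega
  have h1 := length_rels_le P
  rw [h]
  unfold FinPres.size at *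
  omega

end WheelSystem

/-! ### The program that prints the system. -/

instance : DecidableEq PresSymbol := fun a b => by
  cases a <;> cases b <;> first | exact isTrue rfl | exact isFalse (fun h => by cases h)

instance : Fintype PresSymbol where
  elems := {.tick, .pos, .neg, .sep}
  complete := by intro x; cases x <;> simp

instance : DecidableEq SysSymbol
  | .tick, .tick => isTrue rfl
  | .sep, .sep => isTrue rfl
  | .bit b, .bit b' => decidable_of_iff (b = b') (by simp)
  | .tick, .sep => isFalse (fun h => by cases h)
  | .tick, .bit _ => isFalse (fun h => by cases h)
  | .sep, .tick => isFalse (fun h => by cases h)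
  | .sep, .bit _ => isFalse (fun h => by cases h)
  | .bit _, .tick => isFalse (fun h => by cases h)
  | .bit _, .sep => isFalse (fun h => by cases h)

namespace StackProg

variable {K : Type} {Γ : K → Type}

/-- Execute `body a`, where `a` is the symbol on top of the stack `k`. -/
def switch (k : K) [DecidableEq (Γ k)] (body : Γ k → StackProg Γ) : List (Γ k) → StackProg Γ
  | [] => skip
  | a :: as => ite k (fun o => decide (o = some a)) (body a) (switch k body as)

theorem Runs.switch [DecidableEq K] {k : K} [DecidableEq (Γ k)] {body : Γ k → StackProg Γ}
    {as : List (Γ k)} {a : Γ k} {s s' : ∀ k, List (Γ k)} {T : ℕ} (h : Runs (body a) s s' T)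
    (ha : a ∈ as) (hs : (s k).head? = some a) :
    Runs (StackProg.switch k body as) s s' (as.length + T) := by
  induction as with
  | nil => simp at ha
  | cons b as ih =>
    by_cases hb : a = b
    · subst hb
      refine (Runs.ite_true (by simp [hs]) h).mono ?_
      simp
    · refine (Runs.ite_false (by simp [hs, hb]) (ih ?_)).mono ?_
      · simpa [hb] using ha
      · simp only [List.length_cons]; omega

end StackProg

namespace WheelSystem

open StackProg

/-- Counters: the numbers of generators before and after the current one, of blocks before and
after the current two, an auxiliary counter, and a flag. -/
inductive Ctr
  | genBefore
  | genAfter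
  | blkBefore
  | blkAfter
  | aux
  | flag
  deriving DecidableEq

instance : Fintype Ctr where
  elems := {.genBefore, .genAfter, .blkBefore, .blkAfter, .aux, .flag}
  complete := by intro x; cases x <;> simp

/-- The stacks of the machine. -/
inductive Stk
  | inp
  | rev
  | tmp
  | out
  | ctr (c : Ctr)
  deriving DecidableEq

instance : Fintype Stk where
  elems := {.inp, .rev, .tmp, .out} ∪ Finset.univ.image .ctr
  complete := by intro x; cases x <;> simp

/-- The stack alphabets. -/
@[reducible]
def StkAlphabet : Stk → Type
  | .inp => PresSymbol
  | .rev => PresSymbol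
  | .tmp => SysSymbol
  | .out => SysSymbol
  | .ctr _ => Unit

/-- Programs for the construction of the system. -/
abbrev Prog := StackProg StkAlphabet

/-- The stack contents; `w` is the word printed so far. -/
def stk (i r : List PresSymbol) (w o : List SysSymbol) (c : Ctr → ℕ) :
    ∀ k, List (StkAlphabet k)
  | .inp => i
  | .rev => r
  | .tmp => w.reverse
  | .out => o
  | .ctr x => List.replicate (c x) ()

variable (i r : List PresSymbol) (w o : List SysSymbol) (c : Ctr → ℕ)

theorem update_inp (x : List PresSymbol) :
    Function.update (stk i r w o c) .inp x = stk x r w o c := by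
  funext k; cases k <;> rfl

theorem update_rev (x : List PresSymbol) :
    Function.update (stk i r w o c) .rev x = stk i x w o c := by
  funext k; cases k <;> rfl

theorem update_tmp (x : List SysSymbol) :
    Function.update (stk i r w o c) .tmp x = stk i r x.reverse o c := by
  funext k; cases k <;> simp [Function.update, stk]

theorem update_out (x : List SysSymbol) :
    Function.update (stk i r w o c) .out x = stk i r w x c := by
  funext k; cases k <;> rfl

theorem update_ctr (x : Ctr) (n : ℕ) :
    Function.update (stk i r w o c) (.ctr x) (List.replicate n ()) =
      stk i r w o (Function.update c x n) := by
  funext k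
  cases k with
  | ctr y =>
    by_cases h : y = x
    · subst h; simp [stk]
    · simp [Function.update_of_ne, stk, h]
  | _ => simp [stk]

variable {i r w o c}

theorem runs_push_inp (a : PresSymbol) :
    Runs (push .inp a : Prog) (stk i r w o c) (stk (a :: i) r w o c) 1 := by
  have h := Runs.push (Γ := StkAlphabet) .inp a (stk i r w o c)
  rwa [update_inp] at h

theorem runs_push_rev (a : PresSymbol) :
    Runs (push .rev a : Prog) (stk i r w o c) (stk i (a :: r) w o c) 1 := by
  have h := Runs.push (Γ := StkAlphabet) .rev a (stk i r w o c)
  rwa [update_rev] at h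

theorem runs_push_out (a : SysSymbol) :
    Runs (push .out a : Prog) (stk i r w o c) (stk i r w (a :: o) c) 1 := by
  have h := Runs.push (Γ := StkAlphabet) .out a (stk i r w o c)
  rwa [update_out] at h

theorem runs_push_tmp (a : SysSymbol) :
    Runs (push .tmp a : Prog) (stk i r w o c) (stk i r (w ++ [a]) o c) 1 := by
  have := Runs.push (Γ := StkAlphabet) .tmp a (stk i r w o c)
  rw [update_tmp] at this
  simpa [stk] using this

theorem runs_pop_inp {a : PresSymbol} :
    Runs (pop .inp : Prog) (stk (a :: i) r w o c) (stk i r w o c) 1 := by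
  have h := Runs.pop (Γ := StkAlphabet) .inp (stk (a :: i) r w o c)
  rwa [update_inp] at h

theorem runs_pop_rev {a : PresSymbol} :
    Runs (pop .rev : Prog) (stk i (a :: r) w o c) (stk i r w o c) 1 := by
  have h := Runs.pop (Γ := StkAlphabet) .rev (stk i (a :: r) w o c)
  rwa [update_rev] at h

theorem runs_pop_tmp {a : SysSymbol} :
    Runs (pop .tmp : Prog) (stk i r (w ++ [a]) o c) (stk i r w o c) 1 := by
  have := Runs.pop (Γ := StkAlphabet) .tmp (stk i r (w ++ [a]) o c)
  rw [update_tmp] at this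
  simpa [stk] using this

theorem runs_inc (x : Ctr) : Runs (push (.ctr x) () : Prog) (stk i r w o c)
    (stk i r w o (Function.update c x (c x + 1))) 1 := by
  have := Runs.push (Γ := StkAlphabet) (.ctr x) () (stk i r w o c)
  rwa [show (() :: stk i r w o c (.ctr x)) = List.replicate (c x + 1) () from rfl,
    update_ctr] at this

theorem runs_dec (x : Ctr) : Runs (pop (.ctr x) : Prog) (stk i r w o c)
    (stk i r w o (Function.update c x (c x - 1))) 1 := by
  have := Runs.pop (Γ := StkAlphabet) (.ctr x) (stk i r w o c)
  rwa [show (stk i r w o c (.ctr x)).tail = List.replicate (c x - 1) () by simp [stk],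
    update_ctr] at this

/-- Print a word. -/
def emit : List SysSymbol → Prog
  | [] => skip
  | a :: l => seq (push .tmp a) (emit l)

theorem runs_emit (l : List SysSymbol) :
    Runs (emit l) (stk i r w o c) (stk i r (w ++ l) o c) (l.length + 1) := by
  induction l generalizing w with
  | nil => rw [List.append_nil]; exact Runs.skip _
  | cons a l ih =>
    have h := (runs_push_tmp (i := i) (r := r) (w := w) (o := o) (c := c) a).seq ih
    rw [List.append_assoc] at h
    exact h.mono (by rw [List.length_cons]; omega)

/-- Empty the counter `x` into the counter `y`, printing `l` each time. -/
def drain (x y : Ctr) (l : List SysSymbol) : Prog :=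
  loop (.ctr x) Option.isSome <| seq (pop (.ctr x)) <| seq (push (.ctr y) ()) (emit l)

theorem runs_drain {x y : Ctr} (hxy : x ≠ y) (l : List SysSymbol) :
    Runs (drain x y l) (stk i r w o c)
      (stk i r (w ++ (List.replicate (c x) l).flatten) o
        (Function.update (Function.update c x 0) y (c y + c x)))
      (c x * (l.length + 4) + 1) := by
  obtain ⟨n, hn⟩ : ∃ n, c x = n := ⟨_, rfl⟩
  induction n generalizing c w with
  | zero =>
    have h := Runs.loop_false (Γ := StkAlphabet) (k := .ctr x) (c := Option.isSome)
      (p := seq (pop (.ctr x)) <| seq (push (.ctr y) ()) (emit l)) (s := stk i r w o c)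
      (by simp [stk, hn])
    have e : Function.update (Function.update c x 0) y (c y + c x) = c := by
      rw [hn, ← hn, Function.update_eq_self, hn, add_zero, Function.update_eq_self]
    rw [e, hn]
    simp only [List.replicate_zero, List.flatten_nil, List.append_nil]
    exact h.mono (by omega)
  | succ n ih =>
    have h1 := runs_dec (i := i) (r := r) (w := w) (o := o) (c := c) x
    have h2 := runs_inc (i := i) (r := r) (w := w) (o := o)
      (c := Function.update c x (c x - 1)) y
    have h3 := runs_emit (i := i) (r := r) (w := w) (o := o)
      (c := Function.update (Function.update c x (c x - 1)) y
        (Function.update c x (c x - 1) y + 1)) l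
    have h4 := ih (c := Function.update (Function.update c x (c x - 1)) y
        (Function.update c x (c x - 1) y + 1)) (w := w ++ l)
        (by simp [Function.update_of_ne hxy, hn])
    have h5 := Runs.loop_true (c := Option.isSome) (by simp [stk, hn])
      (h1.seq (h2.seq h3)) h4
    have e1 : ∀ d : Ctr → ℕ, d = Function.update (Function.update c x (c x - 1)) y
        (Function.update c x (c x - 1) y + 1) →
        d x = n ∧ Function.update (Function.update d x 0) y (d y + d x) =
        Function.update (Function.update c x 0) y (c y + c x) := by
      rintro d rfl
      refine ⟨by simp [Function.update_of_ne hxy, hn], ?_⟩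
      funext z
      by_cases hzy : z = y
      · subst hzy
        simp [Function.update_of_ne hxy, Function.update_of_ne hxy.symm, hn]
        omega
      · by_cases hzx : z = x
        · subst hzx; simp [hxy]
        · simp [Function.update_of_ne, hzx, hzy]
    rw [(e1 _ rfl).2, (e1 _ rfl).1] at h5
    rw [hn] at h5 ⊢
    have e2 : w ++ l ++ (List.replicate n l).flatten = w ++ (List.replicate (n + 1) l).flatten := by
      rw [List.replicate_succ, List.flatten_cons, List.append_assoc]
    rw [e2] at h5
    exact h5.mono (by ring_nf; omega)

/-- Print `l` as often as the counter `x` says. -/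
def forEach (x : Ctr) (l : List SysSymbol) : Prog := seq (drain x .aux l) (drain .aux x [])

theorem runs_forEach {x : Ctr} (hx : x ≠ .aux) (hc : c .aux = 0) (l : List SysSymbol) :
    Runs (forEach x l) (stk i r w o c)
      (stk i r (w ++ (List.replicate (c x) l).flatten) o c) (c x * (l.length + 8) + 2) := by
  have h := (runs_drain (i := i) (r := r) (w := w) (o := o) (c := c) hx l).seq
    (runs_drain hx.symm [])
  have e : ∀ d : Ctr → ℕ, d = Function.update (Function.update c x 0) .aux (c .aux + c x) →
      d .aux = c x ∧ Function.update (Function.update d .aux 0) x (d x + d .aux) = c := by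
    rintro d rfl
    refine ⟨by simp [hc], ?_⟩
    funext z
    by_cases hzx : z = x
    · subst hzx; simp [Function.update_of_ne hx, hc]
    · by_cases hza : z = .aux
      · subst hza; simp [Function.update_of_ne hx.symm, hc]
      · simp [Function.update_of_ne, hzx, hza]
  rw [(e _ rfl).2, (e _ rfl).1] at h
  have e2 : (List.replicate (c x) ([] : List SysSymbol)).flatten = [] := by simp
  rw [e2, List.append_nil] at h
  exact h.mono (by simp only [List.length_nil]; ring_nf; omega)

/-- Print a pattern of coefficients. -/
def bits {α : Type} [DecidableEq α] (t : Row α) (l : List α) : List SysSymbol :=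
  l.map fun v => .bit (t.bit v)

/-- Zero coefficients. -/
def zeros (n : ℕ) : List SysSymbol := List.replicate n (.bit 0)

/-- The generator, the global, and the block variables. -/
def genPair : List RelVar := [.gen true, .gen false]

/-- The global variables. -/
def globals : List RelVar := (List.finRange 5).map .glob

/-- The variables of the previous and the current block. -/
def twoBlocks : List RelVar :=
  (List.finRange 11).map .prev ++ (List.finRange 11).map .cur

/-- Print an equation. -/
def printRow (t : Row RelVar) : Prog :=
  seq (forEach .genBefore (zeros 2)) <| seq (emit (bits t genPair)) <|
  seq (forEach .genAfter (zeros 2)) <| seq (emit (bits t globals)) <|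
  seq (forEach .blkBefore (zeros 11)) <| seq (emit (bits t twoBlocks)) <|
  seq (forEach .blkAfter (zeros 11)) <| emit [.bit t.c, .sep]

/-- The encoding of an equation. -/
def rowCode (V : List Var) (t : Row Var) : List SysSymbol := bits t V ++ [.bit t.c, .sep]

theorem flatMap_range_add {α : Type} (g : ℕ → List α) (a b : ℕ) :
    (List.range (a + b)).flatMap g =
      (List.range a).flatMap g ++ (List.range b).flatMap fun j => g (a + j) := by
  rw [List.range_add, List.flatMap_append, List.flatMap_map]

theorem flatMap_range_const {α : Type} {g : ℕ → List α} {z : List α} {n : ℕ}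
    (hg : ∀ j < n, g j = z) : (List.range n).flatMap g = (List.replicate n z).flatten := by
  rw [List.flatMap_def]
  congr 1
  apply List.ext_getElem
  · simp
  · intro j h h'
    simp at h
    simpa using hg j h

theorem bits_inst (t : Row RelVar) (s o : ℕ) (l : List RelVar) :
    bits (t.map (RelVar.inst s o)) (l.map (RelVar.inst s o)) = bits t l := by
  unfold bits
  rw [List.map_map]
  exact List.map_congr_left fun v _ => by
    simp only [Function.comp_apply, Row.bit_map (RelVar.inst_injective s o)]

theorem bit_eq_zero {t : Row RelVar} {s o : ℕ} {v : Var} (hv : v ∉ Set.range (RelVar.inst s o)) :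
    (t.map (RelVar.inst s o)).bit v = 0 := by
  apply if_neg
  rintro (rfl | rfl | rfl) <;> exact hv ⟨_, rfl⟩

/-- Outside the window formed by the current generator, the globals and two blocks, all coefficients
vanish. So a row is determined by the pattern `t`, of which there are finitely many, and by four
counts. -/
theorem rowCode_inst (t : Row RelVar) {k B s o : ℕ} (hs : s < k) (ho : o < B) :
    rowCode (vars k B) (t.map (RelVar.inst s o)) =
      (List.replicate s (zeros 2)).flatten ++ bits t genPair ++
      (List.replicate (k - 1 - s) (zeros 2)).flatten ++ bits t globals ++
      (List.replicate o (zeros 11)).flatten ++ bits t twoBlocks ++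
      (List.replicate (B - 1 - o) (zeros 11)).flatten ++ [.bit t.c, .sep] := by
  have h1 : bits (t.map (RelVar.inst s o))
      ((List.range k).flatMap (fun s => [.gen s true, .gen s false])) =
      (List.replicate s (zeros 2)).flatten ++ bits t genPair ++
      (List.replicate (k - 1 - s) (zeros 2)).flatten := by
    have h : ∀ j ≠ s, ∀ e, (t.map (RelVar.inst s o)).bit (.gen j e) = 0 := fun j hj e =>
      bit_eq_zero (by rintro ⟨v, hv⟩; cases v <;> simp_all [RelVar.inst])
    obtain ⟨d, rfl⟩ : ∃ d, k = s + (1 + d) := ⟨k - 1 - s, by omega⟩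
    unfold bits
    rw [List.map_flatMap, flatMap_range_add, flatMap_range_add, List.append_assoc,
      show s + (1 + d) - 1 - s = d by omega]
    congr 1
    · refine flatMap_range_const fun j hj => ?_
      simp [h j (by omega), zeros]
    congr 1
    · rw [← bits, ← bits_inst t s o genPair]
      simp [bits, genPair, RelVar.inst]
    · refine flatMap_range_const fun j hj => ?_
      simp [h (s + (1 + j)) (by omega), zeros]
  have h2 : bits (t.map (RelVar.inst s o)) ((List.finRange 5).map .glob) = bits t globals := by
    rw [← bits_inst t s o globals]
    rfl
  have h3 : bits (t.map (RelVar.inst s o))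
      ((List.range (B + 1)).flatMap fun o => (List.finRange 11).map (.blk o)) =
      (List.replicate o (zeros 11)).flatten ++ bits t twoBlocks ++
      (List.replicate (B - 1 - o) (zeros 11)).flatten := by
    have h : ∀ j, j ≠ o → j ≠ o + 1 → ∀ e, (t.map (RelVar.inst s o)).bit (.blk j e) = 0 :=
      fun j hj hj' e =>
        bit_eq_zero (by rintro ⟨v, hv⟩; cases v <;> simp_all [RelVar.inst])
    obtain ⟨d, rfl⟩ : ∃ d, B = o + (1 + d) := ⟨B - 1 - o, by omega⟩
    unfold bits
    rw [List.map_flatMap, show o + (1 + d) + 1 = o + (2 + d) by ring, flatMap_range_add,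
      flatMap_range_add, List.append_assoc, show o + (1 + d) - 1 - o = d by omega]
    congr 1
    · refine flatMap_range_const fun j hj => ?_
      simp [h j (by omega) (by omega), zeros, List.map_map, Function.comp_def]
    congr 1
    · rw [← bits, ← bits_inst t s o twoBlocks]
      simp [bits, twoBlocks, List.range_succ, RelVar.inst, List.map_map, Function.comp_def]
    · refine flatMap_range_const fun j hj => ?_
      simp [h (o + (2 + j)) (by omega) (by omega), zeros, List.map_map, Function.comp_def]
  have h4 : ∀ l l', bits (t.map (RelVar.inst s o)) (l ++ l') =
      bits (t.map (RelVar.inst s o)) l ++ bits (t.map (RelVar.inst s o)) l' :=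
    fun l l' => List.map_append
  unfold rowCode vars
  rw [h4, h4, h1, h2, h3]
  simp only [List.append_assoc]
  rfl

theorem runs_printRow (t : Row RelVar) (hc : c .aux = 0) :
    Runs (printRow t) (stk i r w o c)
      (stk i r (w ++ rowCode (vars (c .genBefore + 1 + c .genAfter)
        (c .blkBefore + 1 + c .blkAfter))
        (t.map (RelVar.inst (c .genBefore) (c .blkBefore)))) o c)
      (50 * (c .genBefore + c .genAfter + c .blkBefore + c .blkAfter + 1)) := by
  rw [rowCode_inst t (by omega) (by omega),
    show c .genBefore + 1 + c .genAfter - 1 - c .genBefore = c .genAfter by omega,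
    show c .blkBefore + 1 + c .blkAfter - 1 - c .blkBefore = c .blkAfter by omega]
  have h := (runs_forEach (i := i) (r := r) (w := w) (o := o) (x := .genBefore) (by decide) hc
    (zeros 2)).seq <| (runs_emit (bits t genPair)).seq <|
    (runs_forEach (x := .genAfter) (by decide) hc (zeros 2)).seq <|
    (runs_emit (bits t globals)).seq <|
    (runs_forEach (x := .blkBefore) (by decide) hc (zeros 11)).seq <|
    (runs_emit (bits t twoBlocks)).seq <|
    (runs_forEach (x := .blkAfter) (by decide) hc (zeros 11)).seq <|
    runs_emit [.bit t.c, .sep]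
  simp only [List.append_assoc] at h ⊢
  refine h.mono ?_
  simp [zeros, bits, genPair, globals, twoBlocks]
  omega

/-- Print a list of equations. -/
def printRows : List (Row RelVar) → Prog
  | [] => skip
  | t :: l => seq (printRow t) (printRows l)

theorem runs_printRows (l : List (Row RelVar)) (hc : c .aux = 0) :
    Runs (printRows l) (stk i r w o c)
      (stk i r (w ++ (l.map (Row.map (RelVar.inst (c .genBefore) (c .blkBefore)))).flatMap
        (rowCode (vars (c .genBefore + 1 + c .genAfter) (c .blkBefore + 1 + c .blkAfter)))) o c)
      (l.length * (50 * (c .genBefore + c .genAfter + c .blkBefore + c .blkAfter + 1)) + 1) := by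
  induction l generalizing w with
  | nil =>
    rw [List.map_nil, List.flatMap_nil, List.append_nil]
    exact (Runs.skip _).mono (by simp)
  | cons t l ih =>
    have h := (runs_printRow (i := i) (r := r) (w := w) (o := o) t hc).seq ih
    rw [List.map_cons, List.flatMap_cons, ← List.append_assoc]
    exact h.mono (by rw [List.length_cons]; ring_nf; omega)


/-- The values of the counters; the auxiliary counter is `0`. -/
def cfg (gb ga bb ba fl : ℕ) : Ctr → ℕ
  | .genBefore => gb
  | .genAfter => ga
  | .blkBefore => bb
  | .blkAfter => ba
  | .aux => 0
  | .flag => fl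

section

variable (gb ga bb ba fl n : ℕ)

theorem update_genBefore :
    Function.update (cfg gb ga bb ba fl) .genBefore n = cfg n ga bb ba fl := by
  funext x; cases x <;> rfl

theorem update_genAfter :
    Function.update (cfg gb ga bb ba fl) .genAfter n = cfg gb n bb ba fl := by
  funext x; cases x <;> rfl

theorem update_blkBefore :
    Function.update (cfg gb ga bb ba fl) .blkBefore n = cfg gb ga n ba fl := by
  funext x; cases x <;> rfl

theorem update_blkAfter :
    Function.update (cfg gb ga bb ba fl) .blkAfter n = cfg gb ga bb n fl := by
  funext x; cases x <;> rfl

theorem update_flag :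
    Function.update (cfg gb ga bb ba fl) .flag n = cfg gb ga bb ba n := by
  funext x; cases x <;> rfl

end

/-- The sign or mark that ends the encoding of a token. -/
def Tok.mark : Tok → PresSymbol
  | letter _ e => if e then .pos else .neg
  | endmark => .sep

/-- The encoding of a token. -/
def Tok.encode (t : Tok) : List PresSymbol := List.replicate t.index .tick ++ [t.mark]

theorem encode_eq (P : FinPres) : P.encode =
    List.replicate P.numGens .tick ++ .sep :: (List.replicate P.J.val .tick ++
      .sep :: P.tokens.flatMap Tok.encode) := by
  unfold FinPres.encode FinPres.tokens
  rw [List.flatMap_assoc]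
  simp only [List.append_assoc, List.cons_append, List.nil_append]
  congr 4
  refine List.flatMap_congr fun r _ => ?_
  rw [List.flatMap_append, List.flatMap_map]
  rfl

variable {i r : List PresSymbol} {w o : List SysSymbol} {gb ga bb ba fl : ℕ}

/-- Read an index in unary and count the generators. -/
def readGens : Prog :=
  loop .inp (fun a => decide (a = some .tick)) <| seq (pop .inp) (push (.ctr .genAfter) ())

theorem runs_readGens (n : ℕ) : Runs readGens
    (stk (List.replicate n .tick ++ .sep :: i) r w o (cfg gb ga bb ba fl))
    (stk (.sep :: i) r w o (cfg gb (ga + n) bb ba fl)) (3 * n + 1) := by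
  induction n generalizing ga with
  | zero => exact (Runs.loop_false (by simp [stk])).mono (by simp)
  | succ n ih =>
    have h1 := runs_inc (i := List.replicate n .tick ++ .sep :: i) (r := r) (w := w) (o := o)
      (c := cfg gb ga bb ba fl) .genAfter
    rw [update_genAfter] at h1
    have h := Runs.loop_true (c := fun a => decide (a = some .tick)) (k := Stk.inp)
      (by simp [stk]) (runs_pop_inp (a := .tick).seq h1) (ih (ga := ga + 1))
    rw [show ga + (n + 1) = ga + 1 + n by ring]
    exact h.mono (by omega)

/-- Read an index in unary and make it the current generator. -/
def readIndex : Prog :=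
  loop .inp (fun a => decide (a = some .tick)) <| seq (pop .inp) <|
    seq (pop (.ctr .genAfter)) (push (.ctr .genBefore) ())

theorem runs_readIndex (n : ℕ) {a : PresSymbol} (ha : a ≠ .tick) : Runs readIndex
    (stk (List.replicate n .tick ++ a :: i) r w o (cfg gb ga bb ba fl))
    (stk (a :: i) r w o (cfg (gb + n) (ga - n) bb ba fl)) (4 * n + 1) := by
  induction n generalizing ga gb with
  | zero => exact (Runs.loop_false (by simp [stk, ha])).mono (by simp)
  | succ n ih =>
    have h1 := runs_dec (i := List.replicate n .tick ++ a :: i) (r := r) (w := w) (o := o)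
      (c := cfg gb ga bb ba fl) .genAfter
    rw [update_genAfter] at h1
    have h2 := runs_inc (i := List.replicate n .tick ++ a :: i) (r := r) (w := w) (o := o)
      (c := cfg gb (ga - 1) bb ba fl) .genBefore
    rw [update_genBefore] at h2
    have h := Runs.loop_true (c := fun a => decide (a = some .tick)) (k := Stk.inp)
      (by simp [stk]) (runs_pop_inp (a := .tick).seq (h1.seq h2)) (ih (ga := ga - 1) (gb := gb + 1))
    rw [show gb + (n + 1) = gb + 1 + n by ring, show ga - (n + 1) = ga - 1 - n by omega]
    exact h.mono (by omega)

/-- Move the input to another stack and count its tokens. -/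
def countToks : Prog :=
  loop .inp Option.isSome <| switch .inp (fun a => seq (pop .inp) <| seq (push .rev a) <|
    if a = .tick then skip else push (.ctr .blkAfter) ()) [.tick, .pos, .neg, .sep]

theorem runs_countToks (l : List PresSymbol) : Runs countToks
    (stk l r w o (cfg gb ga bb ba fl))
    (stk [] (l.reverse ++ r) w o (cfg gb ga bb (ba + l.countP (· ≠ .tick)) fl))
    (8 * l.length + 1) := by
  induction l generalizing r ba with
  | nil => exact (Runs.loop_false (by simp [stk])).mono (by simp)
  | cons a l ih =>
    have h1 : Runs (if a = .tick then skip else push (.ctr .blkAfter) () : Prog)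
        (stk l (a :: r) w o (cfg gb ga bb ba fl))
        (stk l (a :: r) w o (cfg gb ga bb (ba + if a = .tick then 0 else 1) fl)) 1 := by
      split_ifs
      · exact Runs.skip _
      · have h := runs_inc (i := l) (r := a :: r) (w := w) (o := o)
          (c := cfg gb ga bb ba fl) .blkAfter
        rwa [update_blkAfter] at h
    have h2 := Runs.switch (k := Stk.inp) (body := fun a => seq (pop .inp) <| seq (push .rev a) <|
      if a = .tick then skip else push (.ctr .blkAfter) ()) (as := [.tick, .pos, .neg, .sep])
      ((runs_pop_inp (i := l) (a := a)).seq ((runs_push_rev a).seq h1)) (by cases a <;> simp) rfl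
    have h := Runs.loop_true (c := Option.isSome) (k := Stk.inp) (by simp [stk]) h2 ih
    rw [List.reverse_cons, List.append_assoc, List.countP_cons]
    rw [show ba + (l.countP (· ≠ .tick) + if decide (a ≠ .tick) = true then 1 else 0) =
      (ba + if a = .tick then 0 else 1) + l.countP (· ≠ .tick) by
        by_cases ha : a = .tick <;> simp [ha]; ring]
    exact h.mono (by simp only [List.length_cons, List.length_nil]; omega)

/-- Move the input back. -/
def rewind : Prog :=
  loop .rev Option.isSome <| switch .rev (fun a => seq (pop .rev) (push .inp a))
    [.tick, .pos, .neg, .sep]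

theorem runs_rewind (l : List PresSymbol) {c : Ctr → ℕ} : Runs rewind
    (stk i l w o c) (stk (l.reverse ++ i) [] w o c) (7 * l.length + 1) := by
  induction l generalizing i with
  | nil => exact (Runs.loop_false (by simp [stk])).mono (by simp)
  | cons a l ih =>
    have h2 := Runs.switch (k := Stk.rev) (body := fun a => seq (pop .rev) (push .inp a))
      (as := [.tick, .pos, .neg, .sep])
      ((runs_pop_rev (i := i) (r := l) (w := w) (o := o) (c := c) (a := a)).seq
        (runs_push_inp a)) (by cases a <;> simp) rfl
    have h := Runs.loop_true (c := Option.isSome) (k := Stk.rev) (by simp [stk]) h2 ih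
    rw [List.reverse_cons, List.append_assoc]
    exact h.mono (by simp only [List.length_cons, List.length_nil]; omega)

/-- Move the printed word to the output stack. -/
def flush : Prog :=
  loop .tmp Option.isSome <| switch .tmp (fun a => seq (pop .tmp) (push .out a))
    [.tick, .bit 0, .bit 1, .sep]

theorem runs_flush (w : List SysSymbol) {c : Ctr → ℕ} : Runs flush
    (stk i r w o c) (stk i r [] (w ++ o) c) (7 * w.length + 1) := by
  induction w using List.reverseRecOn generalizing o with
  | nil => exact (Runs.loop_false (by simp [stk])).mono (by simp)
  | append_singleton w a ih =>
    have ha : a ∈ [SysSymbol.tick, .bit 0, .bit 1, .sep] := by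
      rcases a with _ | b | _
      · simp
      · obtain rfl | rfl : b = 0 ∨ b = 1 := by revert b; decide
        all_goals simp
      · simp
    have h2 := Runs.switch (k := Stk.tmp) (body := fun a => seq (pop .tmp) (push .out a))
      ((runs_pop_tmp (i := i) (r := r) (w := w) (o := o) (c := c) (a := a)).seq
        (runs_push_out a)) ha (by simp [stk])
    have h := Runs.loop_true (c := Option.isSome) (k := Stk.tmp) (by simp [stk]) h2 ih
    rw [List.append_assoc]
    exact h.mono (by simp only [List.length_cons, List.length_nil, List.length_append]; omega)

/-- Set the counter `x` to `0`. -/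
def clear (x : Ctr) : Prog := loop (.ctr x) Option.isSome (pop (.ctr x))

theorem runs_clear (x : Ctr) (c : Ctr → ℕ) : Runs (clear x) (stk i r w o c)
    (stk i r w o (Function.update c x 0)) (2 * c x + 1) := by
  obtain ⟨n, hn⟩ : ∃ n, c x = n := ⟨_, rfl⟩
  induction n generalizing c with
  | zero =>
    rw [← hn, Function.update_eq_self]
    exact (Runs.loop_false (by simp [stk, hn])).mono (by simp)
  | succ n ih =>
    have h1 := runs_dec (i := i) (r := r) (w := w) (o := o) (c := c) x
    have h := Runs.loop_true (c := Option.isSome) (by simp [stk, hn]) h1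
      (ih _ (by simp [hn]))
    rw [Function.update_idem] at h
    exact h.mono (by simp [hn]; omega)

/-- The token with the given mark and the generator `0`. -/
def tokOfMark : PresSymbol → Tok
  | .pos => .letter 0 true
  | .neg => .letter 0 false
  | _ => .endmark

/-- In relative variables the equations do not depend on the index of the generator, so the finite
control needs only the mark; the index lives in the counters. -/
theorem tokRows_mark (b : Bool) (t : Tok) : tokRows b (tokOfMark t.mark) = tokRows b t := by
  rcases t with ⟨s, e⟩ | _
  · cases e <;> rfl
  · rfl

/-- Process the mark of a token. -/
def readMark (a : PresSymbol) : Prog :=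
  seq (pop .inp) <| seq
    (ite (.ctr .flag) Option.isSome (printRows (tokRows true (tokOfMark a)))
      (printRows (tokRows false (tokOfMark a)))) <|
    seq (clear .flag) <| if a = .sep then push (.ctr .flag) () else skip

theorem length_tokRows_le (b : Bool) (t : Tok) : (tokRows b t).length ≤ 8 := by
  rcases t with ⟨s, e⟩ | _ <;> simp [tokRows, linkRows, letterRows]

theorem runs_readMark (t : Tok) (b : Bool) : Runs (readMark t.mark)
    (stk (t.mark :: i) r w o (cfg gb ga bb ba b.toNat))
    (stk i r (w ++ ((tokRows b t).map (Row.map (RelVar.inst gb bb))).flatMap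
      (rowCode (vars (gb + 1 + ga) (bb + 1 + ba)))) o
      (cfg gb ga bb ba (decide (t = .endmark)).toNat))
    (410 * (gb + ga + bb + ba + 1)) := by
  have h1 := runs_pop_inp (i := i) (r := r) (w := w) (o := o)
    (c := cfg gb ga bb ba b.toNat) (a := t.mark)
  have h2 : Runs (ite (.ctr .flag) Option.isSome (printRows (tokRows true (tokOfMark t.mark)))
      (printRows (tokRows false (tokOfMark t.mark))) : Prog)
      (stk i r w o (cfg gb ga bb ba b.toNat))
      (stk i r (w ++ ((tokRows b t).map (Row.map (RelVar.inst gb bb))).flatMap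
        (rowCode (vars (gb + 1 + ga) (bb + 1 + ba)))) o (cfg gb ga bb ba b.toNat))
      (400 * (gb + ga + bb + ba + 1) + 2) := by
    have h := runs_printRows (i := i) (r := r) (w := w) (o := o)
      (c := cfg gb ga bb ba b.toNat) (tokRows b t) rfl
    have hT : 1 + ((tokRows b t).length * (50 * (gb + ga + bb + ba + 1)) + 1) ≤
        400 * (gb + ga + bb + ba + 1) + 2 := by
      have := Nat.mul_le_mul_right (50 * (gb + ga + bb + ba + 1)) (length_tokRows_le b t)
      omega
    cases b with
    | false =>
      rw [tokRows_mark, tokRows_mark]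
      exact (Runs.ite_false rfl h).mono hT
    | true =>
      rw [tokRows_mark, tokRows_mark]
      exact (Runs.ite_true rfl h).mono hT
  have h3 := runs_clear (i := i) (r := r) (o := o)
    (w := (w ++ ((tokRows b t).map (Row.map (RelVar.inst gb bb))).flatMap
        (rowCode (vars (gb + 1 + ga) (bb + 1 + ba))))) .flag (cfg gb ga bb ba b.toNat)
  rw [update_flag] at h3
  have h4 : Runs (if t.mark = .sep then push (.ctr .flag) () else skip : Prog)
      (stk i r (w ++ ((tokRows b t).map (Row.map (RelVar.inst gb bb))).flatMap
        (rowCode (vars (gb + 1 + ga) (bb + 1 + ba)))) o (cfg gb ga bb ba 0))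
      (stk i r (w ++ ((tokRows b t).map (Row.map (RelVar.inst gb bb))).flatMap
        (rowCode (vars (gb + 1 + ga) (bb + 1 + ba)))) o
        (cfg gb ga bb ba (decide (t = .endmark)).toNat)) 1 := by
    rcases t with ⟨s, e⟩ | _
    · rw [if_neg (by cases e <;> simp [Tok.mark])]
      exact Runs.skip _
    · rw [if_pos (show Tok.endmark.mark = PresSymbol.sep from rfl)]
      have h := runs_inc (i := i) (r := r) (o := o) (w := w ++ ((tokRows b .endmark).map
        (Row.map (RelVar.inst gb bb))).flatMap (rowCode (vars (gb + 1 + ga) (bb + 1 + ba))))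
        (c := cfg gb ga bb ba 0) .flag
      rwa [update_flag] at h
  refine (h1.seq (h2.seq (h3.seq h4))).mono ?_
  have : (cfg gb ga bb ba b.toNat) .flag ≤ 1 := b.toNat_le
  omega

/-- Process all tokens. -/
def readToks : Prog :=
  loop .inp Option.isSome <| seq readIndex <| seq (switch .inp readMark [.pos, .neg, .sep]) <|
    seq (drain .genBefore .genAfter []) <| seq (push (.ctr .blkBefore) ())
      (pop (.ctr .blkAfter))

theorem Tok.mark_mem (t : Tok) : t.mark ∈ [PresSymbol.pos, .neg, .sep] := by
  rcases t with ⟨s, e⟩ | _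
  · cases e <;> simp [mark]
  · simp [mark]

theorem Tok.mark_ne_tick (t : Tok) : t.mark ≠ .tick := by
  rcases t with ⟨s, e⟩ | _
  · cases e <;> simp [mark]
  · simp [mark]

/-- The loop invariant. Between tokens `genBefore` is `0`, the current generator is not counted, the
block counters leave out the two blocks of the window, and the flag tells whether a relator starts.
-/
theorem runs_readToks (ts : List Tok) {k : ℕ} (hts : ∀ t ∈ ts, t.index < k) :
    ∀ (l done : List Tok) (w : List SysSymbol), done ++ l = ts → Runs readToks
      (stk (l.flatMap Tok.encode) r w o
        (cfg 0 (k - 1) done.length (ts.length - 1 - done.length)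
          (startAt ts done.length).toNat))
      (stk [] r (w ++ (List.range' done.length l.length).flatMap fun o =>
          (rowsAt ts o).flatMap (rowCode (vars k ts.length))) o
        (cfg 0 (k - 1) ts.length 0 (startAt ts ts.length).toNat))
      (l.length * (420 * (k + ts.length)) + 1) := by
  intro l
  induction l with
  | nil =>
    rintro done w rfl
    refine Runs.mono (T := 1) ?_ (by simp)
    simp only [List.append_nil, List.length_nil, List.flatMap_nil, List.range'_zero]
    -- After the last token the counter `blkAfter` was already empty; truncated subtraction matches
    -- popping an empty stack.
    rw [show done.length - 1 - done.length = 0 by omega]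
    exact Runs.loop_false rfl
  | cons t l ih =>
    rintro done w rfl
    have ht : t.index < k := hts t (by simp)
    have hat : tokAt (done ++ t :: l) done.length = t := by simp [tokAt]
    have hst : startAt (done ++ t :: l) (done.length + 1) = decide (t = .endmark) := by
      simp [startAt, hat]
    have ih := ih (done ++ [t]) (w ++ (rowsAt (done ++ t :: l) done.length).flatMap
      (rowCode (vars k (done ++ t :: l).length))) (by simp)
    simp only [List.length_append, List.length_cons, List.length_nil, zero_add] at ih hst ⊢
    have h1 := runs_readIndex (i := l.flatMap Tok.encode) (r := r) (w := w) (o := o) (gb := 0)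
      (ga := k - 1) (bb := done.length) (ba := done.length + (l.length + 1) - 1 - done.length)
      (fl := (startAt (done ++ t :: l) done.length).toNat) t.index t.mark_ne_tick
    have h2 := Runs.switch (k := Stk.inp) (runs_readMark (i := l.flatMap Tok.encode) (r := r)
      (w := w) (o := o) (gb := t.index)
      (ga := k - 1 - t.index) (bb := done.length)
      (ba := done.length + (l.length + 1) - 1 - done.length) t
      (startAt (done ++ t :: l) done.length)) t.mark_mem rfl
    rw [show t.index + 1 + (k - 1 - t.index) = k by omega,
      show done.length + 1 + (done.length + (l.length + 1) - 1 - done.length) =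
        done.length + (l.length + 1) by omega] at h2
    have hrows : (rowsAt (done ++ t :: l) done.length) =
      ((tokRows (startAt (done ++ t :: l) done.length) t).map
        (Row.map (RelVar.inst t.index done.length))) := by
      rw [rowsAt, hat]
    rw [← hrows] at h2
    rw [zero_add] at h1
    have h3 := runs_drain (i := l.flatMap Tok.encode) (r := r) (w := w ++
      (rowsAt (done ++ t :: l) done.length).flatMap
        (rowCode (vars k (done.length + (l.length + 1))))) (o := o)
      (c := cfg t.index (k - 1 - t.index) done.length
        (done.length + (l.length + 1) - 1 - done.length) (decide (t = .endmark)).toNat)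
      (x := .genBefore) (y := .genAfter) (by decide) []
    simp only [update_genBefore, update_genAfter, List.flatten_replicate_nil,
      List.append_nil] at h3
    have e : cfg t.index (k - 1 - t.index) done.length
        (done.length + (l.length + 1) - 1 - done.length) (decide (t = .endmark)).toNat .genAfter +
        cfg t.index (k - 1 - t.index) done.length
        (done.length + (l.length + 1) - 1 - done.length) (decide (t = .endmark)).toNat .genBefore =
        k - 1 := by simp only [cfg]; omega
    rw [e] at h3
    have h4 := runs_inc (i := l.flatMap Tok.encode) (r := r) (w := w ++
      (rowsAt (done ++ t :: l) done.length).flatMap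
        (rowCode (vars k (done.length + (l.length + 1))))) (o := o)
      (c := cfg 0 (k - 1) done.length
        (done.length + (l.length + 1) - 1 - done.length) (decide (t = .endmark)).toNat)
      .blkBefore
    have h5 := runs_dec (i := l.flatMap Tok.encode) (r := r) (w := w ++
      (rowsAt (done ++ t :: l) done.length).flatMap
        (rowCode (vars k (done.length + (l.length + 1))))) (o := o)
      (c := cfg 0 (k - 1) (done.length + 1)
        (done.length + (l.length + 1) - 1 - done.length) (decide (t = .endmark)).toNat)
      .blkAfter
    rw [update_blkBefore] at h4
    rw [update_blkAfter] at h5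
    rw [← hst] at h3 h4 h5 h2
    simp only [cfg] at h4 h5
    rw [show done.length + (l.length + 1) - 1 - done.length - 1 =
      done.length + (l.length + 1) - 1 - (done.length + 1) by omega] at h5
    have h := Runs.loop_true (c := Option.isSome) (k := Stk.inp)
      (s := stk ((t :: l).flatMap Tok.encode) r w o
        (cfg 0 (k - 1) done.length (done.length + (l.length + 1) - 1 - done.length)
          (startAt (done ++ t :: l) done.length).toNat)) (by
        simp [stk, Tok.encode]) ((by
          simpa [Tok.encode] using h1 : Runs readIndex (stk ((t :: l).flatMap Tok.encode) r w o
        (cfg 0 (k - 1) done.length (done.length + (l.length + 1) - 1 - done.length)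
          (startAt (done ++ t :: l) done.length).toNat)) _ _).seq
        (h2.seq (h3.seq (h4.seq h5)))) ih
    rw [List.append_assoc] at h
    rw [List.range'_succ]
    refine h.mono ?_
    have e1 : t.index + (k - 1 - t.index) + done.length +
        (done.length + (l.length + 1) - 1 - done.length) + 1 =
        k + (done.length + (l.length + 1)) - 1 := by omega
    have e2 : (l.length + 1) * (420 * (k + (done.length + (l.length + 1)))) =
      l.length * (420 * (k + (done.length + (l.length + 1)))) +
        420 * (k + (done.length + (l.length + 1))) := by ring
    rw [e1, e2]
    simp only [cfg, List.length_cons, List.length_nil]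
    omega


/-- Read the number of generators and the index of `J`, and count the tokens. -/
def readHeader : Prog :=
  -- One generator is taken off the count for the window, and below, in the same way, one block.
  seq readGens <| seq (pop .inp) <| seq (pop (.ctr .genAfter)) <|
  seq readIndex <| seq (pop .inp) <|
  seq countToks <| seq (pop (.ctr .blkAfter)) rewind

/-- Print the number of variables. -/
def printHeader : Prog :=
  seq (forEach .genBefore (List.replicate 2 .tick)) <|
  seq (forEach .genAfter (List.replicate 2 .tick)) <|
  -- `29 = 2 + 5 + 2 * 11`: the pair of the current generator, the globals, and the two blocks of
  -- the window.
  seq (emit (List.replicate 29 .tick)) <| seq (forEach .blkAfter (List.replicate 11 .tick)) <|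
  emit [.sep]

/-- Print the equations for `J`. -/
def printForcing : Prog :=
  seq (printRows forcingRows) <|
  seq (drain .genBefore .genAfter []) <| push (.ctr .flag) ()

/-- Empty the working stacks and move the printed word to the output stack. -/
def finish : Prog := seq (clear .genAfter) <| seq (clear .blkBefore) <| seq (clear .flag) flush

/-- The program that constructs the system of a presentation. -/
def construct : Prog :=
  seq readHeader <| seq printHeader <| seq printForcing <| seq readToks finish

/-! ### Correctness and quadratic running time of the whole program. -/

theorem countP_encode (ts : List Tok) :
    (ts.flatMap Tok.encode).countP (· ≠ .tick) = ts.length := by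
  induction ts with
  | nil => rfl
  | cons t l ih =>
    rw [List.flatMap_cons, List.countP_append, ih, Tok.encode, List.countP_append,
      List.countP_replicate]
    simp [t.mark_ne_tick]
    omega

theorem length_flatMap_encode_le {ts : List Tok} {k : ℕ} (hts : ∀ t ∈ ts, t.index < k) :
    (ts.flatMap Tok.encode).length ≤ ts.length * k := by
  induction ts with
  | nil => simp
  | cons t l ih =>
    have h1 := hts t (by simp)
    have h2 := ih fun t ht => hts t (by simp [ht])
    rw [List.flatMap_cons, List.length_append, Tok.encode, List.length_append,
      List.length_replicate, List.length_cons]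
    simp only [List.length_cons, List.length_nil]
    rw [add_mul]
    omega

theorem flatten_replicate_replicate {α : Type} (m n : ℕ) (a : α) :
    (List.replicate m (List.replicate n a)).flatten = List.replicate (m * n) a := by
  simp

theorem runs_readHeader {k J : ℕ} (ts : List Tok) : Runs readHeader
    (stk (List.replicate k .tick ++ .sep :: (List.replicate J .tick ++
      .sep :: ts.flatMap Tok.encode)) [] [] [] (cfg 0 0 0 0 0))
    (stk (ts.flatMap Tok.encode) [] [] [] (cfg J (k - 1 - J) 0 (ts.length - 1) 0))
    (3 * k + 4 * J + 15 * (ts.flatMap Tok.encode).length + 8) := by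
  have hcount := countP_encode ts
  generalize ts.flatMap Tok.encode = enc at *
  have h1 := runs_readGens (i := List.replicate J .tick ++ .sep :: enc) (r := []) (w := [])
    (o := []) (gb := 0) (ga := 0) (bb := 0) (ba := 0) (fl := 0) k
  have h2 := runs_pop_inp (i := List.replicate J .tick ++ .sep :: enc) (r := []) (w := [])
    (o := []) (c := cfg 0 (0 + k) 0 0 0) (a := .sep)
  have h3 := runs_dec (i := List.replicate J .tick ++ .sep :: enc) (r := []) (w := [])
    (o := []) (c := cfg 0 (0 + k) 0 0 0) .genAfter
  rw [update_genAfter] at h3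
  simp only [cfg] at h3
  have h4 := runs_readIndex (i := enc) (r := []) (w := [])
    (o := []) (gb := 0) (ga := 0 + k - 1) (bb := 0) (ba := 0) (fl := 0) J (a := .sep)
    (by simp)
  have h5 := runs_pop_inp (i := enc) (r := []) (w := [])
    (o := []) (c := cfg (0 + J) (0 + k - 1 - J) 0 0 0) (a := .sep)
  have h6 := runs_countToks (r := []) (w := []) (o := []) (gb := 0 + J) (ga := 0 + k - 1 - J)
    (bb := 0) (ba := 0) (fl := 0) enc
  have h7 := runs_dec (i := []) (r := enc.reverse ++ []) (w := []) (o := [])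
    (c := cfg (0 + J) (0 + k - 1 - J) 0 (0 + enc.countP (· ≠ .tick)) 0) .blkAfter
  rw [update_blkAfter] at h7
  simp only [cfg] at h7
  have h8 := runs_rewind (i := []) (w := []) (o := []) (enc.reverse ++ [])
    (c := cfg (0 + J) (0 + k - 1 - J) 0 (0 + enc.countP (· ≠ .tick) - 1) 0)
  rw [hcount] at h6 h7 h8
  simp only [List.append_nil, List.reverse_reverse, zero_add, List.length_reverse]
    at h1 h2 h3 h4 h5 h6 h7 h8
  exact (h1.seq <| h2.seq <| h3.seq <| h4.seq <| h5.seq <| h6.seq <| h7.seq h8).mono (by omega)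

theorem runs_printHeader {J k B : ℕ} (hJ : J < k) (hB : 0 < B) (i : List PresSymbol) :
    Runs printHeader (stk i [] [] [] (cfg J (k - 1 - J) 0 (B - 1) 0))
      (stk i [] (List.replicate (vars k B).length .tick ++ [.sep]) []
        (cfg J (k - 1 - J) 0 (B - 1) 0)) (50 * (k + B)) := by
  rw [length_vars]
  have h9 := runs_forEach (i := i) (r := []) (w := []) (o := [])
    (c := cfg J (k - 1 - J) 0 (B - 1) 0) (x := .genBefore) (by decide) rfl
    (List.replicate 2 .tick)
  have h10 := runs_forEach (i := i) (r := [])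
    (w := List.replicate (J * 2) .tick) (o := [])
    (c := cfg J (k - 1 - J) 0 (B - 1) 0) (x := .genAfter) (by decide) rfl
    (List.replicate 2 .tick)
  have h11 := runs_emit (i := i) (r := [])
    (w := List.replicate (J * 2 + (k - 1 - J) * 2) .tick) (o := [])
    (c := cfg J (k - 1 - J) 0 (B - 1) 0) (List.replicate 29 .tick)
  have h12 := runs_forEach (i := i) (r := [])
    (w := List.replicate (J * 2 + (k - 1 - J) * 2 + 29) .tick) (o := [])
    (c := cfg J (k - 1 - J) 0 (B - 1) 0) (x := .blkAfter) (by decide) rfl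
    (List.replicate 11 .tick)
  rw [flatten_replicate_replicate] at h9 h10 h12
  rw [← List.replicate_add] at h10 h11 h12
  simp only [cfg, List.nil_append] at h9 h10 h12
  rw [show J * 2 + (k - 1 - J) * 2 + 29 + (B - 1) * 11 = 2 * k + 5 + 11 * (B + 1) by omega] at h12
  have h13 := runs_emit (i := i) (r := [])
    (w := List.replicate (2 * k + 5 + 11 * (B + 1)) .tick) (o := [])
    (c := cfg J (k - 1 - J) 0 (B - 1) 0) [.sep]
  refine (h9.seq <| h10.seq <| h11.seq <| h12.seq h13).mono ?_
  simp only [List.length_replicate, List.length_cons, List.length_nil]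
  omega

theorem runs_printForcing {J k B : ℕ} (hJ : J < k) (hB : 0 < B) (i : List PresSymbol)
    (w : List SysSymbol) :
    Runs printForcing (stk i [] w [] (cfg J (k - 1 - J) 0 (B - 1) 0))
      (stk i [] (w ++ (forcingRows.map (Row.map (RelVar.inst J 0))).flatMap (rowCode (vars k B))) []
        (cfg 0 (k - 1) 0 (B - 1) 1)) (310 * (k + B)) := by
  have h14 := runs_printRows (i := i) (r := [])
    (w := w) (o := []) (c := cfg J (k - 1 - J) 0 (B - 1) 0) forcingRows rfl
  simp only [cfg] at h14
  rw [show J + 1 + (k - 1 - J) = k by omega, show 0 + 1 + (B - 1) = B by omega] at h14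
  generalize (forcingRows.map (Row.map (RelVar.inst J 0))).flatMap (rowCode (vars k B)) = w' at *
  have h15 := runs_drain (i := i) (r := []) (w := w ++ w') (o := [])
    (c := cfg J (k - 1 - J) 0 (B - 1) 0) (x := .genBefore) (y := .genAfter)
    (by decide) []
  simp only [update_genBefore, update_genAfter, List.flatten_replicate_nil,
    List.append_nil] at h15
  simp only [cfg] at h15
  rw [show k - 1 - J + J = k - 1 by omega] at h15
  have h16 := runs_inc (i := i) (r := []) (w := w ++ w') (o := [])
    (c := cfg 0 (k - 1) 0 (B - 1) 0) .flag
  rw [update_flag] at h16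
  simp only [cfg, zero_add] at h16
  refine (h14.seq <| h15.seq h16).mono ?_
  simp only [List.length_nil, show forcingRows.length = 6 from rfl]
  omega

theorem runs_finish (w : List SysSymbol) (ga bb : ℕ) :
    Runs finish (stk [] [] w [] (cfg 0 ga bb 0 1)) (stk [] [] [] w (cfg 0 0 0 0 0))
      (2 * ga + 2 * bb + 7 * w.length + 6) := by
  have h18 := runs_clear (i := []) (r := []) (w := w) (o := []) .genAfter (cfg 0 ga bb 0 1)
  have h19 := runs_clear (i := []) (r := []) (w := w) (o := []) .blkBefore (cfg 0 0 bb 0 1)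
  have h20 := runs_clear (i := []) (r := []) (w := w) (o := []) .flag (cfg 0 0 0 0 1)
  rw [update_genAfter] at h18
  rw [update_blkBefore] at h19
  rw [update_flag] at h20
  have h21 := runs_flush (i := []) (r := []) (o := []) w (c := cfg 0 0 0 0 0)
  rw [List.append_nil] at h21
  refine (h18.seq <| h19.seq <| h20.seq h21).mono ?_
  simp only [cfg]
  omega

theorem runs_construct {k J : ℕ} {ts : List Tok} (hJ : J < k) (hts : ∀ t ∈ ts, t.index < k)
    (h0 : ts ≠ []) (hlast : startAt ts ts.length = true) :
    Runs construct
      (stk (List.replicate k .tick ++ .sep :: (List.replicate J .tick ++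
        .sep :: ts.flatMap Tok.encode)) [] [] [] (cfg 0 0 0 0 0))
      (stk [] [] [] (LinSys.encode (matrix (vars k ts.length) (rows J ts)) (vector (rows J ts)))
        (cfg 0 0 0 0 0)) (5000 * (k + ts.length) ^ 2) := by
  have hB : 0 < ts.length := List.length_pos_iff.mpr h0
  have hlen : (ts.flatMap Tok.encode).length ≤ ts.length * k := length_flatMap_encode_le hts
  have hVlen : (vars k ts.length).length = 2 * k + 5 + 11 * (ts.length + 1) :=
    length_vars k ts.length
  have hRlen := length_rows_le J ts
  have hw : List.replicate (vars k ts.length).length .tick ++ [.sep] ++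
      (forcingRows.map (Row.map (RelVar.inst J 0))).flatMap (rowCode (vars k ts.length)) ++
      (List.range' 0 ts.length).flatMap
        (fun o => (rowsAt ts o).flatMap (rowCode (vars k ts.length))) =
      LinSys.encode (matrix (vars k ts.length) (rows J ts)) (vector (rows J ts)) := by
    rw [encode_matrix_vector, rows, List.flatMap_append, List.flatMap_assoc,
      List.range_eq_range', List.append_assoc]
    rfl
  have hwlen : (LinSys.encode (matrix (vars k ts.length) (rows J ts))
      (vector (rows J ts))).length =
      (vars k ts.length).length + 1 + (rows J ts).length * ((vars k ts.length).length + 2) := by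
    rw [encode_matrix_vector, List.length_append, List.length_flatMap]
    simp
  have h17 := runs_readToks (r := []) (o := []) ts hts ts []
    (List.replicate (vars k ts.length).length .tick ++ [.sep] ++
      (forcingRows.map (Row.map (RelVar.inst J 0))).flatMap (rowCode (vars k ts.length))) rfl
  rw [List.length_nil, hw, hlast] at h17
  have h := (runs_readHeader (k := k) (J := J) ts).seq <|
    (runs_printHeader hJ hB _).seq <| (runs_printForcing hJ hB _ _).seq <|
    h17.seq (runs_finish _ _ _)
  refine h.mono ?_
  rw [hwlen]
  have hX : 2 ≤ k + ts.length := by omega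
  have b1 : k + ts.length ≤ (k + ts.length) ^ 2 := by nlinarith
  have b2 : ts.length * k ≤ (k + ts.length) ^ 2 := by nlinarith
  have b3 : ts.length * (420 * (k + ts.length)) ≤ 420 * (k + ts.length) ^ 2 := by nlinarith
  have b4 : (rows J ts).length * ((vars k ts.length).length + 2) ≤
      (14 * (k + ts.length)) * (20 * (k + ts.length)) :=
    Nat.mul_le_mul (by omega) (by omega)
  have b5 : (14 * (k + ts.length)) * (20 * (k + ts.length)) = 280 * (k + ts.length) ^ 2 := by ring
  omega

theorem stk_init (x : List PresSymbol) :
    stk x [] [] [] (cfg 0 0 0 0 0) =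
      Function.update (β := fun k => List (StkAlphabet k)) (fun _ => []) .inp x := by
  funext k
  rcases k with _ | _ | _ | _ | c
  · rfl
  · rfl
  · rfl
  · rfl
  · cases c <;> rfl

theorem stk_final (x : List SysSymbol) :
    stk [] [] [] x (cfg 0 0 0 0 0) =
      Function.update (β := fun k => List (StkAlphabet k)) (fun _ => []) .out x := by
  funext k
  rcases k with _ | _ | _ | _ | c
  · rfl
  · rfl
  · rfl
  · rfl
  · cases c <;> rfl

/-- The Turing machine that constructs the system of a presentation. -/
def constructor : Turing.TM2ComputableAux PresSymbol SysSymbol where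
  tm := machine construct .inp .out
  inputAlphabet := Equiv.refl _
  outputAlphabet := Equiv.refl _

instance : Finite SysSymbol :=
  Finite.of_injective (β := Option (Option (ZMod 2)))
    (fun | .tick => none | .sep => some none | .bit b => some (some b)) (by
      intro a b h
      cases a <;> cases b <;> simp_all)

theorem finite_alphabet (k : constructor.tm.K) : Finite (constructor.tm.Γ k) := by
  change Finite (StkAlphabet k)
  cases k <;> simp only [StkAlphabet] <;> infer_instance

/-- This is the state of the flag when the input is exhausted, as `runs_finish` expects it. -/
theorem startAt_length_tokens (P : FinPres) : startAt P.tokens P.tokens.length = true := by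
  rcases List.eq_nil_or_concat P.rels with h | ⟨l, r, h⟩
  · simp [FinPres.tokens, h, startAt]
  · obtain ⟨l', h'⟩ : ∃ l', P.tokens = l' ++ [Tok.endmark] := by
      simp [FinPres.tokens, h, ← List.append_assoc]
    rw [h', List.length_append]
    simp [startAt, tokAt]

theorem constructor_constructsInTime (P : FinPres) (hP : P.rels ≠ []) :
    ConstructsInTime constructor P (matrix (vars P.numGens P.tokens.length) (rows P.J P.tokens))
      (vector (rows P.J P.tokens)) (50000 * P.size ^ 2) := by
  have h0 : P.tokens ≠ [] := by
    obtain ⟨r, l, h⟩ := List.exists_cons_of_ne_nil hP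
    simp [FinPres.tokens, h]
  have h := runs_construct P.J.2 (index_lt_of_mem_tokens P) h0 (startAt_length_tokens P)
  rw [← encode_eq, stk_init, stk_final] at h
  have h1 : P.numGens ≤ P.size := Nat.le_add_right _ _
  have h2 := length_tokens_le P
  have h3 : 1 ≤ P.size := P.J.pos.trans_le h1
  have h4 : 5000 * (P.numGens + P.tokens.length) ^ 2 + 1 ≤ 50000 * P.size ^ 2 := by
    have : (P.numGens + P.tokens.length) ^ 2 ≤ (3 * P.size) ^ 2 :=
      Nat.pow_le_pow_left (by omega) 2
    nlinarith
  have key : ∀ x y, x = P.encode → y = LinSys.encode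
      (matrix (vars P.numGens P.tokens.length) (rows P.J P.tokens))
      (vector (rows P.J P.tokens)) →
      Nonempty (Turing.TM2OutputsInTime (machine construct .inp .out) x (some y)
        (50000 * P.size ^ 2)) := by
    rintro _ _ rfl rfl
    obtain ⟨x⟩ := h.outputsInTime
    exact ⟨⟨x.toEvalsTo, x.steps_le_m.trans h4⟩⟩
  exact key _ _ (List.map_id _) (List.map_id _)

end WheelSystem

/-! ### Realizing automorphisms by involutions of a symmetric group. -/

section RegularAction

variable {B K : Type} [Group B] [Group K]

/-- Left multiplication, as a permutation. -/
abbrev leftMul (K : Type) [Group K] : K →* Equiv.Perm K := MulAction.toPermHom K K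

theorem leftMul_injective : Function.Injective (leftMul K) := MulAction.toPerm_injective

/-- An involutive automorphism of a subgroup `B` is conjugation by an involution of the symmetric
group of `K`. -/
theorem exists_involution_conj (f : B →* K) (hf : Function.Injective f) (θ : B →* B)
    (hθ : ∀ b, θ (θ b) = b) :
    ∃ a : Equiv.Perm K, a * a = 1 ∧ ∀ b, a * leftMul K (f b) * a = leftMul K (f (θ b)) := by
  -- `r k` represents the right coset of `k` modulo the image of `f`, so `k = f (β k) * r k` with a
  -- unique `β k`.
  let r : K → K := fun k => (Quotient.mk (QuotientGroup.rightRel f.range) k).out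
  have hr : ∀ k, ∃ b, k = f b * r k := by
    intro k
    have h : QuotientGroup.rightRel f.range (r k) k := Quotient.exact (Quotient.out_eq _)
    rw [QuotientGroup.rightRel_apply] at h
    obtain ⟨b, hb⟩ := h
    exact ⟨b, by rw [hb, inv_mul_cancel_right]⟩
  have hrf : ∀ b k, r (f b * k) = r k := by
    intro b k
    have h : Quotient.mk (QuotientGroup.rightRel f.range) (f b * k) = Quotient.mk _ k := by
      apply Quotient.sound
      change QuotientGroup.rightRel f.range _ _
      rw [QuotientGroup.rightRel_apply]
      exact ⟨b⁻¹, by rw [map_inv]; group⟩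
    simp only [r, h]
  have hrr : ∀ k, r (r k) = r k := by
    intro k
    obtain ⟨b, hb⟩ := hr k
    calc r (r k) = r (f b * r k) := (hrf _ _).symm
      _ = r k := by rw [← hb]
  choose β hβ using hr
  have hu : ∀ b k, r k = k → β (f b * k) = b := by
    intro b k hk
    have h := hβ (f b * k)
    rw [hrf, hk] at h
    exact (hf (mul_right_cancel h)).symm
  -- The involution applies `θ` to the subgroup coordinate and fixes the coset representative.
  let a : K → K := fun k => f (θ (β k)) * r k
  have ha : ∀ b k, a (f b * r k) = f (θ b) * r k := by
    intro b k
    simp only [a]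
    rw [hu b (r k) (hrr k), hrf, hrr]
  have hinv : Function.Involutive a := by
    intro k
    rw [show a k = f (θ (β k)) * r k from rfl, ha, hθ, ← hβ]
  refine ⟨hinv.toPerm, ?_, ?_⟩
  · ext k
    exact hinv k
  · intro b
    ext k
    change a (f b * a k) = f (θ b) * k
    rw [show a k = f (θ (β k)) * r k from rfl, ← mul_assoc, ← map_mul, ha, map_mul, hθ, map_mul,
      mul_assoc, ← hβ]

end RegularAction

/-! ### Flower groups: the universal rim of wheels with a common base spoke. -/

/-- The products of the terms of a sequence since the last reset. -/
def prefixProd {K : Type} [Monoid K] (reset : ℕ → Bool) (x : ℕ → K) : ℕ → K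
  | 0 => 1
  | i + 1 => if reset i then 1 else prefixProd reset x i * x i

theorem map_prefixProd {K L : Type} [Monoid K] [Monoid L] (f : K →* L) (reset : ℕ → Bool)
    (x : ℕ → K) (i : ℕ) : f (prefixProd reset x i) = prefixProd reset (fun i => f (x i)) i := by
  induction i with
  | zero => exact map_one f
  | succ i ih => simp only [prefixProd]; split_ifs <;> simp [ih]

/-- The relators of the flower group. -/
def flowerRels (reset : ℕ → Bool) : Set (FreeGroup ℕ) :=
  {r | (∃ i, r = .of i * .of i) ∨ ∃ i, reset i = true ∧ r = prefixProd reset .of i * .of i}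

/-- The universal group generated by a sequence of involutions, the product of which is `1` at
every reset. -/
abbrev Flower (reset : ℕ → Bool) : Type := PresentedGroup (flowerRels reset)

namespace Flower

variable {reset : ℕ → Bool} {K : Type} [Group K]

/-- The generators. -/
def gen (reset : ℕ → Bool) (i : ℕ) : Flower reset := PresentedGroup.of i

theorem gen_mul_self (i : ℕ) : gen reset i * gen reset i = 1 :=
  PresentedGroup.one_of_mem (rels := flowerRels reset) (.inl ⟨i, rfl⟩)

theorem prefixProd_mul_gen {i : ℕ} (hi : reset i = true) :
    prefixProd reset (gen reset) i * gen reset i = 1 := by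
  have h := PresentedGroup.one_of_mem (rels := flowerRels reset) (.inr ⟨i, hi, rfl⟩)
  rw [map_mul, map_prefixProd] at h
  exact h

/-- At a reset both sides are `1` by the cycle relation, so in the flower group the recursion has no
exceptional case. -/
theorem prefixProd_succ (i : ℕ) : prefixProd reset (gen reset) (i + 1) =
    prefixProd reset (gen reset) i * gen reset i := by
  by_cases h : reset i = true
  · rw [prefixProd_mul_gen h, prefixProd, if_pos h]
  · rw [prefixProd, if_neg h]

/-- The universal property. -/
def lift (x : ℕ → K) (hx : ∀ i, x i * x i = 1)
    (hr : ∀ i, reset i = true → prefixProd reset x i * x i = 1) : Flower reset →* K :=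
  PresentedGroup.toGroup (f := x) (by
    rintro _ (⟨i, rfl⟩ | ⟨i, hi, rfl⟩)
    · rw [map_mul, FreeGroup.lift_apply_of, hx]
    · rw [map_mul, map_prefixProd]
      simpa using hr i hi)

theorem lift_gen (x : ℕ → K) (hx : ∀ i, x i * x i = 1)
    (hr : ∀ i, reset i = true → prefixProd reset x i * x i = 1) (i : ℕ) :
    lift x hx hr (gen reset i) = x i := PresentedGroup.toGroup.of _

theorem hom_ext {f g : Flower reset →* K} (h : ∀ i, f (gen reset i) = g (gen reset i)) : f = g :=
  PresentedGroup.ext h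

/-- With `p` the prefix product and `x` the next involution, the step is `p⁻¹ (p x p⁻¹) = x p⁻¹ = (p
x)⁻¹`. This makes `flip` well defined and shows that it inverts the prefix products. -/
theorem prefixProd_conj (i : ℕ) : prefixProd reset (fun i => prefixProd reset (gen reset) i *
    gen reset i * (prefixProd reset (gen reset) i)⁻¹) i = (prefixProd reset (gen reset) i)⁻¹ := by
  induction i with
  | zero => simp [prefixProd]
  | succ i ih =>
    rw [prefixProd, prefixProd]
    split_ifs
    · rw [inv_one]
    · rw [ih, mul_inv_rev, inv_eq_of_mul_eq_one_right (gen_mul_self i)]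
      group

/-- The automorphism that inverts all prefix products. -/
def flip (reset : ℕ → Bool) : Flower reset →* Flower reset :=
  lift (fun i => prefixProd reset (gen reset) i *
    gen reset i * (prefixProd reset (gen reset) i)⁻¹)
    (fun i => by
      have h := gen_mul_self (reset := reset) i
      calc _ = prefixProd reset (gen reset) i * (gen reset i * gen reset i) *
            (prefixProd reset (gen reset) i)⁻¹ := by group
        _ = 1 := by rw [h]; group)
    (fun i hi => by
      have h := prefixProd_mul_gen hi
      rw [prefixProd_conj, h, one_mul, eq_inv_of_mul_eq_one_left h, inv_inv, gen_mul_self])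

theorem flip_gen (i : ℕ) : flip reset (gen reset i) = prefixProd reset (gen reset) i *
    gen reset i * (prefixProd reset (gen reset) i)⁻¹ := lift_gen _ _ _ i

theorem flip_prefixProd (i : ℕ) : flip reset (prefixProd reset (gen reset) i) =
    (prefixProd reset (gen reset) i)⁻¹ := by
  rw [map_prefixProd]
  simp only [flip_gen]
  exact prefixProd_conj i

theorem flip_flip (h : Flower reset) : flip reset (flip reset h) = h := by
  have e : (flip reset).comp (flip reset) = MonoidHom.id _ := hom_ext fun i => by
    change flip reset (flip reset (gen reset i)) = gen reset i
    rw [flip_gen, map_mul, map_mul, map_inv, flip_prefixProd, flip_gen]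
    group
  exact DFunLike.congr_fun e h

/-- A faithful copy of the flower group that is disjoint from the central element `J` can be
extended by involutions `A i` with `x i = A i * A (i + 1)`. -/
theorem exists_petals (f : Flower reset →* K) (J : K) (hJ : ∀ h, Commute (f h) J)
    {L : Type} [Group L] (π : K →* L) (hπ : Function.Injective fun h => π (f h))
    (hπJ : π J = 1) : ∃ A : ℕ → Equiv.Perm K, (∀ i, A i * A i = 1) ∧
      (∀ i, Commute (A i) (leftMul K J)) ∧
      (∀ i, A i * A (i + 1) = leftMul K (f (gen reset i))) ∧
      ∀ i, reset i = true → A (i + 1) = A 0 := by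
  have hc : ∀ h (j : Subgroup.zpowers J), Commute (f h) ((Subgroup.zpowers J).subtype j) := by
    rintro h ⟨_, n, rfl⟩
    exact (hJ h).zpow_right n
  have hπj : ∀ j : Subgroup.zpowers J, π j = 1 := by
    rintro ⟨_, n, rfl⟩
    change π (J ^ n) = 1
    rw [map_zpow, hπJ, one_zpow]
  -- Since `π` kills `J` and is faithful on the flower, the flower and `⟨J⟩` form a direct product
  -- inside `K`. The automorphism used is `flip` on the first factor and the identity on the second,
  -- so that the involution commutes with `J`.
  let F := f.noncommCoprod (Subgroup.zpowers J).subtype hc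
  have hF : Function.Injective F := by
    rw [injective_iff_map_eq_one]
    rintro ⟨h, j⟩ e
    replace e : f h * j = 1 := e
    have e1 : π (f h) = π (f 1) := by
      have := congrArg π e
      rwa [map_mul, hπj, mul_one, map_one, ← map_one π, ← map_one f] at this
    have e2 : h = 1 := hπ e1
    subst e2
    rw [map_one, one_mul] at e
    exact Prod.ext rfl (Subtype.ext e)
  obtain ⟨a, ha, hab⟩ := exists_involution_conj F hF
    ((flip reset).prodMap (MonoidHom.id _)) (by
      rintro ⟨h, j⟩
      exact Prod.ext (flip_flip h) rfl)
  have h1 : ∀ h, a * leftMul K (f h) * a = leftMul K (f (flip reset h)) := by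
    intro h
    have := hab (h, 1)
    simpa [F] using this
  have h2 : a * leftMul K J * a = leftMul K J := by
    have := hab (1, ⟨J, Subgroup.mem_zpowers J⟩)
    simpa [F] using this
  have h3 : Commute a (leftMul K J) := by
    calc a * leftMul K J = a * leftMul K J * (a * a) := by rw [ha, mul_one]
      _ = leftMul K J * a := by rw [← mul_assoc, h2]
  have h4 : ∀ h k, a * leftMul K (f h) * (a * leftMul K (f k)) =
      leftMul K (f (flip reset h * k)) := by
    intro h k
    rw [← mul_assoc, h1, ← map_mul, ← map_mul]
  -- Take `A i = a p_i`. As `a` inverts `p_i` by conjugation, `A i` is an involution and `A i * A (i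
  -- + 1) = p_i⁻¹ p_{i+1}`. After a reset the prefix product is `1`, as it is at `0`.
  refine ⟨fun i => a * leftMul K (f (prefixProd reset (gen reset) i)), fun i => ?_, fun i => ?_,
    fun i => ?_, fun i hi => ?_⟩
  · rw [h4, flip_prefixProd, inv_mul_cancel, map_one, map_one]
  · exact h3.mul_left ((hJ _).map (leftMul K))
  · rw [h4, flip_prefixProd, prefixProd_succ, inv_mul_cancel_left]
  · simp only
    rw [prefixProd_succ, prefixProd_mul_gen hi]
    rfl

end Flower

theorem Flower.commute_of_gen {reset : ℕ → Bool} {K : Type} [Group K] (f : Flower reset →* K)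
    {J : K} (h : ∀ i, Commute (f (gen reset i)) J) (x : Flower reset) : Commute (f x) J := by
  have e : (MulAut.conj J).toMonoidHom.comp f = f := hom_ext fun i => by
    change J * f (gen reset i) * J⁻¹ = f (gen reset i)
    rw [← (h i).eq, mul_inv_cancel_right]
  have h1 : J * f x * J⁻¹ = f x := DFunLike.congr_fun e x
  exact (mul_inv_eq_iff_eq_mul.mp h1).symm

/-- On generators, hence everywhere, `π ∘ f` is the regular representation, which is faithful. -/
theorem Flower.injective_comp {reset : ℕ → Bool} {K : Type} [Group K] (f : Flower reset →* K)
    (π : K →* Equiv.Perm (Flower reset)) (h : ∀ i, π (f (gen reset i)) = leftMul _ (gen reset i)) :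
    Function.Injective fun x => π (f x) := by
  have e : π.comp f = leftMul (Flower reset) := hom_ext h
  have h1 : ∀ x, π (f x) = leftMul _ x := fun x => DFunLike.congr_fun e x
  intro x y hxy
  simp only [h1] at hxy
  exact leftMul_injective hxy

/-- Every element of a group is a product of two involutions in the symmetric group, which can be
chosen to commute with a given central involution. -/
theorem exists_two_involutions {G : Type} [Group G] {J : G} (hJ : J ∈ Subgroup.center G)
    (hJ2 : J ^ 2 = 1) (s : G) : ∃ a : Bool → Equiv.Perm G, (∀ e, a e * a e = 1) ∧
      (∀ e, Commute (a e) (leftMul G J)) ∧ a true * a false = leftMul G s := by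
  have hJs : Commute J s := (Subgroup.mem_center_iff.mp hJ s).symm
  have hcomm : ∀ x ∈ ({s, J} : Set G), ∀ y ∈ ({s, J} : Set G), x * y = y * x := by
    rintro x (rfl | rfl) y (rfl | rfl)
    · rfl
    · exact hJs.eq.symm
    · exact hJs.eq
    · rfl
  have := Subgroup.isMulCommutative_closure hcomm
  -- The subgroup generated by `s` and `J` is commutative, so inversion is an automorphism of it; it
  -- fixes `J` because `J² = 1`.
  let θ : Subgroup.closure ({s, J} : Set G) →* Subgroup.closure ({s, J} : Set G) :=
    { toFun := fun x => x⁻¹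
      map_one' := inv_one
      map_mul' := fun x y => by rw [mul_inv_rev, mul_comm'] }
  obtain ⟨a, ha, hab⟩ := exists_involution_conj (Subgroup.closure ({s, J} : Set G)).subtype
    Subtype.val_injective θ (fun x => inv_inv x)
  have hs : a * leftMul G s * a = leftMul G s⁻¹ :=
    hab ⟨s, Subgroup.subset_closure (by simp)⟩
  have hj : a * leftMul G J * a = leftMul G J⁻¹ :=
    hab ⟨J, Subgroup.subset_closure (by simp)⟩
  have hJi : J⁻¹ = J := inv_eq_of_mul_eq_one_right (by rw [← sq, hJ2])
  rw [hJi] at hj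
  have hja : Commute a (leftMul G J) := by
    calc a * leftMul G J = a * leftMul G J * (a * a) := by rw [ha, mul_one]
      _ = leftMul G J * a := by rw [← mul_assoc, hj]
  -- As `a` inverts `s`, also `a s` is an involution, and `s = a (a s)`.
  refine ⟨fun e => if e then a else a * leftMul G s, ?_, ?_, ?_⟩
  · rintro (_ | _)
    · simp only [Bool.false_eq_true, if_false]
      rw [← mul_assoc, hs, ← map_mul, inv_mul_cancel, map_one]
    · simpa using ha
  · rintro (_ | _)
    · simp only [Bool.false_eq_true, if_false]
      exact hja.mul_left (hJs.symm.map (leftMul G))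
    · simpa using hja
  · simp only [Bool.false_eq_true, if_false, if_true]
    rw [← mul_assoc, ha, one_mul]

/-! ### Generic values for the variables other than the spokes. -/

namespace WheelSystem

/-- The variables that are assigned elements of the base group. -/
inductive CoreVar
  | gen (s : ℕ) (e : Bool)
  | hub
  | y (o : ℕ)
  | m (o : ℕ)
  | z (o : ℕ)
  | u (o : ℕ)
  | v (o : ℕ)

/-- A solution of the equations of the core variables and of the products of the equations of the
cycles. -/
structure CoreSol (ts : List Tok) (K : Type) [Group K] (J : K) where
  val : CoreVar → K
  sq : ∀ c, val c * val c = 1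
  comm : ∀ c, Commute (val c) J
  hub_y : ∀ o, startAt ts o = true → val (.y o) = val .hub
  hub_z : ∀ o, startAt ts o = true → val (.z o) = val .hub
  link : ∀ o, val (.z o) * val (.y (o + 1)) = val (.u o) * val (.v o)
  fst : ∀ o s e, tokAt ts o = .letter s e →
    val (.y (o + 1)) * val (.gen s e) = val (.m (o + 1))
  snd : ∀ o s e, tokAt ts o = .letter s e →
    val (.m (o + 1)) * val (.gen s !e) = val (.z (o + 1))

namespace CoreSol

variable {ts : List Tok}

/-- The product of two solutions. -/
def prod {K L : Type} [Group K] [Group L] {J : K} {J' : L} (S : CoreSol ts K J)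
    (S' : CoreSol ts L J') : CoreSol ts (K × L) (J, J') where
  val c := (S.val c, S'.val c)
  sq c := Prod.ext (S.sq c) (S'.sq c)
  comm c := Prod.ext (S.comm c) (S'.comm c)
  hub_y o h := Prod.ext (S.hub_y o h) (S'.hub_y o h)
  hub_z o h := Prod.ext (S.hub_z o h) (S'.hub_z o h)
  link o := Prod.ext (S.link o) (S'.link o)
  fst o s e h := Prod.ext (S.fst o s e h) (S'.fst o s e h)
  snd o s e h := Prod.ext (S.snd o s e h) (S'.snd o s e h)

/-- The product of a family of solutions. -/
def pi {ι : Type} {K : ι → Type} [∀ i, Group (K i)] {J : ∀ i, K i}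
    (S : ∀ i, CoreSol ts (K i) (J i)) : CoreSol ts (∀ i, K i) J where
  val c := fun i => (S i).val c
  sq c := funext fun i => (S i).sq c
  comm c := funext fun i => (S i).comm c
  hub_y o h := funext fun i => (S i).hub_y o h
  hub_z o h := funext fun i => (S i).hub_z o h
  link o := funext fun i => (S i).link o
  fst o s e h := funext fun i => (S i).fst o s e h
  snd o s e h := funext fun i => (S i).snd o s e h

/-- The value of `y` or `z` after a token. -/
def outer {K : Type} [Group K] (ts : List Tok) (α : ℕ → Bool → K) (second : Bool) : ℕ → K
  | 0 => 1
  | o + 1 => match tokAt ts o with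
    | .letter s e => α s (e ^^ second)
    | .endmark => 1

/-- The solution that only depends on the values of the generators. -/
def ofGens {K : Type} [Group K] {J : K} (ts : List Tok) (α : ℕ → Bool → K)
    (hα : ∀ s e, α s e * α s e = 1) (hJ : ∀ s e, Commute (α s e) J) : CoreSol ts K J where
  val
    | .gen s e => α s e
    | .hub => 1
    | .y o => outer ts α false o
    | .m _ => 1
    | .z o => outer ts α true o
    | .u o => outer ts α true o
    | .v o => outer ts α false (o + 1)
  sq := by
    have h : ∀ b o, outer ts α b o * outer ts α b o = 1 := by
      intro b o
      cases o with
      | zero => exact one_mul 1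
      | succ o => rw [outer]; split <;> simp [hα]
    rintro (_ | _ | _ | _ | _ | _ | _) <;> simp [h, hα]
  comm := by
    have h : ∀ b o, Commute (outer ts α b o) J := by
      intro b o
      cases o with
      | zero => exact .one_left J
      | succ o => rw [outer]; split <;> simp [hJ]
    rintro (_ | _ | _ | _ | _ | _ | _) <;> simp [h, hJ]
  hub_y := by
    rintro (_ | o) h
    · rfl
    · simp only [startAt, decide_eq_true_eq] at h
      simp [outer, h]
  hub_z := by
    rintro (_ | o) h
    · rfl
    · simp only [startAt, decide_eq_true_eq] at h
      simp [outer, h]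
  link o := rfl
  fst o s e h := by simp [outer, h, hα]
  snd o s e h := by simp [outer, h]

/-- The solution in which the variables `y`, `m`, `z` of a block have the same value and the
generators have the value `1`. -/
def ofStates {K : Type} [Group K] (ts : List Tok) (ε : K) (e u v : ℕ → K) (hε : ε * ε = 1)
    (he : ∀ o, e o * e o = 1) (hu : ∀ o, u o * u o = 1) (hv : ∀ o, v o * v o = 1)
    (hs : ∀ o, startAt ts o = true → e o = ε) (hl : ∀ o, e o * e (o + 1) = u o * v o) :
    CoreSol ts K 1 where
  val
    | .gen _ _ => 1
    | .hub => ε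
    | .y o => e o
    | .m o => e o
    | .z o => e o
    | .u o => u o
    | .v o => v o
  sq := by rintro (_ | _ | _ | _ | _ | _ | _) <;> simp [hε, he, hu, hv]
  comm _ := .one_right _
  hub_y := hs
  hub_z := hs
  link := hl
  fst _ _ _ _ := mul_one _
  snd _ _ _ _ := mul_one _

end CoreSol

/-- The resets of a single cycle of length four. -/
def fourReset (i : ℕ) : Bool := decide (3 ≤ i)

/-- From index `3` on every position is a reset, so later generators are cycles of length one and
trivial. The flower is thus a single cycle of length four. -/
theorem gen_fourReset {i : ℕ} (hi : 4 ≤ i) : Flower.gen fourReset i = 1 := by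
  obtain ⟨j, rfl⟩ : ∃ j, i = j + 1 := ⟨i - 1, by omega⟩
  have h := Flower.prefixProd_mul_gen (reset := fourReset) (i := j + 1)
    (by simp [fourReset]; omega)
  rwa [prefixProd, if_pos (by simp [fourReset]; omega), one_mul] at h

theorem fourReset_rel : Flower.gen fourReset 0 * Flower.gen fourReset 1 *
    Flower.gen fourReset 2 * Flower.gen fourReset 3 = 1 := by
  have h := Flower.prefixProd_mul_gen (reset := fourReset) (i := 3) rfl
  simpa [prefixProd, fourReset] using h

theorem leftMul_gen_mul_self {reset : ℕ → Bool} (i : ℕ) : leftMul _ (Flower.gen reset i) *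
    leftMul _ (Flower.gen reset i) = 1 := by
  rw [← map_mul, Flower.gen_mul_self, map_one]

/-- The state after a token: `none` at the boundary of a relator. -/
def stateAt (ts : List Tok) (o : ℕ) : Option ℕ := if startAt ts o then none else some o

/-- In `CoreSol.ofStates` the common value of `y, m, z` is free for each state, all relator
boundaries being one state because of the hub. The state after `o₀` gets generator `1` and all
others generator `0`; this requires the two ends of the wheel to have different states, which fails
only for an empty relator. -/
theorem exists_coreSol_four (ts : List Tok) (o₀ : ℕ)
    (h₀ : ¬ (startAt ts o₀ = true ∧ startAt ts (o₀ + 1) = true)) :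
    ∃ S : CoreSol ts (Equiv.Perm (Flower fourReset)) 1,
      S.val (.z o₀) = leftMul _ (Flower.gen fourReset 0) ∧
      S.val (.y (o₀ + 1)) = leftMul _ (Flower.gen fourReset 1) ∧
      S.val (.v o₀) = leftMul _ (Flower.gen fourReset 2) ∧
      S.val (.u o₀) = leftMul _ (Flower.gen fourReset 3) ∧
      ∀ s e, S.val (.gen s e) = 1 := by
  set x : ℕ → Equiv.Perm (Flower fourReset) := fun i => leftMul _ (Flower.gen fourReset i) with hx
  have hxx : ∀ i, x i * x i = 1 := leftMul_gen_mul_self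
  have hrel : x 0 * x 1 = x 3 * x 2 := by
    have h : x 0 * x 1 * x 2 * x 3 = 1 := by
      simp only [hx, ← map_mul, fourReset_rel, map_one]
    calc x 0 * x 1 = x 0 * x 1 * x 2 * x 3 * (x 3)⁻¹ * (x 2)⁻¹ := by group
      _ = x 3 * x 2 := by
        rw [h, one_mul, inv_eq_of_mul_eq_one_right (hxx 3), inv_eq_of_mul_eq_one_right (hxx 2)]
  have hne : stateAt ts o₀ ≠ stateAt ts (o₀ + 1) := by
    unfold stateAt
    split_ifs <;> simp_all
  let t : Option ℕ → Equiv.Perm (Flower fourReset) := fun p =>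
    if p = stateAt ts (o₀ + 1) then x 1 else x 0
  have ht : ∀ p, t p * t p = 1 := by
    intro p; simp only [t]; split_ifs <;> exact hxx _
  let S := CoreSol.ofStates ts (t none) (fun o => t (stateAt ts o))
    (fun o => if o = o₀ then x 3 else t (stateAt ts o))
    (fun o => if o = o₀ then x 2 else t (stateAt ts (o + 1))) (ht _) (fun o => ht _)
    (fun o => by split_ifs <;> [exact hxx 3; exact ht _])
    (fun o => by split_ifs <;> [exact hxx 2; exact ht _])
    (fun o h => by simp [stateAt, h])
    (fun o => by
      split_ifs with h
      · subst h
        simp only [t, if_true, if_neg hne]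
        exact hrel
      · rfl)
  exact ⟨S, by simp [S, CoreSol.ofStates, t, hne, hx], by simp [S, CoreSol.ofStates, t, hx],
    by simp [S, CoreSol.ofStates, hx], by simp [S, CoreSol.ofStates, hx], fun s e => rfl⟩

/-- The resets of the inner cycles. -/
def innerReset (ts : List Tok) (i : ℕ) : Bool := decide (i % 2 = 1 ∧ tokAt ts (i / 2) = .endmark)

theorem innerReset_even (ts : List Tok) (o : ℕ) : innerReset ts (2 * o) = false := by
  simp [innerReset]

theorem innerReset_odd (ts : List Tok) (o : ℕ) :
    innerReset ts (2 * o + 1) = startAt ts (o + 1) := by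
  simp [innerReset, startAt, show (2 * o + 1) % 2 = 1 by omega, show (2 * o + 1) / 2 = o by omega]

/-- The even petals of the inner flower itself serve as states: `A (2 * o) * A (2 * o + 2)` is the
product of the generators `2 * o` and `2 * o + 1`, which are the values of `u` and `v`. -/
theorem exists_coreSol_inner (ts : List Tok) :
    ∃ S : CoreSol ts (Equiv.Perm (Flower (innerReset ts))) 1,
      (∀ o, S.val (.u o) = leftMul _ (Flower.gen (innerReset ts) (2 * o))) ∧
      (∀ o, S.val (.v o) = leftMul _ (Flower.gen (innerReset ts) (2 * o + 1))) ∧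
      ∀ s e, S.val (.gen s e) = 1 := by
  obtain ⟨A, hA, -, hAx, hA0⟩ := Flower.exists_petals
    (MonoidHom.id (Flower (innerReset ts))) 1 (fun _ => .one_right _) (MonoidHom.id _)
    (fun _ _ h => h) rfl
  have hAx' : ∀ i, A i * A (i + 1) = leftMul _ (Flower.gen (innerReset ts) i) := hAx
  refine ⟨CoreSol.ofStates ts (A 0) (fun o => A (2 * o))
    (fun o => leftMul _ (Flower.gen (innerReset ts) (2 * o)))
    (fun o => leftMul _ (Flower.gen (innerReset ts) (2 * o + 1))) (hA 0) (fun o => hA _)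
    (fun o => leftMul_gen_mul_self _) (fun o => leftMul_gen_mul_self _) ?_ ?_,
    fun o => rfl, fun o => rfl, fun s e => rfl⟩
  · rintro (_ | o) h
    · rfl
    · exact hA0 (2 * o + 1) ((innerReset_odd ts o).trans h)
  · intro o
    rw [← hAx', ← hAx', mul_assoc, ← mul_assoc (A (2 * o + 1)), hA, one_mul]
    rfl

/-- The group in which the core variables take their values. -/
abbrev Base (ts : List Tok) (G : Type) : Type :=
  Equiv.Perm G × (ℕ → Equiv.Perm (Flower fourReset)) × Equiv.Perm (Flower (innerReset ts))

/-- The embedding of `G` into the base group. -/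
def toBase (ts : List Tok) (G : Type) [Group G] : G →* Base ts G :=
  (MonoidHom.inl _ _).comp (leftMul G)

theorem toBase_injective (ts : List Tok) (G : Type) [Group G] :
    Function.Injective (toBase ts G) := fun _ _ h =>
  leftMul_injective (congrArg Prod.fst h)

/-- The product of the letters since the last end of a relator. -/
def wordPrefix {G : Type} [Monoid G] (ts : List Tok) (l : ℕ → Bool → G) : ℕ → G
  | 0 => 1
  | o + 1 => match tokAt ts o with
    | .letter s e => wordPrefix ts l o * l s e
    | .endmark => 1

theorem map_wordPrefix {G H : Type} [Monoid G] [Monoid H] (f : G →* H) (ts : List Tok)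
    (l : ℕ → Bool → G) (o : ℕ) :
    f (wordPrefix ts l o) = wordPrefix ts (fun s e => f (l s e)) o := by
  induction o with
  | zero => exact map_one f
  | succ o ih => simp only [wordPrefix]; split <;> simp [ih]

/-- The sequence of the variables of the inner cycles. -/
def CoreSol.innerSeq {ts : List Tok} {K : Type} [Group K] {J : K} (S : CoreSol ts K J)
    (i : ℕ) : K :=
  if i % 2 = 0 then S.val (.u (i / 2)) else S.val (.v (i / 2))

theorem CoreSol.innerSeq_even {ts : List Tok} {K : Type} [Group K] {J : K} (S : CoreSol ts K J)
    (o : ℕ) : S.innerSeq (2 * o) = S.val (.u o) := by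
  simp [innerSeq]

theorem CoreSol.innerSeq_odd {ts : List Tok} {K : Type} [Group K] {J : K} (S : CoreSol ts K J)
    (o : ℕ) : S.innerSeq (2 * o + 1) = S.val (.v o) := by
  simp [innerSeq, show (2 * o + 1) % 2 = 1 by omega, show (2 * o + 1) / 2 = o by omega]

theorem CoreSol.innerSeq_sq {ts : List Tok} {K : Type} [Group K] {J : K} (S : CoreSol ts K J)
    (i : ℕ) : S.innerSeq i * S.innerSeq i = 1 := by
  unfold innerSeq; split_ifs <;> exact S.sq _

theorem CoreSol.innerSeq_comm {ts : List Tok} {K : Type} [Group K] {J : K} (S : CoreSol ts K J)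
    (i : ℕ) : Commute (S.innerSeq i) J := by
  unfold innerSeq; split_ifs <;> exact S.comm _

section

variable {ts : List Tok} {K : Type} [Group K] {J : K} (S : CoreSol ts K J)

theorem CoreSol.prefixProd_two_mul (o : ℕ) :
    prefixProd (innerReset ts) S.innerSeq (2 * o + 1) =
      prefixProd (innerReset ts) S.innerSeq (2 * o) * S.val (.u o) := by
  rw [prefixProd, innerReset_even, if_neg (by simp), S.innerSeq_even]

/-- Telescoping: the next letter equals `y z`, and its `y` combines with the old `z` into `u v`,
which extends the prefix product. -/
theorem CoreSol.invariant (o : ℕ) :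
    S.val .hub * wordPrefix ts (fun s e => S.val (.gen s e) * S.val (.gen s !e)) o =
      prefixProd (innerReset ts) S.innerSeq (2 * o) * S.val (.z o) := by
  induction o with
  | zero =>
    simp only [wordPrefix, prefixProd, mul_one, one_mul]
    exact (S.hub_z 0 rfl).symm
  | succ o ih =>
    rw [show 2 * (o + 1) = 2 * o + 1 + 1 by ring, prefixProd, innerReset_odd]
    cases ht : tokAt ts o with
    | letter s e =>
      rw [wordPrefix, ht]
      simp only [startAt, ht]
      rw [if_neg (by simp), S.prefixProd_two_mul, S.innerSeq_odd, mul_assoc _ (S.val (.u o)),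
        ← S.link, ← mul_assoc, ih]
      have h1 : S.val (.y (o + 1)) * S.val (.m (o + 1)) = S.val (.gen s e) := by
        rw [← S.fst o s e ht, ← mul_assoc, S.sq, one_mul]
      have h2 : S.val (.m (o + 1)) * S.val (.z (o + 1)) = S.val (.gen s !e) := by
        rw [← S.snd o s e ht, ← mul_assoc, S.sq, one_mul]
      have h3 : S.val (.gen s e) * S.val (.gen s !e) = S.val (.y (o + 1)) * S.val (.z (o + 1)) := by
        rw [← h1, ← h2, mul_assoc, ← mul_assoc (S.val (.m (o + 1))), S.sq, one_mul]
      rw [h3]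
      simp only [mul_assoc]
    | endmark =>
      have hs : startAt ts (o + 1) = true := by simp [startAt, ht]
      rw [wordPrefix, ht, if_pos hs, S.hub_z _ hs, mul_one, one_mul]

/-- Here the relators of `G` enter. At the end of a relator the invariant reads `hub = p z`;
appending `u v = z y` with `y = hub` gives `hub * hub = 1`. -/
theorem CoreSol.prefixProd_inner (hrel : ∀ o, tokAt ts o = .endmark →
      wordPrefix ts (fun s e => S.val (.gen s e) * S.val (.gen s !e)) o = 1)
    (i : ℕ) (hi : innerReset ts i = true) :
    prefixProd (innerReset ts) S.innerSeq i * S.innerSeq i = 1 := by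
  obtain ⟨h1, h2⟩ : i % 2 = 1 ∧ tokAt ts (i / 2) = .endmark := by simpa [innerReset] using hi
  obtain ⟨o, rfl⟩ : ∃ o, i = 2 * o + 1 := ⟨i / 2, by omega⟩
  rw [show (2 * o + 1) / 2 = o by omega] at h2
  have hs : startAt ts (o + 1) = true := by simp [startAt, h2]
  have h := S.invariant o
  rw [hrel o h2, mul_one] at h
  rw [S.prefixProd_two_mul, S.innerSeq_odd, mul_assoc, ← S.link, ← mul_assoc, ← h,
    S.hub_y _ hs, S.sq]

end

/-- A solution of the core equations with values in `Base ts G` that is generic on every cycle. -/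
structure GenericSol (ts : List Tok) (G : Type) [Group G] (J : G) (g : ℕ → G) extends
    CoreSol ts (Base ts G) (toBase ts G J) where
  gen_mul_gen : ∀ s, val (.gen s true) * val (.gen s false) = toBase ts G (g s)
  gen_true : ∀ s, g s = J → val (.gen s true) = toBase ts G J
  gen_false : ∀ s, g s = J → val (.gen s false) = 1
  four : ∀ o, ¬ (startAt ts o = true ∧ startAt ts (o + 1) = true) →
    (val (.z o)).2.1 o = leftMul _ (Flower.gen fourReset 0) ∧
    (val (.y (o + 1))).2.1 o = leftMul _ (Flower.gen fourReset 1) ∧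
    (val (.v o)).2.1 o = leftMul _ (Flower.gen fourReset 2) ∧
    (val (.u o)).2.1 o = leftMul _ (Flower.gen fourReset 3)
  inner_u : ∀ o, (val (.u o)).2.2 = leftMul _ (Flower.gen (innerReset ts) (2 * o))
  inner_v : ∀ o, (val (.v o)).2.2 = leftMul _ (Flower.gen (innerReset ts) (2 * o + 1))

/-- The product of three kinds of solutions: one carrying `G`, one generic on each four-wheel, one
generic on the inner wheels. The generators are trivial in the last two, so their pairs still
multiply to elements of `G`. -/
theorem exists_genericSol (ts : List Tok) {G : Type} [Group G] {J : G}
    (hJ : J ∈ Subgroup.center G) (hJ2 : J ^ 2 = 1) (g : ℕ → G) :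
    Nonempty (GenericSol ts G J g) := by
  classical
  have hα : ∀ s, ∃ a : Bool → Equiv.Perm G, (∀ e, a e * a e = 1) ∧
      (∀ e, Commute (a e) (leftMul G J)) ∧ a true * a false = leftMul G (g s) ∧
      (g s = J → a true = leftMul G J ∧ a false = 1) := by
    intro s
    -- For a generator with value `J` the forcing equations prescribe the pair `J, 1`.
    by_cases hs : g s = J
    · refine ⟨fun e => if e then leftMul G J else 1, ?_, ?_, ?_, fun _ => ⟨rfl, rfl⟩⟩
      · rintro (_ | _)
        · exact one_mul 1
        · simp only [if_true]
          rw [← map_mul, ← sq, hJ2, map_one]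
      · rintro (_ | _)
        · exact .one_left _
        · exact .refl _
      · simp [hs]
    · obtain ⟨a, h1, h2, h3⟩ := exists_two_involutions hJ hJ2 (g s)
      exact ⟨a, h1, h2, h3, fun h => absurd h hs⟩
  choose α hα1 hα2 hα3 hα4 using hα
  obtain ⟨S₃, hu, hv, hg⟩ := exists_coreSol_inner ts
  have h4 : ∀ o, ∃ S : CoreSol ts (Equiv.Perm (Flower fourReset)) 1,
      (¬ (startAt ts o = true ∧ startAt ts (o + 1) = true) →
        S.val (.z o) = leftMul _ (Flower.gen fourReset 0) ∧
        S.val (.y (o + 1)) = leftMul _ (Flower.gen fourReset 1) ∧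
        S.val (.v o) = leftMul _ (Flower.gen fourReset 2) ∧
        S.val (.u o) = leftMul _ (Flower.gen fourReset 3)) ∧
      ∀ s e, S.val (.gen s e) = 1 := by
    intro o
    by_cases h : startAt ts o = true ∧ startAt ts (o + 1) = true
    · have h1 : (1 : Equiv.Perm (Flower fourReset)) * 1 = 1 := one_mul 1
      exact ⟨CoreSol.ofStates ts 1 (fun _ => 1) (fun _ => 1) (fun _ => 1) h1 (fun _ => h1)
        (fun _ => h1) (fun _ => h1) (fun _ _ => rfl) (fun _ => rfl), fun h' => absurd h h',
        fun _ _ => rfl⟩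
    · obtain ⟨S, h1, h2, h3, h4, h5⟩ := exists_coreSol_four ts o h
      exact ⟨S, fun _ => ⟨h1, h2, h3, h4⟩, h5⟩
  choose S₂ hS₂ hg₂ using h4
  let S : CoreSol ts (Base ts G) (toBase ts G J) :=
    (CoreSol.ofGens ts α hα1 hα2).prod ((CoreSol.pi S₂).prod S₃)
  have hval : ∀ s e, S.val (.gen s e) = (α s e, 1, 1) := by
    intro s e
    refine Prod.ext rfl (Prod.ext (funext fun o => hg₂ o s e) (hg s e))
  refine ⟨{ S with
    gen_mul_gen := ?_
    gen_true := ?_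
    gen_false := ?_
    four := fun o h => hS₂ o h
    inner_u := hu
    inner_v := hv }⟩
  · intro s
    rw [hval, hval]
    refine Prod.ext (hα3 s) (Prod.ext ?_ ?_)
    · exact one_mul 1
    · exact one_mul 1
  · intro s hs
    rw [hval, (hα4 s hs).1]
    rfl
  · intro s hs
    rw [hval, (hα4 s hs).2]
    rfl

/-! ### Spokes for the generic values: a solution of the whole system. -/

/-- An equation holds for the involutions `f v`, with the central element `J`. -/
def Row.Holds {K : Type} [Group K] (J : K) (f : Var → K) (r : Row Var) : Prop :=
  f r.v₁ * f r.v₂ * f r.v₃ = J ^ r.c.val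

variable {ts : List Tok} {G : Type} [Group G] {J : G} {g : ℕ → G}

namespace GenericSol

variable (S : GenericSol ts G J g)

/-- The letters of the base group. -/
def letterVal (g : ℕ → G) (s : ℕ) (e : Bool) : G := if e then g s else (g s)⁻¹

theorem gen_mul_gen' (s : ℕ) (e : Bool) :
    S.val (.gen s e) * S.val (.gen s !e) = toBase ts G (letterVal g s e) := by
  cases e with
  | true => exact S.gen_mul_gen s
  | false =>
    rw [letterVal, if_neg (by simp), map_inv, ← S.gen_mul_gen s, mul_inv_rev,
      inv_eq_of_mul_eq_one_right (S.sq _), inv_eq_of_mul_eq_one_right (S.sq _)]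
    rfl

theorem exists_inner (hrel : ∀ o, tokAt ts o = .endmark → wordPrefix ts (letterVal g) o = 1) :
    ∃ A : ℕ → Equiv.Perm (Base ts G), (∀ i, A i * A i = 1) ∧
      (∀ i, Commute (A i) (leftMul _ (toBase ts G J))) ∧
      (∀ o, A (2 * o) * A (2 * o + 1) = leftMul _ (S.val (.u o))) ∧
      (∀ o, A (2 * o + 1) * A (2 * o + 2) = leftMul _ (S.val (.v o))) ∧
      ∀ o, startAt ts o = true → A (2 * o) = A 0 := by
  have hrel' : ∀ o, tokAt ts o = .endmark →
      wordPrefix ts (fun s e => S.val (.gen s e) * S.val (.gen s !e)) o = 1 := by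
    intro o ho
    simp only [S.gen_mul_gen']
    rw [← map_wordPrefix, hrel o ho, map_one]
  let f := Flower.lift S.innerSeq S.innerSeq_sq (S.prefixProd_inner hrel')
  have hf : ∀ i, f (Flower.gen _ i) = S.innerSeq i := Flower.lift_gen _ _ _
  let π : Base ts G →* Equiv.Perm (Flower (innerReset ts)) :=
    (MonoidHom.snd _ _).comp (MonoidHom.snd _ _)
  have hπ : ∀ i, π (f (Flower.gen _ i)) = leftMul _ (Flower.gen (innerReset ts) i) := by
    intro i
    rw [hf]
    rcases Nat.even_or_odd' i with ⟨o, rfl | rfl⟩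
    · rw [S.innerSeq_even]; exact S.inner_u o
    · rw [S.innerSeq_odd]; exact S.inner_v o
  obtain ⟨A, h1, h2, h3, h4⟩ := Flower.exists_petals f (toBase ts G J)
    (Flower.commute_of_gen f fun i => by rw [hf]; exact S.innerSeq_comm i) π
    (Flower.injective_comp f π hπ) rfl
  refine ⟨A, h1, h2, fun o => ?_, fun o => ?_, ?_⟩
  · rw [h3, hf, S.innerSeq_even]
  · rw [h3, hf, S.innerSeq_odd]
  · rintro (_ | o) ho
    · rfl
    · exact h4 (2 * o + 1) ((innerReset_odd ts o).trans ho)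

theorem exists_four (o : ℕ) : ∃ C : Fin 4 → Equiv.Perm (Base ts G), (∀ i, C i * C i = 1) ∧
    (∀ i, Commute (C i) (leftMul _ (toBase ts G J))) ∧
    C 0 * C 1 = leftMul _ (S.val (.z o)) ∧ C 1 * C 2 = leftMul _ (S.val (.y (o + 1))) ∧
    C 2 * C 3 = leftMul _ (S.val (.v o)) ∧ C 3 * C 0 = leftMul _ (S.val (.u o)) := by
  by_cases h : startAt ts o = true ∧ startAt ts (o + 1) = true
  -- An empty relator: both `z` and `y` are the hub, so `u = v`, and the spokes can be written down
  -- without genericity.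
  · have hz := S.hub_z o h.1
    have hy := S.hub_y (o + 1) h.2
    have huv : S.val (.u o) = S.val (.v o) := by
      have h1 := S.link o
      rw [hz, hy, S.sq] at h1
      rw [eq_inv_of_mul_eq_one_left h1.symm, inv_eq_of_mul_eq_one_right (S.sq _)]
    refine ⟨![1, leftMul _ (S.val .hub), 1, leftMul _ (S.val (.u o))], ?_, ?_, ?_, ?_, ?_, ?_⟩
    · intro i
      fin_cases i
      · exact one_mul 1
      · change leftMul _ _ * leftMul _ _ = 1
        rw [← map_mul, S.sq, map_one]
      · exact one_mul 1
      · change leftMul _ _ * leftMul _ _ = 1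
        rw [← map_mul, S.sq, map_one]
    · intro i
      fin_cases i
      · exact .one_left _
      · exact (S.comm _).map (leftMul _)
      · exact .one_left _
      · exact (S.comm _).map (leftMul _)
    · rw [hz]; exact one_mul _
    · rw [hy]; exact mul_one _
    · rw [← huv]; exact one_mul _
    · exact mul_one _
  · obtain ⟨g0, g1, g2, g3⟩ := S.four o h
    let x : ℕ → Base ts G
      | 0 => S.val (.z o)
      | 1 => S.val (.y (o + 1))
      | 2 => S.val (.v o)
      | 3 => S.val (.u o)
      | _ => 1
    -- The rim of the wheel satisfies the flower relations by `link`, and its component at `o` is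
    -- generic, so `exists_petals` applies.
    have hx : ∀ i, x i * x i = 1 := by
      rintro (_ | _ | _ | _ | i)
      · exact S.sq _
      · exact S.sq _
      · exact S.sq _
      · exact S.sq _
      · exact one_mul 1
    have hxr : ∀ i, fourReset i = true → prefixProd fourReset x i * x i = 1 := by
      intro i hi
      have hi : 3 ≤ i := by simpa [fourReset] using hi
      rcases i with _ | _ | _ | _ | i
      · omega
      · omega
      · omega
      · have : prefixProd fourReset x 3 * x 3 = S.val (.z o) * S.val (.y (o + 1)) *
          S.val (.v o) * S.val (.u o) := by
          simp [prefixProd, fourReset, x]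
        rw [this, S.link, mul_assoc (S.val (.u o)), S.sq, mul_one, S.sq]
      · rw [prefixProd, if_pos (by simp [fourReset])]
        exact one_mul 1
    let f := Flower.lift x hx hxr
    have hf : ∀ i, f (Flower.gen _ i) = x i := Flower.lift_gen _ _ _
    let π : Base ts G →* Equiv.Perm (Flower fourReset) :=
      (Pi.evalMonoidHom _ o).comp ((MonoidHom.fst _ _).comp (MonoidHom.snd _ _))
    have hπ : ∀ i, π (f (Flower.gen _ i)) = leftMul _ (Flower.gen fourReset i) := by
      intro i
      rw [hf]
      rcases i with _ | _ | _ | _ | i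
      · exact g0
      · exact g1
      · exact g2
      · exact g3
      · rw [gen_fourReset (by omega), map_one]
        exact map_one π
    have hxJ : ∀ i, Commute (x i) (toBase ts G J) := by
      rintro (_ | _ | _ | _ | i)
      · exact S.comm _
      · exact S.comm _
      · exact S.comm _
      · exact S.comm _
      · exact .one_left _
    obtain ⟨A, h1, h2, h3, h4⟩ := Flower.exists_petals f (toBase ts G J)
      (Flower.commute_of_gen f fun i => by rw [hf]; exact hxJ i) π
      (Flower.injective_comp f π hπ) rfl
    refine ⟨fun i => A i, fun i => h1 i, fun i => h2 i, ?_, ?_, ?_, ?_⟩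
    · exact (h3 0).trans (congrArg _ (hf 0))
    · exact (h3 1).trans (congrArg _ (hf 1))
    · exact (h3 2).trans (congrArg _ (hf 2))
    · have h := h3 3
      rw [show A (3 + 1) = A 0 from h4 3 rfl, hf] at h
      exact h

/-- The values of all variables, given the values of the auxiliary variables of the cycles. -/
def valuation (A : ℕ → Equiv.Perm (Base ts G)) (C : ℕ → Fin 4 → Equiv.Perm (Base ts G)) :
    Var → Equiv.Perm (Base ts G)
  | .gen s e => leftMul _ (S.val (.gen s e))
  | .glob 3 => leftMul _ (S.val .hub)
  | .glob 4 => A 0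
  | .glob _ => 1
  | .blk o 0 => leftMul _ (S.val (.y o))
  | .blk o 1 => leftMul _ (S.val (.m o))
  | .blk o 2 => leftMul _ (S.val (.z o))
  | .blk o 3 => leftMul _ (S.val (.u (o - 1)))
  | .blk o 4 => leftMul _ (S.val (.v (o - 1)))
  | .blk o 5 => C (o - 1) 0
  | .blk o 6 => C (o - 1) 1
  | .blk o 7 => C (o - 1) 2
  | .blk o 8 => C (o - 1) 3
  | .blk o 9 => A (2 * o - 1)
  | .blk o _ => A (2 * o)

end GenericSol

/-- The overgroup of `G` against which injectivity is tested. -/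
theorem exists_valuation (ts : List Tok) {G : Type} [Group G] {J : G}
    (hJ : J ∈ Subgroup.center G) (hJ2 : J ^ 2 = 1) (g : ℕ → G) (j : ℕ) (hj : g j = J)
    (hrel : ∀ o, tokAt ts o = .endmark → wordPrefix ts (GenericSol.letterVal g) o = 1) :
    ∃ (K : Type) (_ : Group K) (i : G →* K) (f : Var → K), Function.Injective i ∧
      (∀ v, f v * f v = 1) ∧ (∀ v, Commute (f v) (i J)) ∧
      (∀ s, f (.gen s true) * f (.gen s false) = i (g s)) ∧
      ∀ r ∈ rows j ts, r.Holds (i J) f := by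
  obtain ⟨S⟩ := exists_genericSol ts hJ hJ2 g
  obtain ⟨A, hA1, hA2, hA3, hA4, hA5⟩ := S.exists_inner hrel
  choose C hC1 hC2 hC3 hC4 hC5 hC6 using S.exists_four
  have hl : ∀ c, leftMul _ (S.val c) * leftMul _ (S.val c) = 1 := by
    intro c; rw [← map_mul, S.sq, map_one]
  have hlJ : ∀ c, Commute (leftMul _ (S.val c)) (leftMul _ (toBase ts G J)) :=
    fun c => (S.comm c).map (leftMul _)
  refine ⟨Equiv.Perm (Base ts G), inferInstance, (leftMul _).comp (toBase ts G),
    S.valuation A C, leftMul_injective.comp (toBase_injective ts G), ?_, ?_, ?_, ?_⟩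
  · rintro (⟨s, e⟩ | i | ⟨o, i⟩)
    · exact hl _
    · fin_cases i <;> first | exact one_mul 1 | exact hl _ | exact hA1 _
    · fin_cases i <;> first | exact hl _ | exact hA1 _ | exact hC1 _ _
  · rintro (⟨s, e⟩ | i | ⟨o, i⟩)
    · exact hlJ _
    · fin_cases i <;> first | exact .one_left _ | exact hlJ _ | exact hA2 _
    · fin_cases i <;> first | exact hlJ _ | exact hA2 _ | exact hC2 _ _
  · intro s
    change leftMul _ _ * leftMul _ _ = leftMul _ _
    rw [← map_mul, S.gen_mul_gen]
  · intro r hr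
    rcases List.mem_append.mp hr with hr | hr
    · obtain ⟨t, ht, rfl⟩ := List.mem_map.mp hr
      have h1 : S.valuation A C (.gen j true) = (leftMul _).comp (toBase ts G) J := by
        change leftMul _ _ = leftMul _ _
        rw [S.gen_true j hj]
      have h2 : S.valuation A C (.gen j false) = 1 := by
        change leftMul _ _ = 1
        rw [S.gen_false j hj, map_one]
      have h3 : S.valuation A C (.glob 0) = 1 := rfl
      have h4 : S.valuation A C (.glob 1) = 1 := rfl
      have h5 : S.valuation A C (.glob 2) = 1 := rfl
      simp [forcingRows] at ht
      rcases ht with rfl | rfl | rfl | rfl | rfl | rfl <;>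
        simp only [Row.Holds, Row.map, RelVar.inst, h1, h2, h3, h4, h5, mul_one, ZMod.val_zero,
          pow_zero, ZMod.val_one, pow_one]
    · obtain ⟨o, -, hr⟩ := List.mem_flatMap.mp hr
      obtain ⟨t, ht, rfl⟩ := List.mem_map.mp hr
      have hz : ∀ s, S.valuation A C ((hubOr (startAt ts o) 3 (.prev 2)).inst s o) =
          leftMul _ (S.val (.z o)) := by
        intro s
        cases h : startAt ts o with
        | false => rfl
        | true => rw [S.hub_z o h]; rfl
      have hb : ∀ s, S.valuation A C ((hubOr (startAt ts o) 4 (.prev 10)).inst s o) =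
          A (2 * o) := by
        intro s
        cases h : startAt ts o with
        | false => rfl
        | true => rw [hA5 o h]; rfl
      have hy : ∀ s, S.valuation A C ((hubOr (startAt ts (o + 1)) 3 (.cur 0)).inst s o) =
          leftMul _ (S.val (.y (o + 1))) := by
        intro s
        cases h : startAt ts (o + 1) with
        | false => rfl
        | true => rw [S.hub_y _ h]; rfl
      have hb' : ∀ s, S.valuation A C ((hubOr (startAt ts (o + 1)) 4 (.cur 10)).inst s o) =
          A (2 * o + 2) := by
        intro s
        cases h : startAt ts (o + 1) with
        | false => rfl
        | true => rw [show 2 * o + 2 = 2 * (o + 1) by ring, hA5 _ h]; rfl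
      have hlink : ∀ s, ∀ t ∈ linkRows (startAt ts o) (startAt ts (o + 1)),
          (t.map (RelVar.inst s o)).Holds ((leftMul _).comp (toBase ts G) J)
            (S.valuation A C) := by
        intro s t ht
        simp only [linkRows, List.mem_cons, List.not_mem_nil, or_false] at ht
        rcases ht with rfl | rfl | rfl | rfl | rfl | rfl <;>
          simp only [Row.Holds, Row.map, hz, hb, hy, hb', ZMod.val_zero, pow_zero]
        · change _ * C o 0 * C o 1 = 1
          rw [mul_assoc, hC3, hl]
        · change _ * C o 1 * C o 2 = 1
          rw [mul_assoc, hC4, hl]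
        · change leftMul _ (S.val (.v o)) * C o 2 * C o 3 = 1
          rw [mul_assoc, hC5, hl]
        · change leftMul _ (S.val (.u o)) * C o 3 * C o 0 = 1
          rw [mul_assoc, hC6, hl]
        · change leftMul _ (S.val (.u o)) * A (2 * o) * A (2 * o + 1) = 1
          rw [mul_assoc, hA3, hl]
        · change leftMul _ (S.val (.v o)) * A (2 * o + 1) * A (2 * o + 2) = 1
          rw [mul_assoc, hA4, hl]
      cases htok : tokAt ts o with
      | endmark =>
        have hs : startAt ts (o + 1) = true := by simp [startAt, htok]
        rw [htok] at ht
        rw [hs] at hlink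
        exact hlink _ t ht
      | letter s e =>
        have hs : startAt ts (o + 1) = false := by simp [startAt, htok]
        rw [htok] at ht
        rw [hs] at hlink
        rcases List.mem_append.mp ht with ht | ht
        · exact hlink _ t ht
        · simp only [letterRows, List.mem_cons, List.not_mem_nil, or_false] at ht
          rcases ht with rfl | rfl
          · change leftMul _ (S.val (.y (o + 1))) * leftMul _ (S.val (.gen s e)) *
              leftMul _ (S.val (.m (o + 1))) = 1
            rw [← map_mul, S.fst o s e htok, hl]
          · change leftMul _ (S.val (.m (o + 1))) * leftMul _ (S.val (.gen s !e)) *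
              leftMul _ (S.val (.z (o + 1))) = 1
            rw [← map_mul, S.snd o s e htok, hl]

end WheelSystem

/-! ### Area calculus: congruence of words up to a counted number of relators. -/

section Area

variable {α : Type} {R : Set (FreeGroup α)}

theorem isConjProduct_iff {w : FreeGroup α} {t : ℕ} : IsConjProduct R w t ↔
    ∃ l : List (FreeGroup α), l.length = t ∧
      (∀ g ∈ l, ∃ z, ∃ r ∈ R, ∃ a : ℤ, (a = 1 ∨ a = -1) ∧ g = z * r ^ a * z⁻¹) ∧ w = l.prod := by
  constructor
  · rintro ⟨z, r, a, hr, ha, rfl⟩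
    refine ⟨_, List.length_ofFn, ?_, rfl⟩
    intro g hg
    obtain ⟨i, rfl⟩ := (List.mem_ofFn' _ _).mp hg
    exact ⟨z i, r i, hr i, a i, ha i, rfl⟩
  · rintro ⟨l, rfl, hl, rfl⟩
    choose z r hr a ha hg using fun i : Fin l.length => hl l[i] (List.getElem_mem _)
    refine ⟨z, r, a, hr, ha, ?_⟩
    congr 1
    conv_lhs => rw [← List.ofFn_getElem (xs := l)]
    congr 1
    funext i
    exact hg i

theorem IsConjProduct.one : IsConjProduct R 1 0 :=
  isConjProduct_iff.mpr ⟨[], rfl, by simp, rfl⟩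

theorem IsConjProduct.of_mem {r : FreeGroup α} (hr : r ∈ R) : IsConjProduct R r 1 :=
  isConjProduct_iff.mpr ⟨[r], rfl, by
    intro g hg
    rw [List.mem_singleton.mp hg]
    exact ⟨1, r, hr, 1, .inl rfl, by simp⟩, by simp⟩

theorem IsConjProduct.mul {w w' : FreeGroup α} {t t' : ℕ} (h : IsConjProduct R w t)
    (h' : IsConjProduct R w' t') : IsConjProduct R (w * w') (t + t') := by
  obtain ⟨l, rfl, hl, rfl⟩ := isConjProduct_iff.mp h
  obtain ⟨l', rfl, hl', rfl⟩ := isConjProduct_iff.mp h'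
  refine isConjProduct_iff.mpr ⟨l ++ l', List.length_append, ?_, List.prod_append.symm⟩
  intro g hg
  exact (List.mem_append.mp hg).elim (hl g) (hl' g)

theorem IsConjProduct.conj {w : FreeGroup α} {t : ℕ} (h : IsConjProduct R w t)
    (z : FreeGroup α) : IsConjProduct R (z * w * z⁻¹) t := by
  obtain ⟨l, rfl, hl, rfl⟩ := isConjProduct_iff.mp h
  refine isConjProduct_iff.mpr ⟨l.map (MulAut.conj z), List.length_map _, ?_, ?_⟩
  · intro g hg
    obtain ⟨g', hg', rfl⟩ := List.mem_map.mp hg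
    obtain ⟨y, r, hr, a, ha, rfl⟩ := hl g' hg'
    exact ⟨z * y, r, hr, a, ha, by rw [MulAut.conj_apply]; group⟩
  · rw [← map_list_prod, MulAut.conj_apply]

theorem IsConjProduct.inv {w : FreeGroup α} {t : ℕ} (h : IsConjProduct R w t) :
    IsConjProduct R w⁻¹ t := by
  obtain ⟨l, rfl, hl, rfl⟩ := isConjProduct_iff.mp h
  refine isConjProduct_iff.mpr ⟨(l.map fun g => g⁻¹).reverse, by simp, ?_, List.prod_inv_reverse l⟩
  intro g hg
  obtain ⟨g', hg', rfl⟩ := List.mem_map.mp (List.mem_reverse.mp hg)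
  obtain ⟨y, r, hr, a, ha, rfl⟩ := hl g' hg'
  exact ⟨y, r, hr, -a, by rcases ha with rfl | rfl <;> simp, by group⟩

theorem exists_isConjProduct {w : FreeGroup α} (hw : PresentedGroup.mk R w = 1) :
    ∃ t, IsConjProduct R w t := by
  have h : w ∈ Subgroup.normalClosure R := (QuotientGroup.eq_one_iff w).mp hw
  clear hw
  rw [Subgroup.normalClosure] at h
  induction h using Subgroup.closure_induction with
  | mem r hr =>
    obtain ⟨a, ha, h⟩ := Group.mem_conjugatesOfSet_iff.mp hr
    obtain ⟨z, rfl⟩ := isConj_iff.mp h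
    exact ⟨1, (IsConjProduct.of_mem ha).conj z⟩
  | one => exact ⟨0, .one⟩
  | mul x y _ _ hx hy =>
    obtain ⟨s, hs⟩ := hx
    obtain ⟨t, ht⟩ := hy
    exact ⟨_, hs.mul ht⟩
  | inv x _ hx =>
    obtain ⟨s, hs⟩ := hx
    exact ⟨_, hs.inv⟩

/-- The words `u` and `v` differ by at most `t` applications of relators. -/
def Close (R : Set (FreeGroup α)) (t : ℕ) (u v : FreeGroup α) : Prop :=
  ∃ s ≤ t, IsConjProduct R (u * v⁻¹) s

namespace Close

variable {s t : ℕ} {u v w x y : FreeGroup α}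

theorem refl (u : FreeGroup α) : Close R t u u := ⟨0, t.zero_le, by rw [mul_inv_cancel]; exact .one⟩

theorem of_mem (h : u * v⁻¹ ∈ R) : Close R 1 u v := ⟨1, le_rfl, .of_mem h⟩

theorem mono (h : Close R s u v) (hst : s ≤ t) : Close R t u v :=
  let ⟨a, ha, p⟩ := h; ⟨a, ha.trans hst, p⟩

theorem symm (h : Close R t u v) : Close R t v u :=
  let ⟨a, ha, p⟩ := h; ⟨a, ha, by simpa using p.inv⟩

theorem trans (h : Close R s u v) (h' : Close R t v w) : Close R (s + t) u w :=
  let ⟨a, ha, p⟩ := h; let ⟨b, hb, q⟩ := h'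
  ⟨a + b, add_le_add ha hb, by simpa [mul_assoc] using p.mul q⟩

/-- Since `u x (v y)⁻¹ = u (x y⁻¹) u⁻¹ * (u v⁻¹)` and conjugation costs nothing, the costs add. -/
theorem mul (h : Close R s u v) (h' : Close R t x y) : Close R (s + t) (u * x) (v * y) :=
  let ⟨a, ha, p⟩ := h; let ⟨b, hb, q⟩ := h'
  ⟨b + a, by omega, by simpa [mul_assoc] using (q.conj u).mul p⟩

theorem mul_left (h : Close R t u v) (w : FreeGroup α) : Close R t (w * u) (w * v) :=
  ((refl (t := 0) w).mul h).mono (by omega)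

theorem mul_right (h : Close R t u v) (w : FreeGroup α) : Close R t (u * w) (v * w) :=
  (h.mul (refl (t := 0) w)).mono (by omega)

theorem inv (h : Close R t u v) : Close R t u⁻¹ v⁻¹ :=
  let ⟨a, ha, p⟩ := h.symm; ⟨a, ha, by simpa [mul_assoc] using p.conj u⁻¹⟩

theorem of_mul_left (h : Close R t (w * u) (w * v)) : Close R t u v := by
  simpa using h.mul_left w⁻¹

theorem rotate (h : Close R t (u * v) 1) : Close R t (v * u) 1 := by
  simpa [mul_assoc] using (h.mul_left u⁻¹).mul_right u

end Close

end Area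

/-! ### Deriving the relators from the equations, with costs. -/

namespace WheelSystem

/-- Words `X v` and `E` in a free group that satisfy the equations `rs` up to a bounded number of
applications of the relators `R`. -/
structure CloseSol {α : Type} (R : Set (FreeGroup α)) (X : Var → FreeGroup α) (E : FreeGroup α)
    (rs : List (Row Var)) : Prop where
  sq (v : Var) : Close R 1 (X v * X v) 1
  -- The bound `4` is one equation relator and at most three commutators that put its factors into
  -- the order of `r`.
  row (r : Row Var) (hr : r ∈ rs) : Close R 4 (X r.v₁ * X r.v₂ * X r.v₃) (E ^ r.c.val)

namespace CloseSol

variable {α : Type} {R : Set (FreeGroup α)} {X : Var → FreeGroup α} {E : FreeGroup α}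
  {rs : List (Row Var)}

theorem inv (S : CloseSol R X E rs) (v : Var) : Close R 1 (X v)⁻¹ (X v) := by
  simpa using ((S.sq v).mul_left (X v)⁻¹).symm

theorem cancel (S : CloseSol R X E rs) (v : Var) (g g' : FreeGroup α) :
    Close R 1 (g * X v * (X v * g')) (g * g') := by
  simpa [mul_assoc] using ((S.sq v).mul_left g).mul_right g'

theorem first (S : CloseSol R X E rs) {a b c : Var} (hr : ⟨a, b, c, 0⟩ ∈ rs) :
    Close R 5 (X a) (X b * X c) := by
  have h : Close R 4 (X a * X b * X c) 1 := by simpa using S.row _ hr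
  have h2 := (h.mul_left (X a)⁻¹).symm
  exact (((S.inv a).symm.trans (by simpa [mul_assoc] using h2)).mono (by norm_num) : Close R 5 _ _)

theorem second (S : CloseSol R X E rs) {a b c : Var} (hr : ⟨a, b, c, 0⟩ ∈ rs) :
    Close R 5 (X b) (X c * X a) := by
  have h : Close R 4 (X a * (X b * X c)) 1 := by simpa [mul_assoc] using S.row _ hr
  have h2 := (h.rotate.mul_left (X b)⁻¹).symm
  exact (((S.inv b).symm.trans (by simpa [mul_assoc] using h2)).mono (by norm_num) : Close R 5 _ _)

theorem third (S : CloseSol R X E rs) {a b c : Var} (hr : ⟨a, b, c, 0⟩ ∈ rs) :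
    Close R 5 (X c) (X a * X b) := by
  have h : Close R 4 (X a * X b * X c) 1 := by simpa using S.row _ hr
  have h2 := (h.rotate.mul_left (X c)⁻¹).symm
  exact (((S.inv c).symm.trans (by simpa [mul_assoc] using h2)).mono (by norm_num) : Close R 5 _ _)

/-- The first two equations give `q ≈ r` at cost `8`; then `q r` cancels in the third, at cost `1 +
4`. -/
theorem forced (S : CloseSol R X E rs) {a p q r : Var} {c : ZMod 2}
    (h₁ : ⟨a, p, q, c⟩ ∈ rs) (h₂ : ⟨a, p, r, c⟩ ∈ rs) (h₃ : ⟨a, q, r, c⟩ ∈ rs) : Close R 13 (X a) (E ^ c.val) := by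
  have hqr : Close R 8 (X q) (X r) := ((S.row _ h₁).trans (S.row _ h₂).symm).of_mul_left
  have h := ((S.cancel r (X a) 1).symm.trans ((hqr.symm.mul_left (X a)).mul_right (X r * 1))).trans
    ((by simpa [mul_assoc] using S.row _ h₃ : Close R 4 _ (E ^ c.val)))
  simpa using h

variable {ts : List Tok} {j : ℕ}

theorem row_mem {o : ℕ} (ho : o < ts.length) {r : Row RelVar}
    (hr : r ∈ tokRows (startAt ts o) (tokAt ts o)) :
    r.map (RelVar.inst (tokAt ts o).index o) ∈ rows j ts :=
  List.mem_append_right _ (List.mem_flatMap.mpr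
    ⟨o, List.mem_range.mpr ho, List.mem_map_of_mem hr⟩)

/-- Three comparisons, each using two equations with a common variable that cancels, at cost `5 + 5
+ 1`: `z y` with a product of two opposite spokes of the four-wheel, this with `u v`, and this with
the end spokes of the inner wheel. -/
theorem link (S : CloseSol R X E (rows j ts)) {s o : ℕ} {b b' : Bool}
    (h : ∀ r ∈ linkRows b b', r.map (RelVar.inst s o) ∈ rows j ts) :
    Close R 33 (X ((hubOr b 3 (.prev 2)).inst s o) * X ((hubOr b' 3 (.cur 0)).inst s o))
      (X ((hubOr b 4 (.prev 10)).inst s o) * X ((hubOr b' 4 (.cur 10)).inst s o)) := by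
  simp only [linkRows, List.mem_cons, List.not_mem_nil, or_false, forall_eq_or_imp, forall_eq,
    Row.map] at h
  obtain ⟨h1, h2, h3, h4, h5, h6⟩ := h
  have e1 := ((S.first h1).mul (S.first h2)).trans (S.cancel _ _ _)
  have e2 := ((S.third h4).mul (S.second h3)).trans (S.cancel _ _ _)
  have e3 := ((S.first h5).mul (S.first h6)).trans (S.cancel _ _ _)
  exact (e1.trans e2).trans e3

theorem letter (S : CloseSol R X E (rows j ts)) {s o : ℕ} {e : Bool}
    (h : ∀ r ∈ letterRows e, r.map (RelVar.inst s o) ∈ rows j ts) :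
    Close R 11 (X (.gen s e) * X (.gen s !e)) (X (.blk (o + 1) 0) * X (.blk (o + 1) 2)) := by
  simp only [letterRows, List.mem_cons, List.not_mem_nil, or_false, forall_eq_or_imp, forall_eq,
    Row.map] at h
  obtain ⟨h1, h2⟩ := h
  exact (((S.first h1).mul (S.third h2)).trans (S.cancel _ _ _)).symm

/-- The inductive step of `CoreSol.invariant` for words: one use of `link` and one cancellation of
`X v * X v`. -/
theorem advance (S : CloseSol R X E rs) {v : Var} {t q : ℕ} {k g h p y b z a : FreeGroup α}
    (hg : Close R t (k * g) (h * X v * p)) (hl : Close R 33 (p * y) (X v * b))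
    (hy : Close R q a (y * z)) : Close R (t + q + 34) (k * (g * a)) (h * b * z) := by
  have e1 := hg.mul hy
  have e2 := (hl.mul_left (h * X v)).mul_right z
  have e3 := S.cancel v h (b * z)
  have e4 : Close R 33 (h * X v * p * (y * z)) (h * X v * (X v * (b * z))) := by
    simpa only [mul_assoc] using e2
  simpa only [mul_assoc] using ((e1.trans e4).trans e3).mono (t := t + q + 34) (by omega)

/-- The invariant says that hub times prefix is close to base spoke times current spoke times `z`. A
letter costs `11 + 34`. The end of the relator costs `34`, and two more for cancelling the base
spoke and the hub. -/
theorem relator (S : CloseSol R X E (rows j ts)) (post : List Tok) (ls : List (ℕ × Bool)) (o : ℕ)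
    (hts : ts.drop o = ls.map (fun l => Tok.letter l.1 l.2) ++ .endmark :: post) (g : FreeGroup α)
    {t : ℕ} (hg : Close R t (X (.glob 3) * g) (X (.glob 4) *
      X ((hubOr (startAt ts o) 4 (.prev 10)).inst 0 o) *
      X ((hubOr (startAt ts o) 3 (.prev 2)).inst 0 o))) :
    Close R (t + 45 * ls.length + 36)
      (g * (ls.map fun l => X (.gen l.1 l.2) * X (.gen l.1 !l.2)).prod) 1 := by
  have ho : o < ts.length := by
    by_contra! h
    simp [List.drop_eq_nil_of_le h] at hts
  rw [List.drop_eq_getElem_cons ho, ← tokAt_eq ho] at hts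
  have hi : ∀ b (i : Fin 5) k s, (hubOr b i (.prev k)).inst s o =
      (hubOr b i (.prev k)).inst 0 o := by
    intro b i k s; cases b <;> rfl
  induction ls generalizing o g t with
  | nil =>
    obtain ⟨ht, -⟩ := List.cons.inj hts
    have hl := S.link (s := 0) (o := o) (b := startAt ts o) (b' := true) fun r hr => by
      have := row_mem (j := j) ho (r := r) (by rw [ht]; exact hr)
      rwa [ht] at this
    have h1 : Close R (t + 35) (X (.glob 3) * (g * X (.glob 3))) 1 :=
      ((S.advance (z := 1) (q := 0) hg hl (by rw [mul_one]; exact .refl _)).trans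
        (by rw [mul_one]; exact S.sq (.glob 4))).mono (by omega)
    have e3 := (S.cancel (.glob 3) g 1).symm.trans (by simpa [mul_assoc] using h1.rotate)
    simpa using e3.mono (by omega)
  | cons l ls ih =>
    obtain ⟨ht, hts⟩ := List.cons.inj hts
    have hm : ∀ r ∈ linkRows (startAt ts o) false ++ letterRows l.2,
        r.map (RelVar.inst l.1 o) ∈ rows j ts := fun r hr => by
      have := row_mem (j := j) ho (r := r) (by rw [ht]; exact hr)
      rwa [ht] at this
    have hl := S.link fun r hr => hm r (List.mem_append_left _ hr)
    have hy := S.letter fun r hr => hm r (List.mem_append_right _ hr)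
    rw [hi _ 3 _ l.1, hi _ 4 _ l.1] at hl
    simp only [List.map_cons, List.prod_cons, List.length_cons]
    have hs : startAt ts (o + 1) = false := by simp [startAt, ht]
    have ho1 : o + 1 < ts.length := by
      by_contra! h
      simp [List.drop_eq_nil_of_le h] at hts
    rw [List.drop_eq_getElem_cons ho1, ← tokAt_eq ho1] at hts
    refine ((ih (o + 1) (g * (X (.gen l.1 l.2) * X (.gen l.1 !l.2))) (t := t + 45)
      ?_ ho1 hts ?_).mono (by omega) |> fun h => by simpa [mul_assoc] using h)
    · rw [hs]
      change Close R _ _ (_ * X (.blk (o + 1) 10) * X (.blk (o + 1) 2))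
      exact (S.advance hg hl hy).mono (by omega)
    · intro b i k s; cases b <;> rfl

end CloseSol

end WheelSystem

namespace Close

variable {α β : Type} {R : Set (FreeGroup α)}

theorem list_prod {t : ℕ} {f g : β → FreeGroup α} (l : List β)
    (h : ∀ b ∈ l, Close R t (f b) (g b)) : Close R (t * l.length) (l.map f).prod (l.map g).prod := by
  induction l with
  | nil => exact .refl _
  | cons b l ih =>
    simp only [List.map_cons, List.prod_cons, List.length_cons]
    exact ((h b (by simp)).mul (ih fun b hb => h b (by simp [hb]))).mono (by ring_nf; omega)

/-- Three factors are sorted by at most three adjacent transpositions. This is needed because an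
equation relator multiplies its variables in the order of `V`. -/
theorem prod_perm_three {X : β → FreeGroup α} {l : List β} {a b c : β} (hl : l.Perm [a, b, c])
    (hab : Close R 1 (X b * X a) (X a * X b)) (hac : Close R 1 (X c * X a) (X a * X c))
    (hbc : Close R 1 (X c * X b) (X b * X c)) :
    Close R 3 (l.map X).prod (X a * X b * X c) := by
  have h := List.mem_permutations'.mpr hl
  have e1 := hab.mul_right (X c)
  have e2 := hbc.mul_left (X a)
  have e3 := hac.mul_left (X b)
  have e4 := hac.mul_right (X b)
  have e5 := hbc.mul_right (X a)
  simp only [mul_assoc] at e1 e2 e3 e4 e5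
  simp only [List.permutations', List.permutations'Aux, List.flatMap_cons, List.flatMap_nil,
    List.map_cons, List.map_nil, List.append_nil, List.cons_append, List.nil_append,
    List.mem_cons, List.not_mem_nil, or_false] at h
  rcases h with rfl | rfl | rfl | rfl | rfl | rfl <;>
    simp only [List.map_cons, List.map_nil, List.prod_cons, List.prod_nil, mul_one, mul_assoc]
  · exact .refl _
  · exact e1.mono (by norm_num)
  · exact (e3.trans e1).mono (by norm_num)
  · exact e2.mono (by norm_num)
  · exact (e4.trans e2).mono (by norm_num)
  · exact (e5.trans (e3.trans e1)).mono (by norm_num)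

end Close

/-! ### The words of the solution group and the area bound for relators. -/

namespace WheelSystem

theorem prod_ofFn_bit {M : Type*} [Monoid M] (F : Var → M) (V : List Var) (r : Row Var) :
    (List.ofFn fun j : Fin V.length => F V[j] ^ (r.bit V[j]).val).prod =
      ((V.filter fun v => v = r.v₁ ∨ v = r.v₂ ∨ v = r.v₃).map F).prod := by
  have h : (List.ofFn fun j : Fin V.length => F V[j] ^ (r.bit V[j]).val) =
      V.map fun v => F v ^ (r.bit v).val := by
    apply List.ext_getElem <;> simp
  rw [h]
  clear h
  induction V with
  | nil => rfl
  | cons v V ih =>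
    rw [List.map_cons, List.prod_cons, ih, List.filter_cons]
    unfold Row.bit
    split_ifs <;> simp_all [ZMod.val_one]

/-- The word of a variable: its generator if it occurs in `V`. -/
def varWord (V : List Var) (v : Var) : FreeGroup (Option (Fin V.length)) :=
  if h : v ∈ V then LinSys.x ⟨V.idxOf v, List.idxOf_lt_length_of_mem h⟩ else 1

theorem varWord_get {V : List Var} (hV : V.Nodup) (j : Fin V.length) :
    varWord V V[j] = LinSys.x j := by
  unfold varWord
  rw [dif_pos (show V[j] ∈ V from List.getElem_mem _)]
  congr 1
  exact Fin.ext (hV.idxOf_getElem _ _)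

variable {V : List Var} {rs : List (Row Var)}

theorem closeSol (hV : V.Nodup)
    (hR : ∀ r ∈ rs, r.Distinct ∧ r.v₁ ∈ V ∧ r.v₂ ∈ V ∧ r.v₃ ∈ V) :
    CloseSol (LinSys.solRels (matrix V rs) (vector rs)) (varWord V) LinSys.J rs := by
  have hcomm : ∀ r ∈ rs, ∀ u v : Var, (u = r.v₁ ∨ u = r.v₂ ∨ u = r.v₃) →
      (v = r.v₁ ∨ v = r.v₂ ∨ v = r.v₃) → Close (LinSys.solRels (matrix V rs) (vector rs)) 1
        (varWord V u * varWord V v) (varWord V v * varWord V u) := by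
    intro r hr u v hu hv
    have mem : ∀ w, (w = r.v₁ ∨ w = r.v₂ ∨ w = r.v₃) → w ∈ V := by
      rintro w (rfl | rfl | rfl)
      exacts [(hR r hr).2.1, (hR r hr).2.2.1, (hR r hr).2.2.2]
    obtain ⟨i, rfl⟩ := List.mem_iff_get.mp hr
    obtain ⟨j, rfl⟩ := List.mem_iff_get.mp (mem u hu)
    obtain ⟨k, rfl⟩ := List.mem_iff_get.mp (mem v hv)
    refine .of_mem ?_
    have h := LinSys.SolRel.comm_x (M := matrix V rs) (c := vector rs) i j k
      (matrix_ne_zero_iff.mpr hu) (matrix_ne_zero_iff.mpr hv)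
    change varWord V V[j] * varWord V V[k] * (varWord V V[k] * varWord V V[j])⁻¹ ∈ _
    rw [varWord_get hV, varWord_get hV, mul_inv_rev, ← mul_assoc]
    exact h
  refine ⟨fun v => ?_, fun r hr => ?_⟩
  · unfold varWord
    split_ifs with h
    · exact .of_mem (by rw [inv_one, mul_one, ← sq]; exact LinSys.SolRel.sq_x _)
    · rw [mul_one]; exact .refl _
  · have hr' := hcomm r hr
    obtain ⟨⟨h12, h13, h23⟩, h1, h2, h3⟩ := hR r hr
    have hp := Close.prod_perm_three (X := varWord V) (filter_eq_three hV h1 h2 h3 h12 h13 h23)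
      (hr' _ _ (by simp) (by simp)) (hr' _ _ (by simp) (by simp)) (hr' _ _ (by simp) (by simp))
    rw [← prod_ofFn_bit] at hp
    obtain ⟨i, rfl⟩ := List.mem_iff_get.mp hr
    refine (hp.symm.trans (v := _) (t := 1) (.of_mem ?_)).mono (by norm_num)
    have h := LinSys.SolRel.eqn (M := matrix V rs) (c := vector rs) i
    simp only [varWord_get hV]
    exact h

/-- The words in the generators of the solution group that represent the generators of the
given group. -/
def genWord (V : List Var) {k : ℕ} (J s : Fin k) : FreeGroup (Option (Fin V.length)) :=
  if s = J then LinSys.J else varWord V (.gen s true) * varWord V (.gen s false)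

/-- Only `J` needs an argument: it is sent to the generator `J`, while the blocks use its pair of
involutions, and the forcing equations reconcile the two. -/
theorem CloseSol.genWord {R : Set (FreeGroup (Option (Fin V.length)))} {ts : List Tok} {k : ℕ}
    {J : Fin k} (S : CloseSol R (varWord V) LinSys.J (rows J ts)) (s : Fin k) :
    Close R 27 (genWord V J s) (varWord V (.gen s true) * varWord V (.gen s false)) := by
  unfold WheelSystem.genWord
  split_ifs with h
  · subst h
    have hm : ∀ r ∈ forcingRows, r.map (RelVar.inst s 0) ∈ rows s ts := fun r hr =>
      List.mem_append_left _ (List.mem_map_of_mem hr)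
    simp only [forcingRows, List.mem_cons, List.not_mem_nil, or_false, forall_eq_or_imp, forall_eq,
      Row.map] at hm
    obtain ⟨h1, h2, h3, h4, h5, h6⟩ := hm
    have e := (S.forced h1 h2 h3).mul (S.forced h4 h5 h6)
    simpa [ZMod.val_one, RelVar.inst] using (e.symm.mono (by norm_num) : Close R 27 _ _)
  · exact .refl _

theorem CloseSol.genWord_letter {R : Set (FreeGroup (Option (Fin V.length)))} {ts : List Tok}
    {k : ℕ} {J : Fin k} (S : CloseSol R (varWord V) LinSys.J (rows J ts)) (l : Fin k × Bool) :
    Close R 29 (cond l.2 (WheelSystem.genWord V J l.1) (WheelSystem.genWord V J l.1)⁻¹)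
      (varWord V (.gen l.1 l.2) * varWord V (.gen l.1 !l.2)) := by
  obtain ⟨s, _ | _⟩ := l
  · have h := (S.genWord s).inv
    rw [mul_inv_rev] at h
    exact h.trans ((S.inv _).mul (S.inv _))
  · exact (S.genWord s).mono (by norm_num)

theorem startAt_append (l l' : List Tok) :
    startAt (l ++ .endmark :: l') (l ++ [Tok.endmark]).length = true := by
  simp [startAt, tokAt]

/-- Each letter costs `29` to rewrite as a pair of involutions and `45` in `relator`, with `37`
extra per relator. The total is at most `74 * (|r| + 1)`, and `|r| + 1` is at most the size since
there is a generator. -/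
theorem CloseSol.lift_rel {P : FinPres} {R : Set (FreeGroup (Option (Fin V.length)))}
    (S : CloseSol R (varWord V) LinSys.J (rows P.J P.tokens)) {r : FreeGroup (Fin P.numGens)}
    (hr : r ∈ P.rels) : Close R (74 * P.size) (FreeGroup.lift (WheelSystem.genWord V P.J) r) 1 := by
  have hlen : r.toWord.length + 1 ≤ P.size := by
    have h1 : r.norm ≤ (P.rels.map FreeGroup.norm).sum :=
      List.single_le_sum (by simp) _ (List.mem_map_of_mem hr)
    have h2 : 1 ≤ P.numGens := P.J.pos
    unfold FinPres.size FreeGroup.norm at *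
    omega
  have e1 := Close.list_prod r.toWord fun l _ => S.genWord_letter l
  rw [← FreeGroup.lift_mk, FreeGroup.mk_toWord] at e1
  obtain ⟨pre, post, hpp⟩ := List.append_of_mem hr
  let tok : FreeGroup (Fin P.numGens) → List Tok :=
    fun r => r.toWord.map (fun l => Tok.letter l.1 l.2) ++ [Tok.endmark]
  have hts : P.tokens = pre.flatMap tok ++ (tok r ++ post.flatMap tok) := by
    unfold FinPres.tokens
    rw [hpp, List.flatMap_append, List.flatMap_cons]
  have hstart : startAt P.tokens (pre.flatMap tok).length = true := by
    rcases List.eq_nil_or_concat pre with rfl | ⟨pre', q, rfl⟩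
    · rfl
    · have h : (pre' ++ [q]).flatMap tok =
          (pre'.flatMap tok ++ q.toWord.map fun l => Tok.letter l.1 l.2) ++ [Tok.endmark] := by
        simp [tok]
      rw [hts, List.concat_eq_append, h, List.append_assoc, List.singleton_append]
      exact startAt_append _ _
  have e2 := S.relator (post.flatMap tok) (r.toWord.map fun l => (l.1.val, l.2))
    (pre.flatMap tok).length (by rw [hts, List.drop_left]; simp [tok]) 1 (t := 1) (by
      rw [hstart, mul_one]
      change Close _ _ _ (varWord V (.glob 4) * varWord V (.glob 4) * varWord V (.glob 3))
      simpa [mul_assoc] using ((S.sq (.glob 4)).mul_right (varWord V (.glob 3))).symm)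
  rw [one_mul, List.map_map, List.length_map] at e2
  exact (e1.trans e2).mono (by omega)

theorem close_of_isConjProduct {α β : Type} {R : Set (FreeGroup α)} {R' : Set (FreeGroup β)}
    (φ : FreeGroup α →* FreeGroup β) {k : ℕ} (h : ∀ r ∈ R, Close R' k (φ r) 1)
    {w : FreeGroup α} {t : ℕ} (hw : IsConjProduct R w t) : Close R' (k * t) (φ w) 1 := by
  obtain ⟨l, rfl, hl, rfl⟩ := isConjProduct_iff.mp hw
  have e := Close.list_prod (R := R') (t := k) (f := φ) (g := fun _ => 1) l fun g hg => by
    obtain ⟨z, r, hr, a, ha, rfl⟩ := hl g hg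
    have e1 : Close R' k (φ r ^ a) 1 := by
      rcases ha with rfl | rfl
      · simpa using h r hr
      · simpa using (h r hr).inv
    simpa using (e1.mul_left (φ z)).mul_right (φ z)⁻¹
  rw [← map_list_prod] at e
  simpa using e

theorem mk_eq_one_of_close {α : Type} {R : Set (FreeGroup α)} {w : FreeGroup α} {t : ℕ}
    (h : Close R t w 1) : PresentedGroup.mk R w = 1 := by
  obtain ⟨s, -, h⟩ := h
  obtain ⟨l, -, hl, h⟩ := isConjProduct_iff.mp h
  rw [inv_one, mul_one] at h
  rw [h, map_list_prod]
  refine List.prod_eq_one fun g hg => ?_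
  obtain ⟨g', hg', rfl⟩ := List.mem_map.mp hg
  obtain ⟨z, r, hr, a, -, rfl⟩ := hl g' hg'
  have : PresentedGroup.mk R r = 1 := (PresentedGroup.mk_eq_one_iff).mpr
    (Subgroup.subset_normalClosure hr)
  simp [this]

theorem wordArea_spec {α : Type} {R : Set (FreeGroup α)} (hR : R.Nonempty) {w : FreeGroup α}
    (hw : PresentedGroup.mk R w = 1) : 1 ≤ wordArea R w ∧ IsConjProduct R w (wordArea R w) := by
  obtain ⟨r, hr⟩ := hR
  refine Nat.sInf_mem (s := {t : ℕ | 1 ≤ t ∧ IsConjProduct R w t}) ?_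
  obtain ⟨t, ht⟩ := exists_isConjProduct hw
  exact ⟨t + (1 + 1), by omega, by
    simpa using ht.mul ((IsConjProduct.of_mem hr).mul (IsConjProduct.of_mem hr).inv)⟩

/-- The area is at least `1` by definition, so an empty product is replaced by `r * r⁻¹`; hence the
condition `2 ≤ t`. -/
theorem wordArea_le_of_close {α : Type} {R : Set (FreeGroup α)} (hR : R.Nonempty)
    {w : FreeGroup α} {t : ℕ} (ht : 2 ≤ t) (h : Close R t w 1) : wordArea R w ≤ t := by
  obtain ⟨r, hr⟩ := hR
  obtain ⟨s, hs, h⟩ := h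
  rw [inv_one, mul_one] at h
  rcases Nat.eq_zero_or_pos s with rfl | hs'
  · refine (Nat.sInf_le (show 2 ∈ {t : ℕ | 1 ≤ t ∧ IsConjProduct R w t} from
      ⟨by norm_num, ?_⟩)).trans ht
    simpa using h.mul ((IsConjProduct.of_mem hr).mul (IsConjProduct.of_mem hr).inv)
  · exact (Nat.sInf_le (show s ∈ {t : ℕ | 1 ≤ t ∧ IsConjProduct R w t} from ⟨hs', h⟩)).trans hs

theorem norm_lift_le {α β : Type} [DecidableEq α] [DecidableEq β] (f : α → FreeGroup β) {k : ℕ}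
    (hf : ∀ a, (f a).norm ≤ k) (w : FreeGroup α) : (FreeGroup.lift f w).norm ≤ k * w.norm := by
  have h : ∀ l : List (α × Bool),
      (l.map fun x => cond x.2 (f x.1) (f x.1)⁻¹).prod.norm ≤ k * l.length := by
    intro l
    induction l with
    | nil => simp
    | cons x l ih =>
      rw [List.map_cons, List.prod_cons, List.length_cons]
      refine (FreeGroup.norm_mul_le _ _).trans ?_
      have : (cond x.2 (f x.1) (f x.1)⁻¹).norm ≤ k := by
        rcases x with ⟨a, _ | _⟩
        · simpa [FreeGroup.norm_inv_eq] using hf a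
        · exact hf a
      rw [mul_add, mul_one]
      omega
  have := h w.toWord
  rwa [← FreeGroup.lift_mk, FreeGroup.mk_toWord] at this

theorem norm_genWord_le (V : List Var) {k : ℕ} (J s : Fin k) : (genWord V J s).norm ≤ 2 := by
  have h : ∀ v, (varWord V v).norm ≤ 1 := by
    intro v
    unfold varWord
    split_ifs
    · simp [LinSys.x]
    · simp
  unfold genWord
  split_ifs
  · simp [LinSys.J]
  · refine (FreeGroup.norm_mul_le _ _).trans ?_
    have := h (.gen s true)
    have := h (.gen s false)
    omega

/-! ### Injectivity. -/

/-- Without relators the homomorphism to `ℤ` sending every generator to `1` would show that `J² ≠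
1`. -/
theorem rels_ne_nil {P : FinPres} (hP : P.IsOverZ2) : P.rels ≠ [] := by
  intro h
  have h2 := hP.2
  let f : P.Grp →* Multiplicative ℤ := PresentedGroup.toGroup (f := fun _ => Multiplicative.ofAdd 1)
    (by intro r hr; simp [FinPres.relSet, h] at hr)
  have h3 := congrArg f h2
  rw [map_pow, map_one, PresentedGroup.toGroup.of, ← ofAdd_nsmul] at h3
  exact absurd h3 (by decide)

/-- The images of the generators of a presentation, indexed by natural numbers. -/
def genVal (P : FinPres) (s : ℕ) : P.Grp :=
  if h : s < P.numGens then PresentedGroup.of ⟨s, h⟩ else 1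

theorem prod_letters (P : FinPres) {r : FreeGroup (Fin P.numGens)} (hr : r ∈ P.rels) :
    (r.toWord.map fun l => GenericSol.letterVal (genVal P) l.1 l.2).prod = 1 := by
  have h : PresentedGroup.mk P.relSet r = 1 := PresentedGroup.mk_eq_one_iff.mpr
    (Subgroup.subset_normalClosure hr)
  rw [← h]
  conv_rhs => rw [← FreeGroup.mk_toWord (x := r)]
  generalize r.toWord = l
  induction l with
  | nil => rfl
  | cons x l ih =>
    have hx : PresentedGroup.mk P.relSet (FreeGroup.mk [x]) =
        GenericSol.letterVal (genVal P) x.1 x.2 := by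
      obtain ⟨s, e⟩ := x
      cases e
      · simp only [GenericSol.letterVal, genVal, s.2, dif_pos, Bool.false_eq_true, if_false]
        rw [PresentedGroup.of, ← map_inv]
        rfl
      · simp only [GenericSol.letterVal, genVal, s.2, dif_pos, if_true]
        rfl
    rw [List.map_cons, List.prod_cons, ih, ← hx, ← map_mul, FreeGroup.mul_mk]
    rfl

theorem wordPrefix_add {G : Type} [Monoid G] (l : ℕ → Bool → G) {ts : List Tok}
    {u : List (ℕ × Bool)} {o : ℕ} {post : List Tok}
    (h : ts.drop o = u.map (fun x => Tok.letter x.1 x.2) ++ post) :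
    wordPrefix ts l (o + u.length) = wordPrefix ts l o * (u.map fun x => l x.1 x.2).prod := by
  induction u generalizing o with
  | nil => simp
  | cons x u ih =>
    have ho : o < ts.length := by
      by_contra! h'
      simp [List.drop_eq_nil_of_le h'] at h
    rw [List.drop_eq_getElem_cons ho, ← tokAt_eq ho] at h
    obtain ⟨h1, h2⟩ := List.cons.inj h
    have := ih h2
    rw [List.length_cons, ← Nat.add_assoc, Nat.add_right_comm, this, wordPrefix, h1]
    simp [mul_assoc]

theorem wordPrefix_of_startAt {G : Type} [Monoid G] (l : ℕ → Bool → G) {ts : List Tok} {o : ℕ}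
    (h : startAt ts o = true) : wordPrefix ts l o = 1 := by
  cases o with
  | zero => rfl
  | succ o =>
    have h' : tokAt ts o = .endmark := by simpa [startAt] using h
    rw [wordPrefix, h']

theorem wordPrefix_eq_one_of_words {G : Type} [Monoid G] (l : ℕ → Bool → G) {ts : List Tok}
    (us : List (List (ℕ × Bool))) (hus : ∀ u ∈ us, (u.map fun x => l x.1 x.2).prod = 1) {a : ℕ}
    (h : ts.drop a = us.flatMap fun u => u.map (fun x => Tok.letter x.1 x.2) ++ [Tok.endmark])
    (ha : startAt ts a = true) {o : ℕ} (hao : a ≤ o) (ho : tokAt ts o = .endmark) :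
    wordPrefix ts l o = 1 := by
  induction us generalizing a with
  | nil =>
    -- Past the end `tokAt` has the default value `endmark`, so every position from `a` on starts a
    -- relator.
    refine wordPrefix_of_startAt l ?_
    rcases hao.eq_or_lt with rfl | hao
    · exact ha
    · obtain ⟨o, rfl⟩ := Nat.exists_eq_add_one_of_ne_zero (Nat.ne_of_gt (Nat.zero_lt_of_lt hao))
      have : ts.length ≤ a := List.drop_eq_nil_iff.mp h
      have : ts.length ≤ o := by omega
      simp [startAt, tokAt, List.getElem?_eq_none this]
  | cons u us ih =>
    rw [List.flatMap_cons, List.append_assoc] at h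
    have hget : ∀ i, tokAt ts (a + i) = ((u.map (fun x => Tok.letter x.1 x.2)) ++ ([Tok.endmark] ++
        us.flatMap fun u => u.map (fun x => Tok.letter x.1 x.2) ++ [Tok.endmark])).getD i .endmark := by
      intro i
      rw [← h]
      simp [tokAt]
    rcases lt_trichotomy o (a + u.length) with h1 | h1 | h1
    · have := hget (o - a)
      rw [Nat.add_sub_cancel' hao, ho, List.getD_append _ _ _ _ (by simp; omega)] at this
      rw [List.getD_eq_getElem _ _ (by simp; omega)] at this
      simp at this
    · subst h1
      rw [wordPrefix_add l h, wordPrefix_of_startAt l ha, hus u (by simp), one_mul]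
    · refine ih (fun u hu => hus u (by simp [hu])) (a := a + u.length + 1) ?_ ?_ h1
      · rw [Nat.add_assoc, ← List.drop_drop, h, ← List.append_assoc]
        exact List.drop_left' (by simp)
      · have := hget u.length
        simp [startAt, this]

theorem wordPrefix_eq_one (P : FinPres) (o : ℕ) (ho : tokAt P.tokens o = .endmark) :
    wordPrefix P.tokens (GenericSol.letterVal (genVal P)) o = 1 := by
  refine wordPrefix_eq_one_of_words _ (P.rels.map fun r => r.toWord.map fun l => (l.1.val, l.2))
    ?_ (a := 0) ?_ rfl o.zero_le ho
  · intro u hu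
    obtain ⟨r, hr, rfl⟩ := List.mem_map.mp hu
    rw [List.map_map]
    exact prod_letters P hr
  · simp [FinPres.tokens, List.flatMap_map, Function.comp_def]

/-- The product `a b = E c` is an involution, so `a` and `b` commute. Hence the commutation relators
of the solution group hold for every solution of the equations. -/
theorem commute_of_mul_eq {K : Type} [Group K] {a b c E : K} (ha : a * a = 1) (hb : b * b = 1)
    (hc : c * c = 1) (hE : E * E = 1) (hcE : Commute c E) (h : a * b * c = E) : Commute a b := by
  have h1 : a * b = E * c := by rw [← h, mul_assoc _ c, hc, mul_one]
  have h2 : a * b * (a * b) = 1 := by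
    rw [h1, mul_assoc, ← mul_assoc c, hcE.eq, mul_assoc E, hc, mul_one, hE]
  have h3 : (a * b)⁻¹ = b * a := by
    rw [mul_inv_rev, inv_eq_of_mul_eq_one_left ha, inv_eq_of_mul_eq_one_left hb]
  exact (eq_inv_of_mul_eq_one_left h2).trans h3

theorem Row.Holds.commute {K : Type} [Group K] {J : K} {f : Var → K} {r : Row Var}
    (h : r.Holds J f) (hJ : J ^ 2 = 1) (hf : ∀ v, f v * f v = 1) (hfJ : ∀ v, Commute (f v) J) :
    Commute (f r.v₁) (f r.v₂) ∧ Commute (f r.v₁) (f r.v₃) ∧ Commute (f r.v₂) (f r.v₃) := by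
  have hE : J ^ r.c.val * J ^ r.c.val = 1 := by
    rw [← sq, ← pow_mul, mul_comm, pow_mul, hJ, one_pow]
  have hc := fun v => (hfJ v).pow_right r.c.val
  -- The right side commutes with all values, so the three factors may be rotated and each pair
  -- brought to the front.
  have rot : ∀ {v : Var} {g : K}, f v * g = J ^ r.c.val → g * f v = J ^ r.c.val := by
    intro v g hg
    rw [← inv_mul_cancel_left (f v) g, hg, mul_assoc, ← (hc v).eq, inv_mul_cancel_left]
  have h1 : f r.v₁ * f r.v₂ * f r.v₃ = J ^ r.c.val := h
  have h2 := rot (by rwa [mul_assoc] at h1)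
  have h3 := rot (by rwa [mul_assoc] at h2)
  exact ⟨commute_of_mul_eq (hf _) (hf _) (hf _) hE (hc _) h1,
    (commute_of_mul_eq (hf _) (hf _) (hf _) hE (hc _) h3).symm,
    commute_of_mul_eq (hf _) (hf _) (hf _) hE (hc _) h2⟩

/-- The homomorphism from the solution group given by values that satisfy the equations. -/
theorem exists_hom {V : List Var} {rs : List (Row Var)} (hV : V.Nodup)
    (hR : ∀ r ∈ rs, r.Distinct ∧ r.v₁ ∈ V ∧ r.v₂ ∈ V ∧ r.v₃ ∈ V) {K : Type} [Group K] {J : K}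
    {f : Var → K} (hJ : J ^ 2 = 1) (hf : ∀ v, f v * f v = 1) (hfJ : ∀ v, Commute (f v) J)
    (hr : ∀ r ∈ rs, r.Holds J f) :
    ∃ F : LinSys.SolGroup (matrix V rs) (vector rs) →* K,
      F (PresentedGroup.mk _ LinSys.J) = J ∧
        ∀ v ∈ V, F (PresentedGroup.mk _ (varWord V v)) = f v := by
  have hrel : ∀ r ∈ LinSys.solRels (matrix V rs) (vector rs),
      FreeGroup.lift (fun o : Option (Fin V.length) => o.elim J fun j => f V[j]) r = 1 := by
    intro r h
    cases h with
    | comm_J j =>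
      simp [LinSys.x, LinSys.J, (hfJ _).eq]
    | sq_x j => simp [LinSys.x, sq, hf]
    | sq_J => simp [LinSys.J, hJ]
    | eqn i =>
      have h0 := hR _ (List.getElem_mem i.2)
      have hi := hr _ (List.getElem_mem i.2)
      have hc := hi.commute hJ hf hfJ
      have hp := (filter_eq_three hV h0.2.1 h0.2.2.1 h0.2.2.2 h0.1.1 h0.1.2.1 h0.1.2.2).map f
      have e := hp.symm.prod_eq' (by
        simp only [List.map_cons, List.map_nil, List.pairwise_cons, List.mem_cons,
          List.not_mem_nil, or_false, forall_eq_or_imp, forall_eq]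
        exact ⟨⟨hc.1, hc.2.1⟩, hc.2.2, by simp⟩)
      have e2 : f rs[i].v₁ * f rs[i].v₂ * f rs[i].v₃ = J ^ rs[i].c.val := hi
      have e3 := prod_ofFn_bit f V rs[i]
      rw [map_mul, map_list_prod, map_inv, map_pow, List.map_ofFn]
      have e4 : (FreeGroup.lift fun o : Option (Fin V.length) => o.elim J fun j => f V[j]) ∘
          (fun j => LinSys.x j ^ (matrix V rs i j).val) =
          fun j : Fin V.length => f V[j] ^ (rs[i].bit V[j]).val := by
        funext j
        simp only [Function.comp_apply, map_pow, LinSys.x, FreeGroup.lift_apply_of, Option.elim]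
        rfl
      rw [e4, e3, LinSys.J, FreeGroup.lift_apply_of, mul_inv_eq_one]
      refine e.symm.trans (Eq.trans ?_ e2)
      simp [mul_assoc]
    | comm_x i j k hj hk =>
      obtain ⟨h1, h2, h3⟩ := (hr _ (List.getElem_mem i.2)).commute hJ hf hfJ
      have h : Commute (f (V.get j)) (f (V.get k)) := by
        rcases matrix_ne_zero_iff.mp hj with e | e | e <;>
          rcases matrix_ne_zero_iff.mp hk with e' | e' | e' <;> rw [e, e']
        exacts [h1, h2, h1.symm, h3, h2.symm, h3.symm]
      have h' : f V[j] * f V[k] = f V[k] * f V[j] := h.eq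
      simp only [LinSys.x, map_mul, map_inv, FreeGroup.lift_apply_of, Option.elim]
      rw [h', mul_inv_cancel_right, mul_inv_cancel]
  refine ⟨PresentedGroup.toGroup hrel, ?_, ?_⟩
  · exact PresentedGroup.toGroup.of hrel
  · intro v hv
    obtain ⟨j, rfl⟩ := List.mem_iff_get.mp hv
    change PresentedGroup.toGroup hrel (PresentedGroup.mk _ (varWord V V[j])) = _
    rw [varWord_get hV]
    exact PresentedGroup.toGroup.of hrel

theorem exists_embedding (P : FinPres) (hP : P.IsOverZ2) :
    ∃ ψ : P.Grp →* LinSys.SolGroup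
        (matrix (vars P.numGens P.tokens.length) (rows P.J P.tokens))
        (vector (rows P.J P.tokens)), Function.Injective ψ ∧
      ∀ w, ψ (PresentedGroup.mk P.relSet w) = PresentedGroup.mk _
        (FreeGroup.lift (genWord (vars P.numGens P.tokens.length) P.J) w) := by
  set V := vars P.numGens P.tokens.length with hVdef
  have hV : V.Nodup := nodup_vars _ _
  have hR := rows_wf P.J.2 (index_lt_of_mem_tokens P)
  have S := closeSol hV hR
  have hrel : ∀ r ∈ P.relSet, ((PresentedGroup.mk (LinSys.solRels (matrix V (rows P.J P.tokens))
      (vector (rows P.J P.tokens)))).comp (FreeGroup.lift (genWord V P.J))) r = 1 :=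
    fun r hr => mk_eq_one_of_close (S.lift_rel hr)
  let ψ := QuotientGroup.lift (Subgroup.normalClosure P.relSet) _
    (Subgroup.normalClosure_le_normal (N := MonoidHom.ker _) hrel)
  have hψ : ∀ w, ψ (PresentedGroup.mk P.relSet w) =
      PresentedGroup.mk _ (FreeGroup.lift (genWord V P.J) w) := fun w => rfl
  refine ⟨ψ, ?_, hψ⟩
  have hJ : genVal P P.J = PresentedGroup.of P.J := by simp [genVal]
  obtain ⟨K, _, i, f, hi, hf, hfJ, hfg, hrows⟩ := exists_valuation P.tokens hP.1 hP.2 (genVal P)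
    P.J hJ (wordPrefix_eq_one P)
  obtain ⟨F, hFJ, hF⟩ := exists_hom hV hR (by rw [← map_pow, hP.2, map_one]) hf hfJ hrows
  -- The solution in `K` factors the embedding `i` of `G` through `ψ`, so `ψ` is injective.
  have key : F.comp ψ = i := by
    refine PresentedGroup.ext fun s => ?_
    change F (ψ (PresentedGroup.mk _ (FreeGroup.of s))) = i (PresentedGroup.of s)
    rw [hψ, FreeGroup.lift_apply_of]
    unfold genWord
    split_ifs with h
    · rw [hFJ, h]
    · rw [map_mul, map_mul, hF _ (gen_mem_vars.mpr s.2), hF _ (gen_mem_vars.mpr s.2), hfg]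
      simp [genVal]
  intro x y hxy
  apply hi
  rw [← key]
  exact congrArg F hxy

end WheelSystem

/-! ### The theorem. -/

open WheelSystem in
theorem theorem4p1 :
    ∃ (C : ℕ) (p : Polynomial ℕ) (T : Turing.TM2ComputableAux PresSymbol SysSymbol),
      (∀ k, Finite (T.tm.Γ k)) ∧
      ∀ P : FinPres, P.IsOverZ2 →
        ∃ (m n : ℕ) (M : Matrix (Fin m) (Fin n) (ZMod 2)) (c : Fin m → ZMod 2)
          (φ : FreeGroup (Fin P.numGens) →* FreeGroup (Option (Fin n))),
          -- `φ` maps `J` to `J` and descends to an injection of `G` into the solution group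
          φ (FreeGroup.of P.J) = LinSys.J ∧
          (∃ ψ : P.Grp →* LinSys.SolGroup M c, Function.Injective ψ ∧
            ∀ w, ψ (PresentedGroup.mk P.relSet w) =
              PresentedGroup.mk (LinSys.solRels M c) (φ w)) ∧
          -- length and area bounds
          (∀ w, (φ w).norm ≤ 4 * w.norm) ∧
          (∀ w, PresentedGroup.mk P.relSet w = 1 →
            wordArea (LinSys.solRels M c) (φ w) ≤ C * (P.size * wordArea P.relSet w)) ∧
          -- shape of the system
          (∀ i, (Finset.univ.filter fun j => M i j ≠ 0).card = 3) ∧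
          m ≤ C * P.size ∧ n ≤ C * P.size ∧
          -- construction in time polynomial in the size of the presentation
          ConstructsInTime T P M c (p.eval P.size) := by
  -- The constant `74` is that of `lift_rel`; it also exceeds what the numbers of equations and
  -- variables need.
  refine ⟨74, Polynomial.C 50000 * Polynomial.X ^ 2, constructor, finite_alphabet,
    fun P hP => ?_⟩
  have hV := nodup_vars P.numGens P.tokens.length
  have hR := rows_wf P.J.2 (index_lt_of_mem_tokens P)
  have hrels := rels_ne_nil hP
  have hsize : P.numGens ≤ P.size ∧ 1 ≤ P.numGens := ⟨Nat.le_add_right _ _, P.J.pos⟩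
  have hB := length_tokens_le P
  refine ⟨_, _, matrix (vars P.numGens P.tokens.length) (rows P.J P.tokens),
    vector (rows P.J P.tokens), FreeGroup.lift (genWord _ P.J), ?_, exists_embedding P hP,
    ?_, ?_, card_matrix hV hR, ?_, ?_, ?_⟩
  · rw [FreeGroup.lift_apply_of, genWord, if_pos rfl]
  · intro w
    have := norm_lift_le _ (norm_genWord_le (vars P.numGens P.tokens.length) P.J) w
    omega
  · intro w hw
    obtain ⟨r, hr⟩ := List.exists_mem_of_ne_nil _ hrels
    obtain ⟨h1, h2⟩ := wordArea_spec ⟨r, hr⟩ hw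
    have S := closeSol hV hR
    have h3 := close_of_isConjProduct _ (fun r hr => S.lift_rel hr) h2
    rw [← mul_assoc]
    have h4 : 1 ≤ P.size * wordArea P.relSet w := Nat.mul_pos (by omega) h1
    exact wordArea_le_of_close ⟨_, LinSys.SolRel.sq_J⟩ (by rw [mul_assoc]; omega) h3
  · have := length_rows_le P.J P.tokens
    omega
  · rw [length_vars]
    omega
  · simpa using constructor_constructsInTime P hrels
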